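/- **Proposition 4.1.** Let $d\ge 3$ and let $\mathfrak g(x)=\tilde{\mathfrak g}(|x|)=c_d|x|^{2-d}$, $c_d=\frac{\Gamma(d/2-1)}{4\pi^{d/2}}$, be the Coulomb potential on $\mathbb R^d$. For pairwise distinct points $x_1,\dots,x_N\in\mathbb R^d$ ($N\ge1$), $\underline x_N=(x_1,\dots,x_N)$, and a probability measure $\mu$ put $$\mathfrak F_N^{avg}(\underline x_N,\mu)=\frac1{N^2}\int_{(\mathbb R^d)^2\setminus\Delta_2}\mathfrak g(x-y)\,d\Big(\sum_{i=1}^N\delta_{x_i}-N\mu\Big)(x)\,d\Big(\sum_{i=1}^N\delta_{x_i}-N\mu\Big)(y),\qquad H_{N,d}=\frac1{2N^2}\sum_{1\le i\ne j\le N}\mathfrak g(x_i-x_j),$$ where $\Delta_2=\{(x,y)\in(\mathbb R^d)^2:x=y\}$. Let $\ln_+=\max\{\ln,0\}$ (with $\ln_+0=0$) and $\|v\|_{LL}=\sup_{0<|x-y|\le e^{-1}}\frac{|v(x)-v(y)|}{|x-y|\,|\ln|x-y||}$. There are constants $C_d,\varepsilon_{0}>0$ depending only on $d$, and for every $p\in(d,\infty]$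 a constant $C_{p,d}>0$ depending only on $p,d$, such that the following holds. Let $\mu$ be a probability measure with a density in $L^p(\mathbb R^d)$ (also denoted by $\mu$), let $v:\mathbb R^d\to\mathbb R^d$ be bounded and continuous with $\|v\|_{LL}<\infty$, let $N\ge1$, and let $x_1,\dots,x_N\in\mathbb R^d$ be pairwise distinct. Then the integral above and the one below converge absolutely, and for all $\varepsilon_1,\dots,\varepsilon_4$ with $0<2\varepsilon_1<\varepsilon_2<\varepsilon_3,\varepsilon_4<\varepsilon_0$, $$\begin{aligned} &\frac1{N^2}\left|\int_{(\mathbb R^d)^2\setminus\Delta_2}(v(x)-v(y))\cdot\nabla\mathfrak g(x-y)\,d\Big(\sum_{i=1}^N\delta_{x_i}-N\mu\Big)(x)\,d\Big(\sum_{i=1}^N\delta_{x_i}-N\mu\Big)(y)\right|\\ &\le C_d\bigg[\|v\|_{LL}\big(\ln_+(N^2H_{N,d})+\ln\varepsilon_2^{-1}\big)\mathfrak F_N^{avg}(\underline x_N,\mu) +\frac{\|v\|_{LL}\big(\ln(\varepsilon_2^{-1})\tilde{\mathfrak g}(\varepsilon_1)+\ln_+(N^2H_{N,d})\tilde{\mathfrak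 g}(\varepsilon_3)\big)}{N}\\ &\quad+C_{p,d}\|v\|_{LL}\|\mu\|_{L^p}\Big(\ln(\varepsilon_2^{-1})\varepsilon_4^{\,2-\frac dp}+\ln_+(N^2H_{N,d})\varepsilon_3^{\,2-\frac dp}\Big)\\ &\quad+\frac{\varepsilon_1}{\varepsilon_4^{d-1}}\Big(\frac{\|v\|_{L^\infty}}{\varepsilon_4}+\|v\|_{LL}\ln\varepsilon_1^{-1}\Big)+\|v\|_{LL}\|\mu\|_{L^p}^{\theta}\,\varepsilon_1\ln\varepsilon_1^{-1}\\ &\quad+\|v\|_{LL}\,\varepsilon_2\ln(\varepsilon_2^{-1})\Big(\frac1{\varepsilon_3^{d-1}}+\|\mu\|_{L^p}^{\theta}\Big) +\|v\|_{L^\infty}\Big(\|\mu\|_{L^p}\varepsilon_1^{1-\frac dp}+\mathbf 1_{p=\infty}\|\mu\|_{L^\infty}\varepsilon_1\ln\varepsilon_1^{-1}\Big)\bigg], \end{aligned}$$ where $\theta=\frac{d-1}{d(1-1/p)}$ and $1/\infty=0$. -/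

import Mathlib

open MeasureTheory
open scoped ENNReal BoundedContinuousFunction

noncomputable section

namespace CoulombMF

/-- The Euclidean space `ℝ^d`. -/
abbrev Space (d : ℕ) : Type := EuclideanSpace ℝ (Fin d)

/-- The normalization constant `c_d = Γ(d/2 - 1) / (4 π^{d/2})` (for `d ≥ 3`), for which
`c_d |x|^{2-d}` is the fundamental solution of `-Δ` on `ℝ^d`. -/
def coulombConst (d : ℕ) : ℝ :=
  Real.Gamma ((d : ℝ) / 2 - 1) / (4 * Real.pi ^ ((d : ℝ) / 2))

/-- The radial profile `r ↦ c_d r^{2-d}` of the Coulomb potential, `d ≥ 3`. -/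
def coulombRadial (d : ℕ) (r : ℝ) : ℝ :=
  coulombConst d * r ^ ((2 : ℝ) - (d : ℝ))

/-- The Coulomb potential `g(x) = c_d |x|^{2-d}` on `ℝ^d`, `d ≥ 3`. Its value at the origin is
irrelevant: below it is only integrated off the diagonal. -/
def coulomb (d : ℕ) (x : Space d) : ℝ :=
  coulombRadial d ‖x‖

/-- The `N`-body Coulomb Hamiltonian `(1/2) ∑_{i ≠ j} a_i a_j g(x_i - x_j)` with intensities
`a_1, …, a_N`. -/
def hamiltonian {d N : ℕ} (a : Fin N → ℝ) (x : Fin N → Space d) : ℝ :=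
  (1 / 2) * ∑ i, ∑ j ∈ Finset.univ.erase i, a i * a j * coulomb d (x i - x j)

/-- The Hamiltonian in the mean-field regime, in which all the intensities are `1/N`. -/
def meanFieldHamiltonian {d N : ℕ} (x : Fin N → Space d) : ℝ :=
  hamiltonian (fun _ => 1 / (N : ℝ)) x

/-- The density of a measure on `ℝ^d` with respect to Lebesgue measure, as a real function. -/
def density {d : ℕ} (μ : Measure (Space d)) (x : Space d) : ℝ :=
  (μ.rnDeriv volume x).toReal

/-- `μ` is absolutely continuous and its density is in `L^p(ℝ^d)`. -/
def HasLpDensity {d : ℕ} (μ : Measure (Space d)) (p : ℝ≥0∞) : Prop :=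
  μ ≪ volume ∧ MemLp (density μ) p volume

/-- The `L^p(ℝ^d)` norm of the density of `μ`. -/
def densityNorm {d : ℕ} (μ : Measure (Space d)) (p : ℝ≥0∞) : ℝ :=
  (eLpNorm (density μ) p volume).toReal

/-- The set of the log-Lipschitz difference quotients `|v(x)-v(y)| / (|x-y| |ln|x-y||)`,
`0 < |x-y| ≤ e^{-1}`. -/
def logLipQuotients {d : ℕ} (v : Space d → Space d) : Set ℝ :=
  {q | ∃ x y : Space d, 0 < ‖x - y‖ ∧ ‖x - y‖ ≤ Real.exp (-1) ∧
    q = ‖v x - v y‖ / (‖x - y‖ * |Real.log ‖x - y‖|)}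

/-- `v` is log-Lipschitz: its log-Lipschitz semi-norm is finite. -/
def IsLogLipschitz {d : ℕ} (v : Space d → Space d) : Prop :=
  BddAbove (logLipQuotients v)

/-- The log-Lipschitz semi-norm. -/
def logLipNorm {d : ℕ} (v : Space d → Space d) : ℝ :=
  sSup (logLipQuotients v)

/-- The off-diagonal part `(ℝ^d)^2 ∖ Δ_2` of `ℝ^d × ℝ^d`. -/
def offDiag (d : ℕ) : Set (Space d × Space d) :=
  (Set.diagonal (Space d))ᶜ

/-- `f` is absolutely integrable off the diagonal against the square of `ρ + σ`, hence against
each of the four product measures in the expansion of `(ρ - σ) ⊗ (ρ - σ)`. -/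
def OffDiagIntegrable {d : ℕ} (ρ σ : Measure (Space d)) (f : Space d × Space d → ℝ) : Prop :=
  IntegrableOn f (offDiag d) ((ρ + σ).prod (ρ + σ))

/-- The integral `∫_{(ℝ^d)^2 ∖ Δ_2} f(x,y) d(ρ-σ)(x) d(ρ-σ)(y)`, where `ρ - σ` is the difference
of two finite measures. -/
def offDiagIntegral {d : ℕ} (ρ σ : Measure (Space d)) (f : Space d × Space d → ℝ) : ℝ :=
  (∫ z in offDiag d, f z ∂(ρ.prod ρ)) - (∫ z in offDiag d, f z ∂(ρ.prod σ))
    - (∫ z in offDiag d, f z ∂(σ.prod ρ)) + (∫ z in offDiag d, f z ∂(σ.prod σ))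

/-- The sum `∑_i δ_{x_i}` of the point masses. -/
def pointMasses {d N : ℕ} (x : Fin N → Space d) : Measure (Space d) :=
  ∑ i, Measure.dirac (x i)

/-- The interaction kernel `(x, y) ↦ g(x - y)`. -/
def energyKernel (d : ℕ) (z : Space d × Space d) : ℝ :=
  coulomb d (z.1 - z.2)

/-- The commutator kernel `(x, y) ↦ (v(x) - v(y)) · ∇g(x - y)`. -/
def commutatorKernel {d : ℕ} (v : Space d → Space d) (z : Space d × Space d) : ℝ :=
  inner ℝ (v z.1 - v z.2) (gradient (coulomb d) (z.1 - z.2))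

/-- The modulated energy `F_N(x, μ)`: the off-diagonal Coulomb energy of `∑_i δ_{x_i} - N μ`. -/
def modulatedEnergy {d N : ℕ} (x : Fin N → Space d) (μ : Measure (Space d)) : ℝ :=
  offDiagIntegral (pointMasses x) ((N : ℝ≥0∞) • μ) (energyKernel d)

/-- The averaged modulated energy `F_N^avg = F_N / N^2`. -/
def modulatedEnergyAvg {d N : ℕ} (x : Fin N → Space d) (μ : Measure (Space d)) : ℝ :=
  modulatedEnergy x μ / (N : ℝ) ^ 2

/-- `ln_+ t = max {ln t, 0}`. -/
def lnPlus (t : ℝ) : ℝ :=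
  max (Real.log t) 0

/-- The reciprocal `1/p` of a Lebesgue exponent as a real number, with `1/∞ = 0`. -/
def recip (p : ℝ≥0∞) : ℝ :=
  (p⁻¹).toReal

end CoulombMF

end

/-!
# The commutator estimate for log-Lipschitz transport of Coulomb charges

Let `g` be the Coulomb potential, `f` the signed charge `∑ δ_{x_i} - N μ`, and let `p_t` be the heat
kernel, so that `g = ∫_0^∞ p_t dt` and `G_s = ∫_s^∞ p_t dt` is the interaction smeared by the heat
flow (`heatPot`), with gradient `heatField`.

*Smeared charges.* Give every charge the Gaussian profile `p_s`. The commutator of `v` in the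
smeared charge is `∫ T : ∇v`, where `T` is the stress-energy tensor of the field
`V = f * ∇G_s`, since `div V = -f * p_s` and `DV` is symmetric. Hence it is at most a multiple of
`‖∇v‖_∞ ∫ |V|²`, and by the semigroup property `∫ |V|²` is the energy of `f` with interaction
`G_{2s}`. This is `smearedCommutator_form_le`, which has no error terms; smearing produces them only
in the comparison of kernels: `abs_smearedCommutator_sub_le` shows that at distance `r` the kernel
changes by `‖∇v‖_∞ r^{2-d} min(1, √s / r)`.

*Coercivity.* The difference `g - G_τ` is positive, comparable to `g` at distances `r ≤ √τ` and
rapidly decaying beyond. Splitting `g = (g - G_τ) + G_τ` in the modulated energy bounds both the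
smeared energy and the Coulomb energy of the pairs closer than `ε` by the modulated energy plus the
self-energy `G_τ(0)` of the points plus a term from `μ` (`le_modulatedEnergy`). Choosing
`√τ = K ε` with `K` large makes the self-energy at most half of `g(ε)`, which leaves the other half
of the term `g(ε) / N` of the estimate as a gain. All dependence on `p` enters through the bound
`T ε^{d - d/p}` for the potentials of `μ` with respect to short-range kernels at scale `ε`
(`HasTailBound`, `exists_hasTailBound`), which is Hölder's inequality and scaling.

*Log-Lipschitz fields.* Mollify `v` at the scale `ε₂^d`, so that the mollified field `u` has
Lipschitz constant of order `ln ε₂⁻¹` and `v - u` is of size `ε₂^d ln ε₂⁻¹`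
(`exists_mollification`). The Lipschitz estimate applies to `u`. For `v - u` the log-Lipschitz bound
is used at short distances, where `g(x_i - x_j) ≤ 2 N² H` allows the logarithm of the distance of a
pair to be replaced by `ln_+ (N² H)`, and the sup bound at long distances, where the power `ε₂^d`
beats the singularity `r^{1-d}` of the field. The remaining terms on the right-hand side of the
estimate are nonnegative.
-/

namespace CoulombMF

open Set Filter Topology Real

/-! ### Time integrals of Gaussian profiles -/

/-- The integral `∫_s^∞ t^{-b} e^{-u/(4t)} dt`. With `u = |w|²` and suitable `b` it is, up to
constants, the Coulomb potential smeared by the heat kernel at time `s`, its gradient or its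
Hessian. -/
noncomputable def timeIntegral (b s u : ℝ) : ℝ :=
  ∫ t in Ioi s, t ^ (-b) * exp (-u / (4 * t))

lemma measurable_timeIntegrand (b u : ℝ) :
    Measurable fun t : ℝ => t ^ (-b) * exp (-u / (4 * t)) := by
  fun_prop

lemma integrableOn_timeIntegrand {b s : ℝ} (u : ℝ) (hb : 1 < b) (hs : 0 < s) :
    IntegrableOn (fun t : ℝ => t ^ (-b) * exp (-u / (4 * t))) (Ioi s) := by
  have h : IntegrableOn (fun t : ℝ => t ^ (-b) * exp (|u| / (4 * s))) (Ioi s) :=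
    (integrableOn_Ioi_rpow_of_lt (by linarith) hs).mul_const _
  refine h.mono' (measurable_timeIntegrand b u).aestronglyMeasurable ?_
  filter_upwards [ae_restrict_mem measurableSet_Ioi] with t ht
  have ht0 : 0 < t := hs.trans ht
  have h1 : -u / (4 * t) ≤ |u| / (4 * s) :=
    calc -u / (4 * t) ≤ |u| / (4 * t) := by gcongr; exact neg_le_abs u
      _ ≤ |u| / (4 * s) := by gcongr; exact (show s < t from ht).le
  rw [norm_of_nonneg (by positivity)]
  gcongr

lemma integrableOn_timeIntegrand_zero {b u : ℝ} (hb : 1 < b) (hu : 0 < u) :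
    IntegrableOn (fun t : ℝ => t ^ (-b) * exp (-u / (4 * t))) (Ioi 0) ∧
      timeIntegral b 0 u = (4 / u) ^ (b - 1) * Gamma (b - 1) := by
  have hg := integral_rpow_mul_exp_neg_mul_Ioi (a := b - 1) (r := u / 4) (by linarith)
    (by positivity)
  have hpos : 0 < Gamma (b - 1) := Gamma_pos_of_pos (by linarith)
  have hint : IntegrableOn (fun t : ℝ => t ^ (b - 1 - 1) * exp (-(u / 4 * t))) (Ioi 0) :=
    .of_integral_ne_zero (by rw [hg]; positivity)
  have hcongr : ∀ x ∈ Ioi (0 : ℝ), x ^ ((-1 : ℝ) - 1) *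
      ((x ^ (-1 : ℝ)) ^ (b - 1 - 1) * exp (-(u / 4 * x ^ (-1 : ℝ)))) =
      x ^ (-b) * exp (-u / (4 * x)) := by
    intro x hx
    have hx : 0 < x := hx
    rw [← rpow_mul hx.le, ← mul_assoc, ← rpow_add hx, rpow_neg_one]
    congr 2
    · ring
    · field_simp
  constructor
  · have := (integrableOn_Ioi_comp_rpow_iff' _ (p := -1) (by norm_num)).2 hint
    exact this.congr_fun hcongr measurableSet_Ioi
  · have := integral_comp_rpow_Ioi
      (fun t : ℝ => t ^ (b - 1 - 1) * exp (-(u / 4 * t))) (p := -1) (by norm_num)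
    rw [hg] at this
    rw [timeIntegral, ← setIntegral_congr_fun measurableSet_Ioi hcongr]
    simpa [smul_eq_mul] using this

lemma timeIntegral_nonneg {b s : ℝ} (u : ℝ) (hs : 0 ≤ s) : 0 ≤ timeIntegral b s u :=
  setIntegral_nonneg measurableSet_Ioi fun t ht => by
    have : 0 < t := hs.trans_lt ht
    positivity

lemma timeIntegral_le_zero {b s u : ℝ} (hb : 1 < b) (hs : 0 ≤ s) (hu : 0 < u) :
    timeIntegral b s u ≤ (4 / u) ^ (b - 1) * Gamma (b - 1) := by
  obtain ⟨h1, h2⟩ := integrableOn_timeIntegrand_zero hb hu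
  rw [← h2]
  refine setIntegral_mono_set h1 ?_ (Ioi_subset_Ioi hs).eventuallyLE
  filter_upwards [ae_restrict_mem measurableSet_Ioi] with t ht
  have : 0 < t := ht
  simp only [Pi.zero_apply]; positivity

lemma timeIntegral_le {b s u : ℝ} (hb : 1 < b) (hs : 0 < s) (hu : 0 ≤ u) :
    timeIntegral b s u ≤ s ^ (1 - b) / (b - 1) := by
  have h := integral_Ioi_rpow_of_lt (a := -b) (by linarith) hs
  have h2 : s ^ (1 - b) / (b - 1) = ∫ t in Ioi s, t ^ (-b) := by
    rw [h, show -b + 1 = 1 - b by ring, neg_div, ← div_neg]; congr 1; ring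
  rw [h2]
  refine setIntegral_mono_on (integrableOn_timeIntegrand u hb hs)
    (integrableOn_Ioi_rpow_of_lt (by linarith) hs) measurableSet_Ioi fun t ht => ?_
  have ht0 : 0 < t := hs.trans ht
  have : exp (-u / (4 * t)) ≤ 1 := by
    rw [exp_le_one_iff]; exact div_nonpos_of_nonpos_of_nonneg (by linarith) (by positivity)
  exact mul_le_of_le_one_right (by positivity) this

lemma timeIntegral_at_zero {b s : ℝ} (hb : 1 < b) (hs : 0 < s) :
    timeIntegral b s 0 = s ^ (1 - b) / (b - 1) := by
  have h := integral_Ioi_rpow_of_lt (a := -b) (by linarith) hs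
  simp only [timeIntegral, neg_zero, zero_div, exp_zero, mul_one]
  rw [h, show -b + 1 = 1 - b by ring, neg_div, ← div_neg]; congr 1; ring

lemma exp_neg_le_rpow {m y : ℝ} (hm : 0 < m) (hy : 0 < y) : exp (-y) ≤ m ^ m * y ^ (-m) := by
  have h1 : y / m ≤ exp (y / m) := by linarith [add_one_le_exp (y / m)]
  have h2 : (y / m) ^ m ≤ exp y := by
    calc (y / m) ^ m ≤ exp (y / m) ^ m := by gcongr
      _ = exp y := by rw [← exp_mul]; congr 1; field_simp
  rw [div_rpow hy.le hm.le, div_le_iff₀ (by positivity)] at h2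
  rw [exp_neg, rpow_neg hy.le, ← div_eq_mul_inv, inv_eq_one_div,
    div_le_div_iff₀ (exp_pos _) (by positivity)]
  linarith

lemma timeIntegral_sub {b τ u : ℝ} (hb : 1 < b) (hτ : 0 ≤ τ) (hu : 0 < u) :
    timeIntegral b 0 u - timeIntegral b τ u =
      ∫ t in Ioc 0 τ, t ^ (-b) * exp (-u / (4 * t)) := by
  have h := (integrableOn_timeIntegrand_zero hb hu).1
  have := setIntegral_union (Ioc_disjoint_Ioi_same (a := (0 : ℝ)) (b := τ)) measurableSet_Ioi
    (h.mono_set Ioc_subset_Ioi_self) (h.mono_set (Ioi_subset_Ioi hτ))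
  rw [Ioc_union_Ioi_eq_Ioi hτ] at this
  simp only [timeIntegral]
  rw [this]; ring

lemma timeIntegral_sub_nonneg {b τ u : ℝ} (hb : 1 < b) (hτ : 0 ≤ τ) (hu : 0 < u) :
    0 ≤ timeIntegral b 0 u - timeIntegral b τ u := by
  rw [timeIntegral_sub hb hτ hu]
  exact setIntegral_nonneg measurableSet_Ioc fun t ht => by
    have : 0 < t := ht.1
    positivity

lemma timeIntegral_sub_le {b m τ u : ℝ} (hb : 1 < b) (hm : b - 1 < m) (hτ : 0 ≤ τ)
    (hu : 0 < u) :
    timeIntegral b 0 u - timeIntegral b τ u ≤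
      (4 * m) ^ m / (m - b + 1) * τ ^ (m - b + 1) * u ^ (-m) := by
  have hm0 : 0 < m := by linarith
  rw [timeIntegral_sub hb hτ hu]
  have hint : IntervalIntegrable (fun t : ℝ => t ^ (m - b)) volume 0 τ :=
    intervalIntegral.intervalIntegrable_rpow' (by linarith)
  have hint' : IntegrableOn (fun t : ℝ => (4 * m) ^ m * u ^ (-m) * t ^ (m - b)) (Ioc 0 τ) :=
    ((intervalIntegrable_iff_integrableOn_Ioc_of_le hτ).1 hint).const_mul _
  have hval : ∫ t in Ioc 0 τ, (4 * m) ^ m * u ^ (-m) * t ^ (m - b) =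
      (4 * m) ^ m / (m - b + 1) * τ ^ (m - b + 1) * u ^ (-m) := by
    rw [integral_const_mul, ← intervalIntegral.integral_of_le hτ,
      integral_rpow (Or.inl (by linarith)), zero_rpow (by linarith)]
    ring
  rw [← hval]
  refine setIntegral_mono_on
    ((integrableOn_timeIntegrand_zero hb hu).1.mono_set Ioc_subset_Ioi_self) hint'
    measurableSet_Ioc fun t ht => ?_
  have ht0 : 0 < t := ht.1
  have h1 := exp_neg_le_rpow hm0 (show 0 < u / (4 * t) by positivity)
  rw [← neg_div] at h1
  calc t ^ (-b) * exp (-u / (4 * t)) ≤ t ^ (-b) * (m ^ m * (u / (4 * t)) ^ (-m)) := by gcongr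
    _ = (4 * m) ^ m * u ^ (-m) * t ^ (m - b) := by
      rw [div_rpow hu.le (by positivity), mul_rpow (by norm_num) ht0.le,
        mul_rpow (by norm_num) hm0.le, sub_eq_add_neg, rpow_add ht0,
        rpow_neg (x := 4) (by norm_num), rpow_neg ht0.le m]
      field_simp

/-- On the scale `u ≤ τ` at least a fixed fraction of the full time integral comes from `t ≤ τ`. -/
lemma le_timeIntegral_sub {b τ u : ℝ} (hb : 1 < b) (hu : 0 < u) (huτ : u ≤ τ) :
    exp (-1) / 2 * u ^ (1 - b) ≤ timeIntegral b 0 u - timeIntegral b τ u := by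
  rw [timeIntegral_sub hb (hu.le.trans huτ) hu]
  have hint := (integrableOn_timeIntegrand_zero hb hu).1
  have hsub : Ioc (u / 2) u ⊆ Ioc 0 τ := Ioc_subset_Ioc (by positivity) huτ
  have h1 : ∫ t in Ioc (u / 2) u, t ^ (-b) * exp (-u / (4 * t)) ≤
      ∫ t in Ioc 0 τ, t ^ (-b) * exp (-u / (4 * t)) := by
    refine setIntegral_mono_set (hint.mono_set Ioc_subset_Ioi_self) ?_ hsub.eventuallyLE
    filter_upwards [ae_restrict_mem measurableSet_Ioc] with t ht
    have : 0 < t := ht.1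
    simp only [Pi.zero_apply]; positivity
  refine le_trans ?_ h1
  have h2 : ∫ _t in Ioc (u / 2) u, u ^ (-b) * exp (-1) = exp (-1) / 2 * u ^ (1 - b) := by
    rw [setIntegral_const, smul_eq_mul, measureReal_def, volume_Ioc,
      ENNReal.toReal_ofReal (by linarith), show (1 - b) = 1 + -b by ring, rpow_add hu, rpow_one]
    ring
  rw [← h2]
  refine setIntegral_mono_on (integrableOn_const (by simp)) (hint.mono_set
    (hsub.trans Ioc_subset_Ioi_self)) measurableSet_Ioc fun t ht => ?_
  have ht0 : 0 < t := by linarith [ht.1]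
  gcongr ?_ * ?_
  · exact rpow_le_rpow_of_nonpos ht0 ht.2 (by linarith)
  · rw [exp_le_exp, le_div_iff₀ (by positivity)]; linarith [ht.1]

lemma hasDerivAt_timeIntegral {b s : ℝ} (u : ℝ) (hb : 1 < b) (hs : 0 < s) :
    HasDerivAt (timeIntegral b s) (-(1 / 4) * timeIntegral (b + 1) s u) u := by
  have key := hasDerivAt_integral_of_dominated_loc_of_deriv_le (μ := volume.restrict (Ioi s))
    (F := fun u t => t ^ (-b) * exp (-u / (4 * t)))
    (F' := fun u t => -(1 / 4) * (t ^ (-(b + 1)) * exp (-u / (4 * t))))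
    (bound := fun t => t ^ (-(b + 1)) * exp (-(-(|u| + 1)) / (4 * t)))
    (x₀ := u) (s := Metric.ball u 1) (Metric.ball_mem_nhds u one_pos)
    (Eventually.of_forall fun x => (measurable_timeIntegrand b x).aestronglyMeasurable)
    (integrableOn_timeIntegrand u hb hs)
    ((measurable_timeIntegrand (b + 1) u).const_mul _).aestronglyMeasurable ?_
    (integrableOn_timeIntegrand _ (by linarith) hs) ?_
  · have h2 := key.2
    rw [integral_const_mul] at h2
    exact h2
  · filter_upwards [ae_restrict_mem measurableSet_Ioi] with t ht x hx
    have ht0 : 0 < t := hs.trans ht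
    have hx' : -x ≤ -(-(|u| + 1)) := by
      rw [Metric.mem_ball, Real.dist_eq] at hx
      have := neg_abs_le (x - u)
      linarith [neg_abs_le u]
    rw [norm_mul, norm_neg, norm_of_nonneg (by norm_num : (0 : ℝ) ≤ 1 / 4),
      norm_of_nonneg (by positivity)]
    have : t ^ (-(b + 1)) * exp (-x / (4 * t)) ≤
        t ^ (-(b + 1)) * exp (-(-(|u| + 1)) / (4 * t)) := by gcongr
    have h0 : 0 ≤ t ^ (-(b + 1)) * exp (-x / (4 * t)) := by positivity
    linarith
  · filter_upwards [ae_restrict_mem measurableSet_Ioi] with t ht x _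
    have ht0 : 0 < t := hs.trans ht
    have h1 : HasDerivAt (fun x : ℝ => -x / (4 * t)) (-1 / (4 * t)) x :=
      (hasDerivAt_id x).neg.div_const _
    refine (h1.exp.const_mul (t ^ (-b))).congr_deriv ?_
    rw [neg_add, rpow_add ht0, rpow_neg_one]
    field_simp

lemma continuous_timeIntegral {b s : ℝ} (hb : 1 < b) (hs : 0 < s) :
    Continuous (timeIntegral b s) :=
  continuous_iff_continuousAt.2 fun u => (hasDerivAt_timeIntegral u hb hs).continuousAt

/-- Integration by parts in time; for `b = d / 2` this is the heat equation integrated in time. -/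
lemma timeIntegral_heat {b s : ℝ} (u : ℝ) (hb : 0 < b) (hs : 0 < s) :
    b * timeIntegral (b + 1) s u - u / 4 * timeIntegral (b + 2) s u =
      s ^ (-b) * exp (-u / (4 * s)) := by
  have i1 := integrableOn_timeIntegrand u (b := b + 1) (by linarith) hs
  have i2 := integrableOn_timeIntegrand u (b := b + 2) (by linarith) hs
  have hd : ∀ t ∈ Ici s, HasDerivAt (fun t : ℝ => t ^ (-b) * exp (-u / (4 * t)))
      (-(b * (t ^ (-(b + 1)) * exp (-u / (4 * t))) -
        u / 4 * (t ^ (-(b + 2)) * exp (-u / (4 * t))))) t := by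
    intro t ht
    have ht0 : 0 < t := hs.trans_le ht
    have h1 : HasDerivAt (fun t : ℝ => -u / (4 * t)) (u / (4 * t ^ 2)) t := by
      have := ((hasDerivAt_id t).const_mul 4).fun_inv (by simpa using ht0.ne') |>.const_mul (-u)
      refine this.congr_deriv ?_
      simp only [id]; field_simp
    have h2 := (hasDerivAt_rpow_const (x := t) (p := -b) (Or.inl ht0.ne')).mul h1.exp
    refine h2.congr_deriv ?_
    rw [show -(b + 1) = -b - 1 by ring, show -(b + 2) = -b + -(2 : ℕ) by push_cast; ring,
      rpow_add ht0, rpow_neg ht0.le ((2 : ℕ) : ℝ), rpow_natCast]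
    field_simp
    ring
  have ht : Tendsto (fun t : ℝ => t ^ (-b) * exp (-u / (4 * t))) atTop (𝓝 (0 * exp 0)) := by
    refine (tendsto_rpow_neg_atTop hb).mul ((continuous_exp.tendsto 0).comp ?_)
    exact (tendsto_const_nhds (x := -u)).div_atTop
      (tendsto_id.const_mul_atTop (by norm_num : (0 : ℝ) < 4))
  have := integral_Ioi_of_hasDerivAt_of_tendsto' hd
    ((i1.const_mul b).sub (i2.const_mul (u / 4))).neg ht
  rw [integral_neg, integral_sub (i1.const_mul b) (i2.const_mul (u / 4)), integral_const_mul,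
    integral_const_mul] at this
  simp only [timeIntegral]
  linarith

/-! ### The heat kernel and the Coulomb field smeared by it -/

/-- The constant `(4π)^{-d/2}` of the heat kernel. -/
noncomputable def heatConst (d : ℕ) : ℝ := (4 * π) ^ (-((d : ℝ) / 2))

lemma heatConst_pos (d : ℕ) : 0 < heatConst d := by unfold heatConst; positivity

/-- The heat kernel `(4πt)^{-d/2} e^{-|w|²/(4t)}` on `ℝ^d`. -/
noncomputable def heatKernel {d : ℕ} (t : ℝ) (w : Space d) : ℝ :=
  heatConst d * (t ^ (-((d : ℝ) / 2)) * exp (-‖w‖ ^ 2 / (4 * t)))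

/-- The Coulomb potential smeared by the heat kernel at time `s`, that is `∫_s^∞ p_t(w) dt`. -/
noncomputable def heatPot {d : ℕ} (s : ℝ) (w : Space d) : ℝ :=
  heatConst d * timeIntegral ((d : ℝ) / 2) s (‖w‖ ^ 2)

/-- The gradient of the smeared Coulomb potential `heatPot s`. -/
noncomputable def heatField {d : ℕ} (s : ℝ) (w : Space d) : Space d :=
  (-(heatConst d / 2) * timeIntegral ((d : ℝ) / 2 + 1) s (‖w‖ ^ 2)) • w

variable {d : ℕ}

lemma heatKernel_nonneg {t : ℝ} (ht : 0 ≤ t) (w : Space d) : 0 ≤ heatKernel t w := by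
  have := heatConst_pos d
  unfold heatKernel; positivity

lemma heatKernel_pos {t : ℝ} (ht : 0 < t) (w : Space d) : 0 < heatKernel t w := by
  have := heatConst_pos d
  unfold heatKernel; positivity

lemma heatKernel_neg (t : ℝ) (w : Space d) : heatKernel t (-w) = heatKernel t w := by
  simp [heatKernel]

lemma heatField_neg (s : ℝ) (w : Space d) : heatField s (-w) = -heatField s w := by
  simp [heatField]

lemma continuous_heatKernel (t : ℝ) : Continuous (heatKernel (d := d) t) := by
  unfold heatKernel; fun_prop

lemma heatKernel_eq {t : ℝ} (ht : 0 < t) (w : Space d) :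
    heatKernel t w = (4 * π * t) ^ (-((d : ℝ) / 2)) * exp (-(1 / (4 * t)) * ‖w‖ ^ 2) := by
  rw [heatKernel, heatConst, mul_rpow (by positivity) ht.le, mul_assoc]
  congr 3
  field_simp

lemma integral_heatKernel {t : ℝ} (ht : 0 < t) : ∫ w : Space d, heatKernel t w = 1 := by
  simp_rw [heatKernel_eq ht]
  rw [integral_const_mul, GaussianFourier.integral_rexp_neg_mul_sq_norm (by positivity),
    finrank_euclideanSpace_fin, one_div, div_inv_eq_mul, show π * (4 * t) = 4 * π * t by ring,
    ← rpow_add (by positivity), neg_add_cancel, rpow_zero]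

lemma integrable_heatKernel {t : ℝ} (ht : 0 < t) : Integrable (heatKernel (d := d) t) :=
  .of_integral_ne_zero (by rw [integral_heatKernel ht]; exact one_ne_zero)

/-- Moments of the heat kernel are controlled by the heat kernel at twice the time. -/
lemma norm_pow_mul_heatKernel_le {k : ℕ} (hk : 0 < k) {s : ℝ} (hs : 0 < s) (w : Space d) :
    ‖w‖ ^ k * heatKernel s w ≤
      2 ^ ((d : ℝ) / 2) * (4 * k) ^ ((k : ℝ) / 2) * s ^ ((k : ℝ) / 2) *
        heatKernel (2 * s) w := by
  have hκ := heatConst_pos d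
  have hk' : (0 : ℝ) < k := by exact_mod_cast hk
  rcases eq_or_ne w 0 with rfl | hw
  · have := heatKernel_nonneg (d := d) (t := 2 * s) (by positivity) 0
    rw [norm_zero, zero_pow hk.ne', zero_mul]; positivity
  have hw : 0 < ‖w‖ := norm_pos_iff.2 hw
  have h1 := exp_neg_le_rpow (m := (k : ℝ) / 2) (y := ‖w‖ ^ 2 / (8 * s)) (by positivity)
    (by positivity)
  have h2 : ‖w‖ ^ k * exp (-(‖w‖ ^ 2 / (8 * s))) ≤ (4 * k) ^ ((k : ℝ) / 2) * s ^ ((k : ℝ) / 2) := by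
    refine (mul_le_mul_of_nonneg_left h1 (by positivity)).trans (le_of_eq ?_)
    have h3 : (‖w‖ ^ 2) ^ (-((k : ℝ) / 2)) = (‖w‖ ^ k)⁻¹ := by
      rw [← rpow_natCast, ← rpow_natCast, ← rpow_mul hw.le, ← rpow_neg hw.le]
      congr 1; push_cast; ring
    rw [div_rpow (sq_nonneg ‖w‖) (by positivity : 0 ≤ 8 * s), h3,
      rpow_neg (by positivity : 0 ≤ 8 * s),
      div_inv_eq_mul, ← mul_rpow (by positivity) hs.le]
    rw [show ‖w‖ ^ k * (((k : ℝ) / 2) ^ ((k : ℝ) / 2) * ((‖w‖ ^ k)⁻¹ * (8 * s) ^ ((k : ℝ) / 2))) =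
      ((k : ℝ) / 2) ^ ((k : ℝ) / 2) * (8 * s) ^ ((k : ℝ) / 2) by field_simp,
      ← mul_rpow (by positivity) (by positivity)]
    congr 1; ring
  have h4 : heatKernel s w =
      2 ^ ((d : ℝ) / 2) * heatKernel (2 * s) w * exp (-(‖w‖ ^ 2 / (8 * s))) := by
    have e1 : exp (-‖w‖ ^ 2 / (4 * s)) =
        exp (-‖w‖ ^ 2 / (4 * (2 * s))) * exp (-(‖w‖ ^ 2 / (8 * s))) := by
      rw [← exp_add]; congr 1; field_simp; ring
    rw [heatKernel, heatKernel, mul_rpow (by norm_num) hs.le, e1,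
      rpow_neg (by norm_num : (0 : ℝ) ≤ 2)]
    have : (0 : ℝ) < 2 ^ ((d : ℝ) / 2) := by positivity
    field_simp
  have h5 := heatKernel_nonneg (d := d) (t := 2 * s) (by positivity) w
  calc ‖w‖ ^ k * heatKernel s w = 2 ^ ((d : ℝ) / 2) * heatKernel (2 * s) w *
        (‖w‖ ^ k * exp (-(‖w‖ ^ 2 / (8 * s)))) := by rw [h4]; ring
    _ ≤ 2 ^ ((d : ℝ) / 2) * heatKernel (2 * s) w *
        ((4 * k) ^ ((k : ℝ) / 2) * s ^ ((k : ℝ) / 2)) := by gcongr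
    _ = _ := by ring

lemma integrable_norm_pow_mul_heatKernel {k : ℕ} (hk : 0 < k) {s : ℝ} (hs : 0 < s) :
    Integrable fun w : Space d => ‖w‖ ^ k * heatKernel s w := by
  refine ((integrable_heatKernel (d := d) (t := 2 * s) (by positivity)).const_mul
    (2 ^ ((d : ℝ) / 2) * (4 * k) ^ ((k : ℝ) / 2) * s ^ ((k : ℝ) / 2))).mono'
    (((continuous_norm.pow k).mul (continuous_heatKernel s)).aestronglyMeasurable) ?_
  refine Eventually.of_forall fun w => ?_
  rw [norm_of_nonneg (mul_nonneg (by positivity) (heatKernel_nonneg hs.le w))]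
  exact norm_pow_mul_heatKernel_le hk hs w

lemma integral_norm_pow_mul_heatKernel_le {k : ℕ} (hk : 0 < k) {s : ℝ} (hs : 0 < s) :
    ∫ w : Space d, ‖w‖ ^ k * heatKernel s w ≤
      2 ^ ((d : ℝ) / 2) * (4 * k) ^ ((k : ℝ) / 2) * s ^ ((k : ℝ) / 2) := by
  have := integral_mono (integrable_norm_pow_mul_heatKernel (d := d) hk hs)
    ((integrable_heatKernel (d := d) (t := 2 * s) (by positivity)).const_mul
    (2 ^ ((d : ℝ) / 2) * (4 * k) ^ ((k : ℝ) / 2) * s ^ ((k : ℝ) / 2)))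
    (norm_pow_mul_heatKernel_le hk hs)
  rwa [integral_const_mul, integral_heatKernel (by positivity), mul_one] at this

lemma integrable_heatKernel_smul {s : ℝ} (hs : 0 < s) :
    Integrable fun w : Space d => heatKernel s w • w := by
  refine (integrable_norm_pow_mul_heatKernel (d := d) one_pos hs).mono'
    ((continuous_heatKernel s).smul continuous_id).aestronglyMeasurable ?_
  refine Eventually.of_forall fun w => ?_
  rw [norm_smul, norm_of_nonneg (heatKernel_nonneg hs.le w), pow_one, mul_comm]

lemma integral_heatKernel_smul (s : ℝ) : ∫ w : Space d, heatKernel s w • w = 0 := by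
  have h := integral_neg_eq_self (fun w : Space d => heatKernel s w • w) volume
  simp only [heatKernel_neg, smul_neg, integral_neg] at h
  have h2 : (2 : ℝ) • ∫ w : Space d, heatKernel s w • w = 0 := by
    rw [two_smul]; nth_rw 1 [← h]; exact neg_add_cancel _
  exact (smul_eq_zero.1 h2).resolve_left two_ne_zero

/-- Completing the square in a product of two heat kernels. -/
lemma heatKernel_mul_heatKernel {t s : ℝ} (ht : 0 < t) (hs : 0 < s) (a b : Space d) :
    heatKernel t a * heatKernel s b = heatKernel (t + s) (a - b) *
      heatKernel (t * s / (t + s)) ((s / (t + s)) • a + (t / (t + s)) • b) := by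
  have hts : 0 < t + s := by positivity
  have e : exp (-‖a‖ ^ 2 / (4 * t)) * exp (-‖b‖ ^ 2 / (4 * s)) =
      exp (-‖a - b‖ ^ 2 / (4 * (t + s))) *
      exp (-‖(s / (t + s)) • a + (t / (t + s)) • b‖ ^ 2 / (4 * (t * s / (t + s)))) := by
    rw [← exp_add, ← exp_add]
    congr 1
    rw [norm_sub_sq_real, norm_add_sq_real, norm_smul, norm_smul, inner_smul_left,
      inner_smul_right, norm_of_nonneg (by positivity), norm_of_nonneg (by positivity)]
    simp only [conj_trivial]
    field_simp
    ring
  have r : t ^ (-((d : ℝ) / 2)) * s ^ (-((d : ℝ) / 2)) =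
      (t + s) ^ (-((d : ℝ) / 2)) * (t * s / (t + s)) ^ (-((d : ℝ) / 2)) := by
    rw [← mul_rpow ht.le hs.le, ← mul_rpow hts.le (by positivity)]
    congr 1; field_simp
  simp only [heatKernel]
  linear_combination (heatConst d ^ 2 * (t ^ (-((d : ℝ) / 2)) * s ^ (-((d : ℝ) / 2)))) * e +
    (heatConst d ^ 2 * (exp (-‖a - b‖ ^ 2 / (4 * (t + s))) *
      exp (-‖(s / (t + s)) • a + (t / (t + s)) • b‖ ^ 2 / (4 * (t * s / (t + s)))))) * r

lemma heatKernel_sub_mul {t s : ℝ} (ht : 0 < t) (hs : 0 < s) (x y z : Space d) :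
    heatKernel t (z - x) * heatKernel s (z - y) = heatKernel (t + s) (x - y) *
      heatKernel (t * s / (t + s)) (z - ((s / (t + s)) • x + (t / (t + s)) • y)) := by
  rw [heatKernel_mul_heatKernel ht hs, ← heatKernel_neg (t + s)]
  congr 2
  · abel
  · have : t + s ≠ 0 := by positivity
    have h1 : s / (t + s) + t / (t + s) = 1 := by field_simp; ring
    have h2 : z = (s / (t + s)) • z + (t / (t + s)) • z := by rw [← add_smul, h1, one_smul]
    conv_rhs => rw [h2]
    module

lemma integral_heatKernel_mul {t s : ℝ} (ht : 0 < t) (hs : 0 < s) (x y : Space d) :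
    ∫ z, heatKernel t (z - x) * heatKernel s (z - y) = heatKernel (t + s) (x - y) := by
  simp_rw [heatKernel_sub_mul ht hs]
  rw [integral_const_mul, integral_sub_right_eq_self (fun z => heatKernel (t * s / (t + s)) z),
    integral_heatKernel (by positivity), mul_one]

lemma integral_heatKernel_mul_smul {t s : ℝ} (ht : 0 < t) (hs : 0 < s) (x y : Space d) :
    ∫ z, (heatKernel t (z - x) * heatKernel s (z - y)) • (z - x) =
      (t / (t + s) * heatKernel (t + s) (x - y)) • (y - x) := by
  have hτ : 0 < t * s / (t + s) := by positivity
  set m := (s / (t + s)) • x + (t / (t + s)) • y with hm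
  have hmx : m - x = (t / (t + s)) • (y - x) := by
    have h1 : x = (s / (t + s)) • x + (t / (t + s)) • x := by
      rw [← add_smul, ← add_div, add_comm s, div_self (by positivity), one_smul]
    rw [hm]; nth_rw 2 [h1]; module
  have h2 : ∀ z, (heatKernel t (z - x) * heatKernel s (z - y)) • (z - x) =
      heatKernel (t + s) (x - y) • (heatKernel (t * s / (t + s)) (z - m) • (z - m) +
        heatKernel (t * s / (t + s)) (z - m) • (m - x)) := by
    intro z
    rw [heatKernel_sub_mul ht hs, ← smul_add, mul_smul]; congr 3; abel
  simp_rw [h2]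
  rw [integral_smul, integral_sub_right_eq_self
    (fun z => heatKernel (t * s / (t + s)) z • z + heatKernel (t * s / (t + s)) z • (m - x)),
    integral_add (integrable_heatKernel_smul hτ) ((integrable_heatKernel hτ).smul_const _),
    integral_heatKernel_smul, integral_smul_const, integral_heatKernel hτ, one_smul, zero_add, hmx,
    smul_smul, mul_comm]

/-! ### Bounds on the smeared field -/

lemma heatField_norm (s : ℝ) (hs : 0 ≤ s) (w : Space d) :
    ‖heatField s w‖ = heatConst d / 2 * timeIntegral ((d : ℝ) / 2 + 1) s (‖w‖ ^ 2) * ‖w‖ := by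
  have h1 := timeIntegral_nonneg (b := (d : ℝ) / 2 + 1) (‖w‖ ^ 2) hs
  have h2 := heatConst_pos d
  rw [heatField, norm_smul, neg_mul, norm_neg, norm_of_nonneg (by positivity)]

/-- The size constant of the Coulomb field: `|∇g(w)| = coulombFieldConst |w|^{1-d}`. -/
noncomputable def coulombFieldConst (d : ℕ) : ℝ :=
  heatConst d / 2 * (4 ^ ((d : ℝ) / 2) * Gamma ((d : ℝ) / 2))

lemma coulombFieldConst_pos (hd : 3 ≤ d) : 0 < coulombFieldConst d := by
  have := heatConst_pos d
  have : (0 : ℝ) < d := by exact_mod_cast (by omega : 0 < d)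
  have := Gamma_pos_of_pos (show 0 < (d : ℝ) / 2 by positivity)
  unfold coulombFieldConst; positivity

lemma four_div_sq_rpow {r : ℝ} (hr : 0 < r) (b : ℝ) :
    (4 / r ^ 2) ^ b = 4 ^ b * r ^ (-(2 * b)) := by
  rw [div_rpow (by norm_num) (by positivity), ← rpow_natCast, ← rpow_mul hr.le, rpow_neg hr.le,
    div_eq_mul_inv]
  norm_num

lemma rpow_one_sub_nat (hd : 3 ≤ d) {r : ℝ} (hr : 0 < r) :
    r ^ (1 - (d : ℝ)) = (r ^ (d - 1))⁻¹ := by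
  rw [← rpow_natCast, ← rpow_neg hr.le, Nat.cast_sub (by omega)]; congr 1; push_cast; ring

lemma norm_heatField_mul_le (hd : 3 ≤ d) {s : ℝ} (hs : 0 ≤ s) (w : Space d) :
    ‖heatField s w‖ * ‖w‖ ^ (d - 1) ≤ coulombFieldConst d := by
  rcases eq_or_ne w 0 with rfl | hw
  · rw [heatField_norm s hs]; simpa using (coulombFieldConst_pos hd).le
  have hr : 0 < ‖w‖ := norm_pos_iff.2 hw
  have hd' : (3 : ℝ) ≤ d := by exact_mod_cast hd
  have h := timeIntegral_le_zero (b := (d : ℝ) / 2 + 1) (s := s) (u := ‖w‖ ^ 2) (by linarith) hs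
    (by positivity)
  have h1 := heatConst_pos d
  rw [heatField_norm s hs, coulombFieldConst]
  have h3 : ‖w‖ ^ d * ‖w‖ ^ (-(2 * ((d : ℝ) / 2))) = 1 := by
    rw [← rpow_natCast, ← rpow_add hr]; simp [mul_div_cancel₀]
  have h4 : ‖w‖ * ‖w‖ ^ (d - 1) = ‖w‖ ^ d := by
    rw [← pow_succ']; congr 1; omega
  rw [four_div_sq_rpow hr, add_sub_cancel_right] at h
  calc heatConst d / 2 * timeIntegral ((d : ℝ) / 2 + 1) s (‖w‖ ^ 2) * ‖w‖ * ‖w‖ ^ (d - 1)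
      = heatConst d / 2 * timeIntegral ((d : ℝ) / 2 + 1) s (‖w‖ ^ 2) * ‖w‖ ^ d := by
        rw [mul_assoc, h4]
    _ ≤ heatConst d / 2 * (4 ^ ((d : ℝ) / 2) * ‖w‖ ^ (-(2 * ((d : ℝ) / 2))) * Gamma ((d : ℝ) / 2))
          * ‖w‖ ^ d := by gcongr
    _ = heatConst d / 2 * (4 ^ ((d : ℝ) / 2) * Gamma ((d : ℝ) / 2)) *
          (‖w‖ ^ d * ‖w‖ ^ (-(2 * ((d : ℝ) / 2)))) := by ring
    _ = _ := by rw [h3, mul_one]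

/-- Since `r e^{-r²/(4t)} ≤ 2 √t`, the integrand of `r · timeIntegral b s (r²)` is at most
`2 t^{1/2-b}`, uniformly in `r`. -/
lemma sqrt_mul_timeIntegral_le {b s r : ℝ} (hb : 3 / 2 < b) (hs : 0 < s) (hr : 0 ≤ r) :
    r * timeIntegral b s (r ^ 2) ≤ 2 * (s ^ (3 / 2 - b) / (b - 3 / 2)) := by
  have h := timeIntegral_at_zero (b := b - 1 / 2) (s := s) (by linarith) hs
  rw [show 1 - (b - 1 / 2) = 3 / 2 - b by ring, show b - 1 / 2 - 1 = b - 3 / 2 by ring] at h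
  rw [← h, timeIntegral, timeIntegral, ← integral_const_mul, ← integral_const_mul]
  refine setIntegral_mono_on ((integrableOn_timeIntegrand (r ^ 2) (by linarith) hs).const_mul _)
    ((integrableOn_timeIntegrand 0 (by linarith) hs).const_mul _) measurableSet_Ioi fun t ht => ?_
  have ht0 : 0 < t := hs.trans ht
  simp only [neg_zero, zero_div, exp_zero, mul_one]
  have hsq : √t ^ 2 = t := sq_sqrt ht0.le
  have h1 : r * exp (-r ^ 2 / (4 * t)) ≤ 2 * √t := by
    have h2 : exp (-r ^ 2 / (4 * t)) ≤ (1 + r ^ 2 / (4 * t))⁻¹ := by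
      rw [neg_div, exp_neg]
      gcongr
      linarith [add_one_le_exp (r ^ 2 / (4 * t))]
    have h3 : 0 < √t := sqrt_pos.2 ht0
    refine (mul_le_mul_of_nonneg_left h2 hr).trans ?_
    rw [← div_eq_mul_inv, div_le_iff₀ (by positivity)]
    have h5 : 2 * √t * (1 + r ^ 2 / (4 * t)) = 2 * √t + r ^ 2 / (2 * √t) := by
      nth_rw 2 [← hsq]; field_simp; ring
    have h6 : r = 2 * √t * (r / (2 * √t)) := by field_simp
    have h7 : r ^ 2 / (2 * √t) = 2 * √t * (r / (2 * √t)) ^ 2 := by field_simp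
    rw [h5, h7]
    nth_rw 1 [h6]
    nlinarith [sq_nonneg (r / (2 * √t) - 1)]
  calc r * (t ^ (-b) * exp (-r ^ 2 / (4 * t))) = t ^ (-b) * (r * exp (-r ^ 2 / (4 * t))) := by ring
    _ ≤ t ^ (-b) * (2 * √t) := by gcongr
    _ = 2 * t ^ (-(b - 1 / 2)) := by
      rw [sqrt_eq_rpow, neg_sub, sub_eq_add_neg, rpow_add ht0]; ring

lemma norm_heatField_le (hd : 3 ≤ d) {s : ℝ} (hs : 0 < s) (w : Space d) :
    ‖heatField s w‖ ≤ heatConst d * s ^ ((1 - (d : ℝ)) / 2) := by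
  have hd' : (3 : ℝ) ≤ d := by exact_mod_cast hd
  have h1 := heatConst_pos d
  have h := sqrt_mul_timeIntegral_le (b := (d : ℝ) / 2 + 1) (s := s) (r := ‖w‖) (by linarith) hs
    (norm_nonneg _)
  rw [heatField_norm s hs.le]
  have h2 : 2 * (s ^ (3 / 2 - ((d : ℝ) / 2 + 1)) / ((d : ℝ) / 2 + 1 - 3 / 2)) ≤
      2 * s ^ ((1 - (d : ℝ)) / 2) := by
    rw [show 3 / 2 - ((d : ℝ) / 2 + 1) = (1 - (d : ℝ)) / 2 by ring]
    gcongr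
    exact div_le_self (by positivity) (by linarith)
  calc _ = heatConst d / 2 * (‖w‖ * timeIntegral ((d : ℝ) / 2 + 1) s (‖w‖ ^ 2)) := by ring
    _ ≤ heatConst d / 2 * (2 * s ^ ((1 - (d : ℝ)) / 2)) :=
        mul_le_mul_of_nonneg_left (h.trans h2) (by positivity)
    _ = _ := by ring

/-! ### The divergence theorem on the whole space -/

/-- The divergence (trace) of a linear map, computed in the standard basis. -/
noncomputable def divg (D : Space d →L[ℝ] Space d) : ℝ :=
  ∑ i, inner ℝ (EuclideanSpace.basisFun (Fin d) ℝ i) (D (EuclideanSpace.basisFun (Fin d) ℝ i))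

lemma divg_add (D D' : Space d →L[ℝ] Space d) : divg (D + D') = divg D + divg D' := by
  simp [divg, inner_add_right, Finset.sum_add_distrib]

lemma divg_sub (D D' : Space d →L[ℝ] Space d) : divg (D - D') = divg D - divg D' := by
  simp [divg, inner_sub_right, Finset.sum_sub_distrib]

lemma divg_smul (c : ℝ) (D : Space d →L[ℝ] Space d) : divg (c • D) = c * divg D := by
  simp [divg, inner_smul_right, Finset.mul_sum]

lemma divg_smulRight (φ : Space d →L[ℝ] ℝ) (b : Space d) : divg (φ.smulRight b) = φ b := by
  have h : b = ∑ i, inner ℝ (EuclideanSpace.basisFun (Fin d) ℝ i) b •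
      EuclideanSpace.basisFun (Fin d) ℝ i :=
    ((EuclideanSpace.basisFun (Fin d) ℝ).sum_repr' b).symm
  conv_rhs => rw [h]
  simp only [divg, ContinuousLinearMap.smulRight_apply, inner_smul_right, map_sum, map_smul,
    smul_eq_mul]
  exact Finset.sum_congr rfl fun i _ => mul_comm _ _

lemma divg_id : divg (ContinuousLinearMap.id ℝ (Space d)) = d := by
  simp [divg]

lemma abs_divg_le (D : Space d →L[ℝ] Space d) : |divg D| ≤ d * ‖D‖ := by
  calc |divg D| ≤ ∑ i : Fin d, |inner ℝ (EuclideanSpace.basisFun (Fin d) ℝ i)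
        (D (EuclideanSpace.basisFun (Fin d) ℝ i))| := Finset.abs_sum_le_sum_abs _ _
    _ ≤ ∑ _i : Fin d, ‖D‖ := by
        refine Finset.sum_le_sum fun i _ => (abs_real_inner_le_norm _ _).trans ?_
        have h := D.le_opNorm (EuclideanSpace.basisFun (Fin d) ℝ i)
        simpa using h
    _ = d * ‖D‖ := by simp

lemma continuous_divg : Continuous (divg (d := d)) := by
  unfold divg; fun_prop

lemma integral_divg_eq_zero {W : Space d → Space d} {W' : Space d → Space d →L[ℝ] Space d}
    (h : ∀ z, HasFDerivAt W (W' z) z) (hW : Integrable W) (hW' : Integrable W') :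
    ∫ z, divg (W' z) = 0 := by
  unfold divg
  have hint : ∀ e : Space d, Integrable fun z => inner ℝ e (W' z e) := fun e =>
    (hW'.apply_continuousLinearMap e).const_inner e
  rw [integral_finsetSum _ fun i _ => hint _]
  refine Finset.sum_eq_zero fun i _ => ?_
  set e := EuclideanSpace.basisFun (Fin d) ℝ i
  have h2 : ∫ z, inner ℝ e (W' z e) = -∫ z, inner ℝ (0 : Space d) (W z) :=
    integral_bilinear_hasFDerivAt_right_eq_neg_left_of_integrable (μ := volume)
    (f := fun _ : Space d => e) (f' := fun _ => 0) (g := W) (g' := W') (v := e)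
    (B := innerSL ℝ) (by simp) (hint e)
    (hW.const_inner e) (fun x _ => hasFDerivAt_const _ _) (fun x _ => h x)
  simpa using h2

/-! ### The stress-energy tensor -/

/-- The stress-energy density: `Dv` contracted with the symmetrized stress-energy tensor of the
fields `a` and `b`. -/
noncomputable def stress (D : Space d →L[ℝ] Space d) (a b : Space d) : ℝ :=
  inner ℝ (D b) a + inner ℝ (D a) b - inner ℝ a b * divg D

lemma abs_stress_le (D : Space d →L[ℝ] Space d) (a b : Space d) :
    |stress D a b| ≤ (2 + d) * ‖D‖ * (‖a‖ * ‖b‖) := by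
  have h1 : |inner ℝ (D b) a| ≤ ‖D‖ * (‖a‖ * ‖b‖) :=
    (abs_real_inner_le_norm _ _).trans (by nlinarith [D.le_opNorm b, norm_nonneg a])
  have h2 : |inner ℝ (D a) b| ≤ ‖D‖ * (‖a‖ * ‖b‖) :=
    (abs_real_inner_le_norm _ _).trans (by nlinarith [D.le_opNorm a, norm_nonneg b])
  have h3 : |inner ℝ a b * divg D| ≤ d * ‖D‖ * (‖a‖ * ‖b‖) := by
    rw [abs_mul, mul_comm]
    exact mul_le_mul (abs_divg_le D) (abs_real_inner_le_norm _ _) (abs_nonneg _) (by positivity)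
  calc |stress D a b| ≤ |inner ℝ (D b) a| + |inner ℝ (D a) b| + |inner ℝ a b * divg D| :=
        (abs_sub _ _).trans (by gcongr; exact abs_add_le _ _)
    _ ≤ _ := by linarith

/-- For two gradient fields `F`, `H` (symmetric derivative), `v · F div H + v · H div F` differs
from minus the stress-energy density by a divergence. -/
lemma integral_stress {v F H : Space d → Space d} {v' F' H' : Space d → Space d →L[ℝ] Space d}
    (hv : ∀ z, HasFDerivAt v (v' z) z) (hF : ∀ z, HasFDerivAt F (F' z) z)
    (hH : ∀ z, HasFDerivAt H (H' z) z)
    (cv' : Continuous v')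
    (sF : ∀ z a b, inner ℝ (F' z a) b = inner ℝ a (F' z b))
    (sH : ∀ z a b, inner ℝ (H' z a) b = inner ℝ a (H' z b))
    {B L : ℝ} (hB : ∀ z, ‖v z‖ ≤ B) (hL : ∀ z, ‖v' z‖ ≤ L)
    (i1 : Integrable fun z => ‖F z‖ * ‖H z‖) (i2 : Integrable fun z => ‖F' z‖ * ‖H z‖)
    (i3 : Integrable fun z => ‖F z‖ * ‖H' z‖) :
    ∫ z, (inner ℝ (v z) (F z) * -divg (H' z) + inner ℝ (v z) (H z) * -divg (F' z)) =
      ∫ z, stress (v' z) (F z) (H z) := by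
  have cv : Continuous v := continuous_iff_continuousAt.2 fun z => (hv z).continuousAt
  have cF : Continuous F := continuous_iff_continuousAt.2 fun z => (hF z).continuousAt
  have cH : Continuous H := continuous_iff_continuousAt.2 fun z => (hH z).continuousAt
  have hB0 : 0 ≤ B := (norm_nonneg _).trans (hB 0)
  have hL0 : 0 ≤ L := (norm_nonneg _).trans (hL 0)
  let W : Space d → Space d := fun z =>
    inner ℝ (v z) (F z) • H z + inner ℝ (v z) (H z) • F z - inner ℝ (F z) (H z) • v z
  let W' : Space d → Space d →L[ℝ] Space d := fun z =>
    (inner ℝ (v z) (F z) • H' z +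
        ((fderivInnerCLM ℝ (v z, F z)).comp ((v' z).prod (F' z))).smulRight (H z)) +
      (inner ℝ (v z) (H z) • F' z +
        ((fderivInnerCLM ℝ (v z, H z)).comp ((v' z).prod (H' z))).smulRight (F z)) -
      (inner ℝ (F z) (H z) • v' z +
        ((fderivInnerCLM ℝ (F z, H z)).comp ((F' z).prod (H' z))).smulRight (v z))
  have hW : ∀ z, HasFDerivAt W (W' z) z := fun z =>
    ((((hv z).inner ℝ (hF z)).smul (hH z)).add (((hv z).inner ℝ (hH z)).smul (hF z))).sub
      (((hF z).inner ℝ (hH z)).smul (hv z))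
  have cW : Continuous W := by fun_prop
  have hdiv : ∀ z, divg (W' z) = stress (v' z) (F z) (H z) -
      (inner ℝ (v z) (F z) * -divg (H' z) + inner ℝ (v z) (H z) * -divg (F' z)) := by
    intro z
    simp only [W', divg_sub, divg_add, divg_smul, divg_smulRight, ContinuousLinearMap.comp_apply,
      ContinuousLinearMap.prod_apply, fderivInnerCLM_apply, stress]
    rw [← sF z (v z) (H z), ← sH z (v z) (F z), real_inner_comm (H z) (F' z (v z)),
      real_inner_comm (F z) (H' z (v z))]
    ring
  have iW : Integrable W := by
    refine (i1.const_mul (3 * B)).mono' cW.aestronglyMeasurable (Eventually.of_forall fun z => ?_)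
    have e1 : ‖inner ℝ (v z) (F z) • H z‖ ≤ B * (‖F z‖ * ‖H z‖) := by
      rw [norm_smul, ← mul_assoc]
      exact mul_le_mul_of_nonneg_right ((norm_inner_le_norm _ _).trans
        (mul_le_mul_of_nonneg_right (hB z) (norm_nonneg _))) (norm_nonneg _)
    have e2 : ‖inner ℝ (v z) (H z) • F z‖ ≤ B * (‖F z‖ * ‖H z‖) := by
      rw [norm_smul, mul_comm ‖F z‖, ← mul_assoc]
      exact mul_le_mul_of_nonneg_right ((norm_inner_le_norm _ _).trans
        (mul_le_mul_of_nonneg_right (hB z) (norm_nonneg _))) (norm_nonneg _)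
    have e3 : ‖inner ℝ (F z) (H z) • v z‖ ≤ B * (‖F z‖ * ‖H z‖) := by
      rw [norm_smul, mul_comm B]
      exact mul_le_mul (norm_inner_le_norm _ _) (hB z) (norm_nonneg _) (by positivity)
    calc ‖W z‖ ≤ _ := norm_sub_le _ _
      _ ≤ _ := add_le_add_left (norm_add_le _ _) _
      _ ≤ 3 * B * (‖F z‖ * ‖H z‖) := by linarith
  have iW' : Integrable W' := by
    have hb : Integrable fun z => 3 * L * (‖F z‖ * ‖H z‖) + 3 * B * (‖F' z‖ * ‖H z‖) +
        3 * B * (‖F z‖ * ‖H' z‖) :=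
      ((i1.const_mul _).add (i2.const_mul _)).add (i3.const_mul _)
    have eW' : W' = fderiv ℝ W := funext fun z => (hW z).fderiv.symm
    refine hb.mono' ?_ (Eventually.of_forall fun z => ?_)
    · rw [eW']; exact (measurable_fderiv ℝ W).aestronglyMeasurable
    · refine ContinuousLinearMap.opNorm_le_bound _ (by positivity) fun u => ?_
      have hvu : ‖v' z u‖ ≤ L * ‖u‖ := (v' z).le_of_opNorm_le (hL z) u
      have hFu := (F' z).le_opNorm u
      have hHu := (H' z).le_opNorm u
      have key : ∀ (a b c : Space d) (α β γ : ℝ), ‖a‖ ≤ α → ‖b‖ ≤ β → ‖c‖ ≤ γ →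
          ‖inner ℝ a b • c‖ ≤ α * β * γ := by
        intro a b c α β γ ha hb hc
        rw [norm_smul]
        have hα := (norm_nonneg a).trans ha
        have hβ := (norm_nonneg b).trans hb
        exact mul_le_mul ((norm_inner_le_norm _ _).trans
          (mul_le_mul ha hb (norm_nonneg _) hα)) hc (norm_nonneg _) (by positivity)
      have e : W' z u = (inner ℝ (v z) (F z) • H' z u + (inner ℝ (v z) (F' z u) • H z +
          inner ℝ (v' z u) (F z) • H z)) + (inner ℝ (v z) (H z) • F' z u +
          (inner ℝ (v z) (H' z u) • F z + inner ℝ (v' z u) (H z) • F z)) -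
          (inner ℝ (F z) (H z) • v' z u + (inner ℝ (F z) (H' z u) • v z +
          inner ℝ (F' z u) (H z) • v z)) := by
        simp [W', add_smul]
      have n1 := key (v z) (F z) (H' z u) _ _ _ (hB z) le_rfl hHu
      have n2 := key (v z) (F' z u) (H z) _ _ _ (hB z) hFu le_rfl
      have n3 := key (v' z u) (F z) (H z) _ _ _ hvu le_rfl le_rfl
      have n4 := key (v z) (H z) (F' z u) _ _ _ (hB z) le_rfl hFu
      have n5 := key (v z) (H' z u) (F z) _ _ _ (hB z) hHu le_rfl
      have n6 := key (v' z u) (H z) (F z) _ _ _ hvu le_rfl le_rfl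
      have n7 := key (F z) (H z) (v' z u) _ _ _ le_rfl le_rfl hvu
      have n8 := key (F z) (H' z u) (v z) _ _ _ le_rfl hHu (hB z)
      have n9 := key (F' z u) (H z) (v z) _ _ _ hFu le_rfl (hB z)
      rw [e]
      refine (norm_sub_le _ _).trans ((add_le_add ((norm_add_le _ _).trans (add_le_add
        ((norm_add_le _ _).trans (add_le_add n1 ((norm_add_le _ _).trans (add_le_add n2 n3))))
        ((norm_add_le _ _).trans (add_le_add n4 ((norm_add_le _ _).trans (add_le_add n5 n6))))))
        ((norm_add_le _ _).trans (add_le_add n7 ((norm_add_le _ _).trans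
          (add_le_add n8 n9))))).trans (le_of_eq ?_))
      ring
  have iS : Integrable fun z => stress (v' z) (F z) (H z) := by
    refine (i1.const_mul ((2 + d) * L)).mono' ?_ (Eventually.of_forall fun z => ?_)
    · have := continuous_divg (d := d)
      unfold stress
      exact Continuous.aestronglyMeasurable (by fun_prop)
    · refine (abs_stress_le _ _ _).trans ?_
      gcongr; exact hL z
  have idiv : Integrable fun z => divg (W' z) := by
    refine (iW'.norm.const_mul (d : ℝ)).mono'
      (continuous_divg.comp_aestronglyMeasurable iW'.aestronglyMeasurable)
      (Eventually.of_forall fun z => abs_divg_le _)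
  have h0 := integral_divg_eq_zero hW iW iW'
  have h1 : ∀ z, inner ℝ (v z) (F z) * -divg (H' z) + inner ℝ (v z) (H z) * -divg (F' z) =
      stress (v' z) (F z) (H z) - divg (W' z) := fun z => by rw [hdiv z]; ring
  simp_rw [h1]
  rw [integral_sub iS idiv, h0, sub_zero]

/-! ### Derivative and decay of the smeared field -/

/-- The derivative of `heatField s`, that is the Hessian of the smeared Coulomb potential. -/
noncomputable def heatHess {d : ℕ} (s : ℝ) (w : Space d) : Space d →L[ℝ] Space d :=
  (-(heatConst d / 2) * timeIntegral ((d : ℝ) / 2 + 1) s (‖w‖ ^ 2)) •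
      ContinuousLinearMap.id ℝ (Space d) +
    (heatConst d / 4 * timeIntegral ((d : ℝ) / 2 + 2) s (‖w‖ ^ 2)) •
      (innerSL ℝ w).smulRight w

lemma hasFDerivAt_heatField {s : ℝ} (hd : 3 ≤ d) (hs : 0 < s) (w : Space d) :
    HasFDerivAt (heatField s) (heatHess s w) w := by
  have hd' : (3 : ℝ) ≤ d := by exact_mod_cast hd
  have h1 := (hasDerivAt_timeIntegral (b := (d : ℝ) / 2 + 1) (‖w‖ ^ 2) (by linarith)
    hs).comp_hasFDerivAt w ((hasFDerivAt_id w).norm_sq)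
  have h2 := (h1.const_mul (-(heatConst d / 2))).smul (hasFDerivAt_id w)
  refine h2.congr_fderiv ?_
  ext1 u
  have e : (d : ℝ) / 2 + 1 + 1 = d / 2 + 2 := by ring
  simp only [heatHess, _root_.add_apply, _root_.smul_apply,
    ContinuousLinearMap.smulRight_apply, ContinuousLinearMap.id_apply, id, e, Function.comp,
    innerSL_apply_apply, smul_smul, smul_eq_mul, ContinuousLinearMap.comp_apply]
  congr 2
  simp
  ring

lemma inner_heatHess_symm (s : ℝ) (w a b : Space d) :
    inner ℝ (heatHess s w a) b = inner ℝ a (heatHess s w b) := by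
  simp only [heatHess, _root_.add_apply, _root_.smul_apply,
    ContinuousLinearMap.smulRight_apply, ContinuousLinearMap.id_apply, innerSL_apply_apply,
    inner_add_left, inner_add_right, inner_smul_left, inner_smul_right, conj_trivial]
  rw [real_inner_comm w a]
  ring

lemma divg_heatHess {s : ℝ} (hd : 3 ≤ d) (hs : 0 < s) (w : Space d) :
    divg (heatHess s w) = -heatKernel s w := by
  have hd' : (3 : ℝ) ≤ d := by exact_mod_cast hd
  have h := timeIntegral_heat (b := (d : ℝ) / 2) (‖w‖ ^ 2) (by linarith) hs
  rw [heatHess, divg_add, divg_smul, divg_smul, divg_id, divg_smulRight, innerSL_apply_apply,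
    real_inner_self_eq_norm_sq, heatKernel]
  linear_combination (-heatConst d) * h

lemma norm_heatHess_le {s : ℝ} (hd : 3 ≤ d) (hs : 0 < s) (w : Space d) :
    ‖heatHess s w‖ ≤
      (1 + d) * (heatConst d / 2 * timeIntegral ((d : ℝ) / 2 + 1) s (‖w‖ ^ 2)) := by
  have hd' : (3 : ℝ) ≤ d := by exact_mod_cast hd
  have hκ := heatConst_pos d
  have h := timeIntegral_heat (b := (d : ℝ) / 2) (‖w‖ ^ 2) (by linarith) hs
  have h0 := timeIntegral_nonneg (b := (d : ℝ) / 2 + 1) (‖w‖ ^ 2) hs.le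
  have h2 := timeIntegral_nonneg (b := (d : ℝ) / 2 + 2) (‖w‖ ^ 2) hs.le
  have h3 : 0 < s ^ (-((d : ℝ) / 2)) * exp (-‖w‖ ^ 2 / (4 * s)) := by positivity
  have h4 : heatConst d / 4 * timeIntegral ((d : ℝ) / 2 + 2) s (‖w‖ ^ 2) * ‖w‖ ^ 2 ≤
      d * (heatConst d / 2 * timeIntegral ((d : ℝ) / 2 + 1) s (‖w‖ ^ 2)) := by
    have : timeIntegral ((d : ℝ) / 2 + 2) s (‖w‖ ^ 2) * ‖w‖ ^ 2 / 4 ≤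
      d / 2 * timeIntegral ((d : ℝ) / 2 + 1) s (‖w‖ ^ 2) := by linarith
    nlinarith
  refine ContinuousLinearMap.opNorm_le_bound _ (by positivity) fun u => ?_
  simp only [heatHess, _root_.add_apply, _root_.smul_apply,
    ContinuousLinearMap.smulRight_apply, ContinuousLinearMap.id_apply, innerSL_apply_apply]
  refine (norm_add_le _ _).trans ?_
  rw [norm_smul, norm_smul, norm_smul, neg_mul, norm_neg,
    norm_of_nonneg (by positivity :
      0 ≤ heatConst d / 2 * timeIntegral ((d : ℝ) / 2 + 1) s (‖w‖ ^ 2)),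
    norm_of_nonneg (by positivity :
      0 ≤ heatConst d / 4 * timeIntegral ((d : ℝ) / 2 + 2) s (‖w‖ ^ 2))]
  have h5 : heatConst d / 4 * timeIntegral ((d : ℝ) / 2 + 2) s (‖w‖ ^ 2) *
      (‖inner ℝ w u‖ * ‖w‖) ≤ heatConst d / 4 * timeIntegral ((d : ℝ) / 2 + 2) s (‖w‖ ^ 2) *
      ‖w‖ ^ 2 * ‖u‖ := by
    rw [mul_assoc _ (‖w‖ ^ 2) ‖u‖]
    refine mul_le_mul_of_nonneg_left ?_ (by positivity)
    have := norm_inner_le_norm (𝕜 := ℝ) w u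
    nlinarith [norm_nonneg w]
  have := mul_le_mul_of_nonneg_right h4 (norm_nonneg u)
  linarith

lemma continuous_heatField {s : ℝ} (hd : 3 ≤ d) (hs : 0 < s) :
    Continuous (heatField (d := d) s) :=
  continuous_iff_continuousAt.2 fun w => (hasFDerivAt_heatField hd hs w).continuousAt

lemma continuous_heatHess {s : ℝ} (hs : 0 < s) : Continuous (heatHess (d := d) s) := by
  have hd' : (0 : ℝ) ≤ d := by positivity
  rcases Nat.eq_zero_or_pos d with rfl | hd
  · exact continuous_of_const fun x y => by rw [Subsingleton.elim x y]
  have hd' : (0 : ℝ) < d := by exact_mod_cast hd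
  have h1 := continuous_timeIntegral (b := (d : ℝ) / 2 + 1) (by linarith) hs
  have h2 := continuous_timeIntegral (b := (d : ℝ) / 2 + 2) (by linarith) hs
  unfold heatHess
  have h3 : Continuous fun w : Space d => (innerSL ℝ w).smulRight w := by
    exact ((ContinuousLinearMap.smulRightL ℝ (Space d) (Space d)).continuous.comp
      (innerSL ℝ).continuous).clm_apply continuous_id
  fun_prop

/-- A function that is bounded and decays like `|w|^{-m}` with `m > d / 2` is square
integrable. -/
lemma integrable_sq_of_decay {V : Type*} [NormedAddCommGroup V] {f : Space d → V}
    (hf : Continuous f) {m : ℕ} (hm : d < 2 * m) {C₁ C₂ : ℝ} (h1 : ∀ w, ‖f w‖ ≤ C₁)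
    (h2 : ∀ w, ‖f w‖ * ‖w‖ ^ m ≤ C₂) : Integrable fun w => ‖f w‖ ^ 2 := by
  have hint := (integrable_one_add_norm (E := Space d) (μ := volume) (r := 2 * m)
    (by rw [finrank_euclideanSpace_fin]; exact_mod_cast hm)).const_mul ((2 ^ m * (C₁ + C₂)) ^ 2)
  refine hint.mono' (hf.norm.pow 2).aestronglyMeasurable (Eventually.of_forall fun w => ?_)
  have hC1 : 0 ≤ C₁ := (norm_nonneg _).trans (h1 0)
  have hC2 : 0 ≤ C₂ := (by positivity : 0 ≤ ‖f 0‖ * ‖(0 : Space d)‖ ^ m).trans (h2 0)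
  have key : ‖f w‖ * (1 + ‖w‖) ^ m ≤ 2 ^ m * (C₁ + C₂) := by
    have hmax : (1 + ‖w‖) ^ m ≤ 2 ^ m * (1 + ‖w‖ ^ m) := by
      rcases le_total ‖w‖ 1 with h | h
      · calc (1 + ‖w‖) ^ m ≤ 2 ^ m := by gcongr; linarith
          _ ≤ 2 ^ m * (1 + ‖w‖ ^ m) := le_mul_of_one_le_right (by positivity)
            (by linarith [pow_nonneg (norm_nonneg w) m])
      · calc (1 + ‖w‖) ^ m ≤ (2 * ‖w‖) ^ m := by gcongr; linarith
          _ = 2 ^ m * ‖w‖ ^ m := mul_pow _ _ _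
          _ ≤ 2 ^ m * (1 + ‖w‖ ^ m) := by gcongr; linarith
    calc ‖f w‖ * (1 + ‖w‖) ^ m ≤ ‖f w‖ * (2 ^ m * (1 + ‖w‖ ^ m)) := by gcongr
      _ = 2 ^ m * (‖f w‖ + ‖f w‖ * ‖w‖ ^ m) := by ring
      _ ≤ 2 ^ m * (C₁ + C₂) := by gcongr; exacts [h1 w, h2 w]
  rw [norm_of_nonneg (by positivity)]
  have hpos : (0 : ℝ) < (1 + ‖w‖) ^ m := by positivity
  have e : (1 + ‖w‖) ^ (-(2 * (m : ℝ))) = (((1 + ‖w‖) ^ m) ^ 2)⁻¹ := by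
    rw [rpow_neg (by positivity), ← pow_mul, ← rpow_natCast]; push_cast; ring_nf
  rw [e, ← div_eq_mul_inv, ← div_pow]
  gcongr
  rwa [le_div_iff₀ hpos]

lemma integrable_heatField_sq {s : ℝ} (hd : 3 ≤ d) (hs : 0 < s) :
    Integrable fun w : Space d => ‖heatField s w‖ ^ 2 :=
  integrable_sq_of_decay (continuous_heatField hd hs) (m := d - 1) (by omega)
    (norm_heatField_le hd hs) (norm_heatField_mul_le hd hs.le)

lemma integrable_heatHess_sq {s : ℝ} (hd : 3 ≤ d) (hs : 0 < s) :
    Integrable fun w : Space d => ‖heatHess s w‖ ^ 2 := by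
  have hd' : (3 : ℝ) ≤ d := by exact_mod_cast hd
  have hκ := heatConst_pos d
  refine integrable_sq_of_decay (continuous_heatHess hs) (m := d) (by omega)
    (C₁ := (1 + d) * (heatConst d / 2 *
      (s ^ (1 - ((d : ℝ) / 2 + 1)) / ((d : ℝ) / 2 + 1 - 1))))
    (C₂ := (1 + d) * coulombFieldConst d)
    (fun w => (norm_heatHess_le hd hs w).trans ?_) fun w => ?_
  · gcongr
    exact timeIntegral_le (by linarith) hs (by positivity)
  · have h1 := norm_heatField_mul_le hd hs.le w
    rw [heatField_norm s hs.le] at h1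
    calc ‖heatHess s w‖ * ‖w‖ ^ d ≤ (1 + d) * (heatConst d / 2 *
          timeIntegral ((d : ℝ) / 2 + 1) s (‖w‖ ^ 2)) * ‖w‖ ^ d := by
          gcongr; exact norm_heatHess_le hd hs w
      _ = (1 + d) * (heatConst d / 2 * timeIntegral ((d : ℝ) / 2 + 1) s (‖w‖ ^ 2) * ‖w‖ *
          ‖w‖ ^ (d - 1)) := by
          have : ‖w‖ ^ d = ‖w‖ * ‖w‖ ^ (d - 1) := by rw [← pow_succ']; congr 1; omega
          rw [this]; ring
      _ ≤ _ := by gcongr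

lemma integrable_norm_mul_norm {V V' : Type*} [NormedAddCommGroup V] [NormedAddCommGroup V']
    {f : Space d → V} {h : Space d → V'} (cf : Continuous f) (ch : Continuous h)
    (hf : Integrable fun w => ‖f w‖ ^ 2) (hh : Integrable fun w => ‖h w‖ ^ 2) (x y : Space d) :
    Integrable fun z => ‖f (z - x)‖ * ‖h (z - y)‖ := by
  refine ((hf.comp_sub_right x).add (hh.comp_sub_right y)).mono'
    (by fun_prop) (Eventually.of_forall fun z => ?_)
  rw [norm_of_nonneg (by positivity)]
  simp only [Pi.add_apply]
  nlinarith [sq_nonneg (‖f (z - x)‖ - ‖h (z - y)‖), sq_nonneg (‖f (z - x)‖ + ‖h (z - y)‖)]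

/-! ### Convolutions of the smeared field -/

lemma setIntegral_Ioi_comp_add (f : ℝ → ℝ) (s : ℝ) :
    ∫ t in Ioi s, f (t + s) = ∫ t in Ioi (s + s), f t := by
  have := (measurePreserving_add_right volume s).setIntegral_preimage_emb
    (measurableEmbedding_addRight s) f (Ioi (s + s))
  rwa [preimage_add_const_Ioi, add_sub_cancel_right] at this

/-- Fubini for the time integral that defines the smeared field. -/
lemma integral_inner_heatField {s : ℝ} (hd : 3 ≤ d) (hs : 0 < s) (x : Space d)
    {H : Space d → Space d} (cH : Continuous H)
    (hint : Integrable fun z => ‖heatField s (z - x)‖ * ‖H z‖) :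
    ∫ z, inner ℝ (heatField s (z - x)) (H z) =
      ∫ t in Ioi s, -(1 / (2 * t)) * ∫ z, heatKernel t (z - x) * inner ℝ (z - x) (H z) := by
  have hd' : (3 : ℝ) ≤ d := by exact_mod_cast hd
  have hκ := heatConst_pos d
  let f : Space d → ℝ → ℝ := fun z t => (-(heatConst d / 2) * inner ℝ (z - x) (H z)) *
    (t ^ (-((d : ℝ) / 2 + 1)) * exp (-‖z - x‖ ^ 2 / (4 * t)))
  have hft : ∀ z, Integrable (f z) (volume.restrict (Ioi s)) := fun z =>
    (integrableOn_timeIntegrand _ (by linarith) hs).const_mul _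
  have hmeas : AEStronglyMeasurable (Function.uncurry f)
      (volume.prod (volume.restrict (Ioi s))) := by
    apply Measurable.aestronglyMeasurable
    have := cH.measurable
    unfold f Function.uncurry
    fun_prop
  have hprod : Integrable (Function.uncurry f) (volume.prod (volume.restrict (Ioi s))) := by
    rw [integrable_prod_iff hmeas]
    refine ⟨Eventually.of_forall hft, hint.mono' hmeas.norm.integral_prod_right' ?_⟩
    refine Eventually.of_forall fun z => ?_
    have h1 : ∫ t in Ioi s, ‖f z t‖ = |inner ℝ (z - x) (H z)| * (heatConst d / 2) *
        timeIntegral ((d : ℝ) / 2 + 1) s (‖z - x‖ ^ 2) := by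
      rw [timeIntegral, ← integral_const_mul]
      refine setIntegral_congr_fun measurableSet_Ioi fun t ht => ?_
      have ht0 : 0 < t := hs.trans ht
      simp only [f]
      rw [norm_mul, norm_mul, norm_neg, norm_of_nonneg (by positivity : 0 ≤ heatConst d / 2),
        norm_of_nonneg (by positivity : 0 ≤ t ^ (-((d : ℝ) / 2 + 1)) * _), Real.norm_eq_abs]
      ring
    have h2 := timeIntegral_nonneg (b := (d : ℝ) / 2 + 1) (‖z - x‖ ^ 2) hs.le
    simp only [Function.uncurry_apply_pair]
    rw [h1, norm_of_nonneg (by positivity), heatField_norm s hs.le]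
    calc |inner ℝ (z - x) (H z)| * (heatConst d / 2) *
          timeIntegral ((d : ℝ) / 2 + 1) s (‖z - x‖ ^ 2) ≤ (‖z - x‖ * ‖H z‖) * (heatConst d / 2) *
          timeIntegral ((d : ℝ) / 2 + 1) s (‖z - x‖ ^ 2) := by
          gcongr; exact abs_real_inner_le_norm _ _
      _ = _ := by ring
  have hsw := integral_integral_swap hprod
  have hl : ∀ z, ∫ t in Ioi s, f z t = inner ℝ (heatField s (z - x)) (H z) := fun z => by
    simp only [f, heatField, inner_smul_left, conj_trivial]
    rw [integral_const_mul, timeIntegral]; ring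
  simp_rw [hl] at hsw
  rw [hsw]
  refine setIntegral_congr_fun measurableSet_Ioi fun t ht => ?_
  have ht0 : 0 < t := hs.trans ht
  rw [← integral_const_mul]
  congr 1
  ext z
  simp only [f, heatKernel]
  rw [neg_add, rpow_add ht0, rpow_neg_one]
  field_simp

/-- The heat flow commutes with the smeared field: `F_s * p_s = F_{2s}`, tested against a fixed
vector. -/
lemma integral_heatField_mul_heatKernel {s : ℝ} (hd : 3 ≤ d) (hs : 0 < s) (x y e : Space d) :
    ∫ z, inner ℝ (heatField s (z - x)) (heatKernel s (z - y) • e) =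
      inner ℝ (heatField (2 * s) (y - x)) e := by
  have cK := continuous_heatKernel (d := d) s
  have hint : Integrable fun z => ‖heatField s (z - x)‖ * ‖heatKernel s (z - y) • e‖ := by
    have cF := continuous_heatField hd hs
    refine (((integrable_heatKernel hs).comp_sub_right y).const_mul
      (heatConst d * s ^ ((1 - (d : ℝ)) / 2) * ‖e‖)).mono' (by fun_prop)
      (Eventually.of_forall fun z => ?_)
    rw [norm_of_nonneg (by positivity), norm_smul, norm_of_nonneg (heatKernel_nonneg hs.le _)]
    have := heatKernel_nonneg (d := d) hs.le (z - y)
    calc _ ≤ heatConst d * s ^ ((1 - (d : ℝ)) / 2) * (heatKernel s (z - y) * ‖e‖) := by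
          gcongr; exact norm_heatField_le hd hs _
      _ = _ := by ring
  rw [integral_inner_heatField hd hs x (by fun_prop) hint]
  have h1 : ∀ t ∈ Ioi s, -(1 / (2 * t)) * ∫ z, heatKernel t (z - x) *
      inner ℝ (z - x) (heatKernel s (z - y) • e) =
      (fun t => -(1 / (2 * t)) * (heatKernel t (y - x) * inner ℝ (y - x) e)) (t + s) := by
    intro t ht
    have ht0 : 0 < t := hs.trans ht
    have h2 : ∀ z, heatKernel t (z - x) * inner ℝ (z - x) (heatKernel s (z - y) • e) =
        inner ℝ e ((heatKernel t (z - x) * heatKernel s (z - y)) • (z - x)) := fun z => by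
      rw [inner_smul_right, inner_smul_right, real_inner_comm]; ring
    have i2 : Integrable fun z => (heatKernel t (z - x) * heatKernel s (z - y)) • (z - x) := by
      have cKt := continuous_heatKernel (d := d) t
      refine (((integrable_norm_pow_mul_heatKernel one_pos ht0).comp_sub_right x).mul_const
        (heatConst d * s ^ (-((d : ℝ) / 2)))).mono' (by fun_prop) (Eventually.of_forall fun z => ?_)
      rw [norm_smul, norm_mul, norm_of_nonneg (heatKernel_nonneg ht0.le _),
        norm_of_nonneg (heatKernel_nonneg hs.le _), pow_one]
      have h4 : heatKernel s (z - y) ≤ heatConst d * s ^ (-((d : ℝ) / 2)) := by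
        have hκ := heatConst_pos d
        have : exp (-‖z - y‖ ^ 2 / (4 * s)) ≤ 1 := by
          rw [exp_le_one_iff]
          exact div_nonpos_of_nonpos_of_nonneg (by simp) (by positivity)
        rw [heatKernel]
        gcongr
        exact mul_le_of_le_one_right (by positivity) this
      have h5 := heatKernel_nonneg (d := d) ht0.le (z - x)
      calc heatKernel t (z - x) * heatKernel s (z - y) * ‖z - x‖ ≤
          heatKernel t (z - x) * (heatConst d * s ^ (-((d : ℝ) / 2))) * ‖z - x‖ := by gcongr
        _ = _ := by ring
    simp_rw [h2]
    rw [integral_inner i2, integral_heatKernel_mul_smul ht0 hs, inner_smul_right,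
      real_inner_comm, ← heatKernel_neg (t + s) (y - x), neg_sub]
    field_simp
  rw [setIntegral_congr_fun measurableSet_Ioi h1, setIntegral_Ioi_comp_add
    (fun t => -(1 / (2 * t)) * (heatKernel t (y - x) * inner ℝ (y - x) e)), ← two_mul,
    heatField, inner_smul_left, conj_trivial, timeIntegral]
  rw [← integral_const_mul, ← integral_mul_const]
  refine setIntegral_congr_fun measurableSet_Ioi fun t ht => ?_
  have ht0 : 0 < t := (by positivity : 0 < 2 * s).trans ht
  simp only [heatKernel]
  rw [neg_add, rpow_add ht0, rpow_neg_one]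
  field_simp

lemma hasFDerivAt_heatKernel (t : ℝ) (x z : Space d) :
    HasFDerivAt (fun z => heatKernel t (z - x))
      ((-(1 / (2 * t)) * heatKernel t (z - x)) • innerSL ℝ (z - x)) z := by
  have h1 := ((hasFDerivAt_id z).sub_const x).norm_sq
  have h2 := (((h1.neg.mul_const (4 * t)⁻¹).exp).const_mul (t ^ (-((d : ℝ) / 2)))).const_mul
    (heatConst d)
  have h3 : (fun z : Space d => heatKernel t (z - x)) = fun z : Space d =>
      heatConst d * (t ^ (-((d : ℝ) / 2)) * exp (-‖id z - x‖ ^ 2 * (4 * t)⁻¹)) := by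
    ext z; simp [heatKernel, div_eq_mul_inv]
  rw [h3]
  refine h2.congr_fderiv ?_
  ext1 u
  simp [heatKernel, div_eq_mul_inv]
  ring

/-- The Dirichlet form of the smeared Coulomb potentials: `⟨∇G_s(· - x), ∇G_s(· - y)⟩` integrates
to `G_{2s}(x - y)`. -/
lemma integral_inner_heatField_heatField {s : ℝ} (hd : 3 ≤ d) (hs : 0 < s) (x y : Space d) :
    ∫ z, inner ℝ (heatField s (z - x)) (heatField s (z - y)) = heatPot (2 * s) (x - y) := by
  have cF := continuous_heatField hd hs
  have iF := integrable_heatField_sq hd hs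
  rw [integral_inner_heatField hd hs x (H := fun z => heatField s (z - y)) (by fun_prop)
    (integrable_norm_mul_norm cF cF iF iF x y)]
  have h1 : ∀ t ∈ Ioi s, -(1 / (2 * t)) * ∫ z, heatKernel t (z - x) *
      inner ℝ (z - x) (heatField s (z - y)) = (fun t => heatKernel t (x - y)) (t + s) := by
    intro t ht
    have ht0 : 0 < t := hs.trans ht
    have cK := continuous_heatKernel (d := d) t
    have cKs := continuous_heatKernel (d := d) s
    have cH := continuous_heatHess (d := d) hs
    have iK := (integrable_heatKernel (d := d) ht0).comp_sub_right x
    have iK1 := (integrable_norm_pow_mul_heatKernel (d := d) one_pos ht0).comp_sub_right x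
    set C := heatConst d * s ^ ((1 - (d : ℝ)) / 2) with hC
    have hd' : (3 : ℝ) ≤ d := by exact_mod_cast hd
    have hκ := heatConst_pos d
    have hC0 : 0 ≤ C := by positivity
    set C' := (1 + d) * (heatConst d / 2 * (s ^ (1 - ((d : ℝ) / 2 + 1)) / ((d : ℝ) / 2 + 1 - 1)))
    have hb : ∀ w : Space d, ‖heatHess s w‖ ≤ C' := fun w => by
      refine (norm_heatHess_le hd hs w).trans ?_
      unfold C'
      gcongr
      exact timeIntegral_le (by linarith) hs (by positivity)
    -- integrate the divergence of `p_t(z - x) F_s(z - y)` over the whole space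
    let W' : Space d → Space d →L[ℝ] Space d := fun z =>
      heatKernel t (z - x) • heatHess s (z - y) +
        ((-(1 / (2 * t)) * heatKernel t (z - x)) • innerSL ℝ (z - x)).smulRight
          (heatField s (z - y))
    have hW : ∀ z, HasFDerivAt (fun z => heatKernel t (z - x) • heatField s (z - y)) (W' z) z := by
      intro z
      refine (hasFDerivAt_heatKernel t x z).smul ?_
      exact (hasFDerivAt_heatField hd hs (z - y)).comp z ((hasFDerivAt_id z).sub_const y)
    have i1 : Integrable fun z => heatKernel t (z - x) • heatField s (z - y) := by
      refine (iK.mul_const C).mono' (by fun_prop) (Eventually.of_forall fun z => ?_)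
      rw [norm_smul, norm_of_nonneg (heatKernel_nonneg ht0.le _)]
      exact mul_le_mul_of_nonneg_left (norm_heatField_le hd hs _) (heatKernel_nonneg ht0.le _)
    have i2 : Integrable W' := by
      have eW' : W' = fderiv ℝ (fun z => heatKernel t (z - x) • heatField s (z - y)) :=
        funext fun z => (hW z).fderiv.symm
      refine ((iK.mul_const C').add (iK1.mul_const (1 / (2 * t) * C))).mono' ?_
        (Eventually.of_forall fun z => ?_)
      · rw [eW']; exact (measurable_fderiv ℝ _).aestronglyMeasurable
      · have hk := heatKernel_nonneg (d := d) ht0.le (z - x)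
        refine (norm_add_le _ _).trans (add_le_add ?_ ?_)
        · rw [norm_smul, norm_of_nonneg hk]
          exact mul_le_mul_of_nonneg_left (hb _) hk
        · rw [ContinuousLinearMap.norm_smulRight_apply, norm_smul, innerSL_apply_norm, norm_mul,
            norm_neg, norm_of_nonneg hk, norm_of_nonneg (by positivity)]
          simp only [pow_one]
          calc 1 / (2 * t) * heatKernel t (z - x) * ‖z - x‖ * ‖heatField s (z - y)‖
              ≤ 1 / (2 * t) * heatKernel t (z - x) * ‖z - x‖ * C := by
                gcongr; exact norm_heatField_le hd hs _
            _ = _ := by ring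
    have h0 := integral_divg_eq_zero hW i1 i2
    have hdiv : ∀ z, divg (W' z) = -(1 / (2 * t)) *
        (heatKernel t (z - x) * inner ℝ (z - x) (heatField s (z - y))) -
        heatKernel t (z - x) * heatKernel s (z - y) := fun z => by
      simp only [W', divg_add, divg_smul, divg_smulRight, divg_heatHess hd hs,
        _root_.smul_apply, innerSL_apply_apply, smul_eq_mul]
      ring
    have iA : Integrable fun z => -(1 / (2 * t)) *
        (heatKernel t (z - x) * inner ℝ (z - x) (heatField s (z - y))) := by
      refine Integrable.const_mul ((iK1.mul_const C).mono' (by fun_prop)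
        (Eventually.of_forall fun z => ?_)) _
      have hk := heatKernel_nonneg (d := d) ht0.le (z - x)
      rw [norm_mul, norm_of_nonneg hk, pow_one]
      calc heatKernel t (z - x) * ‖inner ℝ (z - x) (heatField s (z - y))‖
          ≤ heatKernel t (z - x) * (‖z - x‖ * C) := by
            gcongr
            exact (norm_inner_le_norm _ _).trans (by gcongr; exact norm_heatField_le hd hs _)
        _ = _ := by ring
    have iB : Integrable fun z => heatKernel t (z - x) * heatKernel s (z - y) := by
      refine .of_integral_ne_zero ?_
      rw [integral_heatKernel_mul ht0 hs]
      exact (heatKernel_pos (by positivity) _).ne'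
    simp_rw [hdiv] at h0
    rw [integral_sub iA iB, integral_const_mul, integral_heatKernel_mul ht0 hs] at h0
    linarith
  rw [setIntegral_congr_fun measurableSet_Ioi h1,
    setIntegral_Ioi_comp_add (fun t => heatKernel t (x - y)), ← two_mul,
    heatPot, timeIntegral, ← integral_const_mul]
  rfl

/-! ### The commutator kernel of smeared charges -/

/-- The commutator kernel of two unit charges at `x` and `y` that are smeared by the heat kernel
at time `s`. -/
noncomputable def smearedCommutator {d : ℕ} (v : Space d → Space d) (s : ℝ) (x y : Space d) : ℝ :=
  ∫ z, (inner ℝ (v z) (heatField s (z - x)) * heatKernel s (z - y) +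
    inner ℝ (v z) (heatField s (z - y)) * heatKernel s (z - x))

/-- A bounded continuously differentiable vector field with bounded derivative. -/
structure IsC1Bounded {d : ℕ} (v : Space d → Space d) (v' : Space d → Space d →L[ℝ] Space d)
    (B L : ℝ) : Prop where
  hasFDerivAt : ∀ z, HasFDerivAt v (v' z) z
  continuous_deriv : Continuous v'
  norm_le : ∀ z, ‖v z‖ ≤ B
  norm_deriv_le : ∀ z, ‖v' z‖ ≤ L

namespace IsC1Bounded

variable {v : Space d → Space d} {v' : Space d → Space d →L[ℝ] Space d} {B L : ℝ}

lemma continuous (h : IsC1Bounded v v' B L) : Continuous v :=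
  continuous_iff_continuousAt.2 fun z => (h.hasFDerivAt z).continuousAt

lemma nonneg (h : IsC1Bounded v v' B L) : 0 ≤ L := (norm_nonneg _).trans (h.norm_deriv_le 0)

lemma norm_sub_le (h : IsC1Bounded v v' B L) (x y : Space d) : ‖v x - v y‖ ≤ L * ‖x - y‖ :=
  convex_univ.norm_image_sub_le_of_norm_hasFDerivWithin_le
    (fun z _ => (h.hasFDerivAt z).hasFDerivWithinAt) (fun z _ => h.norm_deriv_le z)
    (mem_univ y) (mem_univ x)

end IsC1Bounded

lemma smearedCommutator_eq_stress (hd : 3 ≤ d) {s : ℝ} (hs : 0 < s) {v : Space d → Space d}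
    {v' : Space d → Space d →L[ℝ] Space d} {B L : ℝ} (h : IsC1Bounded v v' B L) (x y : Space d) :
    smearedCommutator v s x y =
      ∫ z, stress (v' z) (heatField s (z - x)) (heatField s (z - y)) := by
  have cF := continuous_heatField hd hs
  have cH := continuous_heatHess (d := d) hs
  have iF := integrable_heatField_sq hd hs
  have iH := integrable_heatHess_sq hd hs
  have hder : ∀ x z : Space d, HasFDerivAt (fun z => heatField s (z - x)) (heatHess s (z - x)) z :=
    fun x z => by
      have := (hasFDerivAt_heatField hd hs (z - x)).comp z ((hasFDerivAt_id z).sub_const x)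
      rwa [ContinuousLinearMap.comp_id] at this
  rw [← integral_stress (H' := fun z => heatHess s (z - y)) (F' := fun z => heatHess s (z - x))
    h.hasFDerivAt (hder x) (hder y) h.continuous_deriv
    (fun z a b => inner_heatHess_symm s _ a b) (fun z a b => inner_heatHess_symm s _ a b)
    h.norm_le h.norm_deriv_le (integrable_norm_mul_norm cF cF iF iF x y)
    (integrable_norm_mul_norm cH cF iH iF x y) (integrable_norm_mul_norm cF cH iF iH x y)]
  simp only [divg_heatHess hd hs, neg_neg, smearedCommutator]

/-- The error made by freezing `v` at the centre of one smeared charge. -/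
noncomputable def freezingError {d : ℕ} (v : Space d → Space d) (s : ℝ) (x y : Space d) : ℝ :=
  ∫ z, inner ℝ (v z - v y) (heatField s (z - x)) * heatKernel s (z - y)

lemma integrable_inner_heatField_mul (hd : 3 ≤ d) {s : ℝ} (hs : 0 < s) {v : Space d → Space d}
    (cv : Continuous v) {B : ℝ} (hB : ∀ z, ‖v z‖ ≤ B) (x y : Space d) :
    Integrable fun z => inner ℝ (v z) (heatField s (z - x)) * heatKernel s (z - y) := by
  have cF := continuous_heatField hd hs
  have cK := continuous_heatKernel (d := d) s
  have hB0 : 0 ≤ B := (norm_nonneg _).trans (hB 0)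
  refine (((integrable_heatKernel hs).comp_sub_right y).const_mul
    (B * (heatConst d * s ^ ((1 - (d : ℝ)) / 2)))).mono' (by fun_prop)
    (Eventually.of_forall fun z => ?_)
  have hk := heatKernel_nonneg (d := d) hs.le (z - y)
  rw [norm_mul, norm_of_nonneg hk]
  refine mul_le_mul_of_nonneg_right ((norm_inner_le_norm _ _).trans ?_) hk
  exact mul_le_mul (hB z) (norm_heatField_le hd hs _) (norm_nonneg _) hB0

lemma smearedCommutator_eq_freezing (hd : 3 ≤ d) {s : ℝ} (hs : 0 < s) {v : Space d → Space d}
    (cv : Continuous v) {B : ℝ} (hB : ∀ z, ‖v z‖ ≤ B) (x y : Space d) :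
    smearedCommutator v s x y = freezingError v s x y + freezingError v s y x +
      inner ℝ (v x - v y) (heatField (2 * s) (x - y)) := by
  have key : ∀ x y : Space d,
      ∫ z, inner ℝ (v z) (heatField s (z - x)) * heatKernel s (z - y) =
        freezingError v s x y + inner ℝ (v y) (heatField (2 * s) (y - x)) := by
    intro x y
    have i1 := integrable_inner_heatField_mul hd hs cv hB x y
    have i2 := integrable_inner_heatField_mul hd hs (v := fun _ => v y) continuous_const
      (B := B) (fun _ => hB y) x y
    have e : ∫ z, inner ℝ (v y) (heatField s (z - x)) * heatKernel s (z - y) =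
        inner ℝ (v y) (heatField (2 * s) (y - x)) := by
      rw [real_inner_comm, ← integral_heatField_mul_heatKernel hd hs x y (v y)]
      congr 1; ext z
      rw [inner_smul_right, real_inner_comm]; ring
    rw [← e, freezingError]
    simp_rw [inner_sub_left, sub_mul]
    rw [integral_sub i1 i2]; ring
  have i1 := integrable_inner_heatField_mul hd hs cv hB x y
  have i2 := integrable_inner_heatField_mul hd hs cv hB y x
  rw [smearedCommutator, integral_add i1 i2, key x y, key y x, inner_sub_left, ← neg_sub x y,
    heatField_neg, inner_neg_right]
  ring

lemma norm_freezing_integrand_le {s : ℝ} (hs : 0 < s) {v : Space d → Space d}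
    {L : ℝ} (hL : ∀ a b, ‖v a - v b‖ ≤ L * ‖a - b‖) (x y z : Space d) :
    ‖inner ℝ (v z - v y) (heatField s (z - x)) * heatKernel s (z - y)‖ ≤
      L * (‖heatField s (z - x)‖ * (‖z - y‖ * heatKernel s (z - y))) := by
  have hk := heatKernel_nonneg (d := d) hs.le (z - y)
  rw [norm_mul, norm_of_nonneg hk]
  calc _ ≤ (L * ‖z - y‖) * ‖heatField s (z - x)‖ * heatKernel s (z - y) := by
        gcongr
        exact (norm_inner_le_norm _ _).trans (by gcongr; exact hL z y)
    _ = _ := by ring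

/-- The freezing error at distance `r` is at most a multiple of `L √s min(s^{(1-d)/2}, r^{1-d})`:
`v` varies by `L √s` over the smeared charge, and the minimum bounds the field there. -/
lemma abs_freezingError_le (hd : 3 ≤ d) : ∃ C : ℝ, 0 < C ∧ ∀ {s : ℝ}, 0 < s →
    ∀ {v : Space d → Space d}, Continuous v → ∀ {L : ℝ}, 0 ≤ L →
    (∀ a b, ‖v a - v b‖ ≤ L * ‖a - b‖) → ∀ x y,
      |freezingError v s x y| ≤ C * L * (√s * s ^ ((1 - (d : ℝ)) / 2)) ∧
      ‖x - y‖ ^ (d - 1) * |freezingError v s x y| ≤ C * L * √s := by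
  have hκ := heatConst_pos d
  have hcf := coulombFieldConst_pos hd
  have hd' : (0 : ℝ) < d := by exact_mod_cast (by omega : 0 < d)
  let m : ℕ → ℝ := fun k => 2 ^ ((d : ℝ) / 2) * (4 * k) ^ ((k : ℝ) / 2)
  have hm1 : 0 < m 1 := by simp only [m]; positivity
  have hmd : 0 < m d := by simp only [m]; positivity
  refine ⟨heatConst d * m 1 + 2 ^ (d - 1 - 1) * (coulombFieldConst d * m 1 + heatConst d * m d),
    by positivity, ?_⟩
  intro s hs v cv L hL0 hL x y
  have i1 := (integrable_norm_pow_mul_heatKernel (d := d) one_pos hs).comp_sub_right y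
  have id' := (integrable_norm_pow_mul_heatKernel (d := d) (by omega : 0 < d) hs).comp_sub_right y
  have I1 : ∫ z, ‖z - y‖ ^ 1 * heatKernel s (z - y) ≤ m 1 * √s := by
    rw [integral_sub_right_eq_self (fun z : Space d => ‖z‖ ^ 1 * heatKernel s z)]
    have := integral_norm_pow_mul_heatKernel_le (d := d) one_pos hs
    simpa [m, sqrt_eq_rpow] using this
  have Id : ∫ z, ‖z - y‖ ^ d * heatKernel s (z - y) ≤ m d * s ^ ((d : ℝ) / 2) := by
    rw [integral_sub_right_eq_self (fun z : Space d => ‖z‖ ^ d * heatKernel s z)]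
    exact integral_norm_pow_mul_heatKernel_le (d := d) (by omega) hs
  constructor
  · have h1 : |freezingError v s x y| ≤
        ∫ z, L * (heatConst d * s ^ ((1 - (d : ℝ)) / 2)) *
          (‖z - y‖ ^ 1 * heatKernel s (z - y)) := by
      rw [freezingError, ← Real.norm_eq_abs]
      refine norm_integral_le_of_norm_le (i1.const_mul _) (Eventually.of_forall fun z => ?_)
      refine (norm_freezing_integrand_le hs hL x y z).trans ?_
      have hk := heatKernel_nonneg (d := d) hs.le (z - y)
      rw [mul_assoc L, pow_one]
      gcongr
      exact norm_heatField_le hd hs _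
    rw [integral_const_mul] at h1
    calc _ ≤ _ := h1
      _ ≤ L * (heatConst d * s ^ ((1 - (d : ℝ)) / 2)) * (m 1 * √s) := by gcongr
      _ = heatConst d * m 1 * L * (√s * s ^ ((1 - (d : ℝ)) / 2)) := by ring
      _ ≤ _ := by gcongr; exact le_add_of_nonneg_right (by positivity)
  · have h1 : |‖x - y‖ ^ (d - 1) * freezingError v s x y| ≤
        ∫ z, (L * 2 ^ (d - 1 - 1) * coulombFieldConst d * (‖z - y‖ ^ 1 * heatKernel s (z - y)) +
          L * 2 ^ (d - 1 - 1) * (heatConst d * s ^ ((1 - (d : ℝ)) / 2)) *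
            (‖z - y‖ ^ d * heatKernel s (z - y))) := by
      rw [freezingError, ← integral_const_mul, ← Real.norm_eq_abs]
      have hI : Integrable fun z => L * 2 ^ (d - 1 - 1) * coulombFieldConst d *
          (‖z - y‖ ^ 1 * heatKernel s (z - y)) + L * 2 ^ (d - 1 - 1) *
          (heatConst d * s ^ ((1 - (d : ℝ)) / 2)) * (‖z - y‖ ^ d * heatKernel s (z - y)) :=
        (i1.const_mul _).add (id'.const_mul _)
      refine norm_integral_le_of_norm_le hI (Eventually.of_forall fun z => ?_)
      have hk := heatKernel_nonneg (d := d) hs.le (z - y)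
      rw [norm_mul, norm_of_nonneg (by positivity : 0 ≤ ‖x - y‖ ^ (d - 1))]
      have hr : ‖x - y‖ ^ (d - 1) ≤
          2 ^ (d - 1 - 1) * (‖z - x‖ ^ (d - 1) + ‖z - y‖ ^ (d - 1)) := by
        refine le_trans ?_ (add_pow_le (norm_nonneg _) (norm_nonneg _) _)
        gcongr
        calc ‖x - y‖ = ‖(z - y) - (z - x)‖ := by congr 1; abel
          _ ≤ _ := (norm_sub_le _ _).trans (by rw [add_comm])
      have e1 : ‖z - y‖ ^ d = ‖z - y‖ * ‖z - y‖ ^ (d - 1) := by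
        rw [← pow_succ']; congr 1; omega
      have n1 := norm_heatField_mul_le hd hs.le (z - x)
      have n2 := norm_heatField_le hd hs (z - x)
      calc _ ≤ (2 ^ (d - 1 - 1) * (‖z - x‖ ^ (d - 1) + ‖z - y‖ ^ (d - 1))) *
            (L * (‖heatField s (z - x)‖ * (‖z - y‖ * heatKernel s (z - y)))) := by
            gcongr
            exact norm_freezing_integrand_le hs hL x y z
        _ = L * 2 ^ (d - 1 - 1) * (‖heatField s (z - x)‖ * ‖z - x‖ ^ (d - 1)) *
              (‖z - y‖ ^ 1 * heatKernel s (z - y)) +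
            L * 2 ^ (d - 1 - 1) * ‖heatField s (z - x)‖ * (‖z - y‖ ^ d * heatKernel s (z - y)) := by
            rw [e1]; ring
        _ ≤ _ := by gcongr
    rw [integral_add (i1.const_mul _) (id'.const_mul _), integral_const_mul, integral_const_mul,
      abs_mul, abs_of_nonneg (by positivity : 0 ≤ ‖x - y‖ ^ (d - 1))] at h1
    have hsd : s ^ ((1 - (d : ℝ)) / 2) * s ^ ((d : ℝ) / 2) = √s := by
      rw [← rpow_add hs, sqrt_eq_rpow]; congr 1; ring
    calc _ ≤ _ := h1
      _ ≤ L * 2 ^ (d - 1 - 1) * coulombFieldConst d * (m 1 * √s) +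
          L * 2 ^ (d - 1 - 1) * (heatConst d * s ^ ((1 - (d : ℝ)) / 2)) *
            (m d * s ^ ((d : ℝ) / 2)) := by gcongr
      _ = L * 2 ^ (d - 1 - 1) * coulombFieldConst d * (m 1 * √s) +
          L * 2 ^ (d - 1 - 1) * heatConst d * m d *
            (s ^ ((1 - (d : ℝ)) / 2) * s ^ ((d : ℝ) / 2)) := by ring
      _ = 2 ^ (d - 1 - 1) * (coulombFieldConst d * m 1 + heatConst d * m d) * L * √s := by
          rw [hsd]; ring
      _ ≤ _ := by gcongr; exact le_add_of_nonneg_left (by positivity)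

lemma norm_heatField_sub_le (hd : 3 ≤ d) : ∃ C : ℝ, 0 < C ∧ ∀ {τ : ℝ}, 0 < τ →
    ∀ w : Space d, w ≠ 0 →
      ‖heatField τ w - heatField 0 w‖ * ‖w‖ ^ (d - 1) ≤ C ∧
      ‖heatField τ w - heatField 0 w‖ * ‖w‖ ^ d ≤ C * √τ := by
  have hκ := heatConst_pos d
  have hcf := coulombFieldConst_pos hd
  have hd' : (3 : ℝ) ≤ d := by exact_mod_cast hd
  set C₀ : ℝ := (4 * (((d : ℝ) + 1) / 2)) ^ (((d : ℝ) + 1) / 2) /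
    (((d : ℝ) + 1) / 2 - ((d : ℝ) / 2 + 1) + 1) with hC₀
  have hC₀' : 0 < C₀ := by
    refine div_pos (by positivity) (by linarith)
  refine ⟨2 * coulombFieldConst d + heatConst d / 2 * C₀, by positivity, ?_⟩
  intro τ hτ w hw
  have hr : 0 < ‖w‖ := norm_pos_iff.2 hw
  constructor
  · have h1 := norm_heatField_mul_le hd hτ.le w
    have h2 := norm_heatField_mul_le hd le_rfl w
    calc _ ≤ (‖heatField τ w‖ + ‖heatField 0 w‖) * ‖w‖ ^ (d - 1) := by
          gcongr; exact norm_sub_le _ _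
      _ ≤ 2 * coulombFieldConst d := by linarith
      _ ≤ _ := le_add_of_nonneg_right (by positivity)
  · have h1 := timeIntegral_sub_le (b := (d : ℝ) / 2 + 1) (m := ((d : ℝ) + 1) / 2) (τ := τ)
      (u := ‖w‖ ^ 2) (by linarith) (by linarith) hτ.le (by positivity)
    have h2 := timeIntegral_sub_nonneg (b := (d : ℝ) / 2 + 1) (τ := τ)
      (u := ‖w‖ ^ 2) (by linarith) hτ.le (by positivity)
    have e1 : heatField τ w - heatField 0 w = (heatConst d / 2 *
        (timeIntegral ((d : ℝ) / 2 + 1) 0 (‖w‖ ^ 2) -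
          timeIntegral ((d : ℝ) / 2 + 1) τ (‖w‖ ^ 2))) • w := by
      rw [heatField, heatField, ← sub_smul]; congr 1; ring
    have e2 : (‖w‖ ^ 2) ^ (-(((d : ℝ) + 1) / 2)) * (‖w‖ * ‖w‖ ^ d) = 1 := by
      rw [← pow_succ', ← rpow_natCast, ← rpow_natCast, ← rpow_mul hr.le, ← rpow_add hr]
      convert rpow_zero ‖w‖ using 2
      push_cast; ring
    have e3 : τ ^ (((d : ℝ) + 1) / 2 - ((d : ℝ) / 2 + 1) + 1) = √τ := by
      rw [sqrt_eq_rpow]; congr 1; ring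
    rw [e3, ← hC₀] at h1
    rw [e1, norm_smul, norm_of_nonneg (by positivity)]
    calc _ = heatConst d / 2 * (timeIntegral ((d : ℝ) / 2 + 1) 0 (‖w‖ ^ 2) -
          timeIntegral ((d : ℝ) / 2 + 1) τ (‖w‖ ^ 2)) * (‖w‖ * ‖w‖ ^ d) := by ring
      _ ≤ heatConst d / 2 * (C₀ * √τ * (‖w‖ ^ 2) ^ (-(((d : ℝ) + 1) / 2))) *
          (‖w‖ * ‖w‖ ^ d) := by gcongr
      _ = heatConst d / 2 * C₀ * √τ * ((‖w‖ ^ 2) ^ (-(((d : ℝ) + 1) / 2)) *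
          (‖w‖ * ‖w‖ ^ d)) := by ring
      _ = heatConst d / 2 * C₀ * √τ := by rw [e2, mul_one]
      _ ≤ _ := by gcongr; exact le_add_of_nonneg_left (by positivity)

/-- Smearing at time `s` changes the commutator kernel at distance `r` by at most
`C L r^{2-d} min(1, √s / r)`, and leaves a self-interaction of size `C L s^{1-d/2}`. -/
lemma abs_smearedCommutator_sub_le (hd : 3 ≤ d) : ∃ C : ℝ, 0 < C ∧ ∀ {s : ℝ}, 0 < s →
    ∀ {v : Space d → Space d} {v' : Space d → Space d →L[ℝ] Space d} {B L : ℝ},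
    IsC1Bounded v v' B L →
      (∀ x, |smearedCommutator v s x x| ≤ C * L * s ^ (1 - (d : ℝ) / 2)) ∧
      ∀ x y, x ≠ y →
        |smearedCommutator v s x y - inner ℝ (v x - v y) (heatField 0 (x - y))| ≤
            C * L * ‖x - y‖ ^ (2 - (d : ℝ)) ∧
        |smearedCommutator v s x y - inner ℝ (v x - v y) (heatField 0 (x - y))| ≤
            C * L * (√s * ‖x - y‖ ^ (1 - (d : ℝ))) := by
  obtain ⟨C₁, hC₁, H₁⟩ := abs_freezingError_le hd
  obtain ⟨C₂, hC₂, H₂⟩ := norm_heatField_sub_le hd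
  refine ⟨2 * C₁ + 2 * C₂, by positivity, ?_⟩
  intro s hs v v' B L h
  have hL := h.nonneg
  have hLip := h.norm_sub_le
  have hss : √s * s ^ ((1 - (d : ℝ)) / 2) = s ^ (1 - (d : ℝ) / 2) := by
    rw [sqrt_eq_rpow, ← rpow_add hs]; congr 1; ring
  constructor
  · intro x
    have h1 := (H₁ hs h.continuous hL hLip x x).1
    rw [smearedCommutator_eq_freezing hd hs h.continuous h.norm_le, sub_self, inner_zero_left,
      add_zero]
    rw [hss] at h1
    calc _ ≤ _ := abs_add_le _ _
      _ ≤ C₁ * L * s ^ (1 - (d : ℝ) / 2) + C₁ * L * s ^ (1 - (d : ℝ) / 2) := add_le_add h1 h1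
      _ = 2 * C₁ * L * s ^ (1 - (d : ℝ) / 2) := by ring
      _ ≤ _ := by gcongr; linarith
  · intro x y hxy
    have hw : x - y ≠ 0 := sub_ne_zero.2 hxy
    have hr : 0 < ‖x - y‖ := norm_pos_iff.2 hw
    set r := ‖x - y‖ with hrdef
    have e0 : smearedCommutator v s x y - inner ℝ (v x - v y) (heatField 0 (x - y)) =
        freezingError v s x y + freezingError v s y x +
        inner ℝ (v x - v y) (heatField (2 * s) (x - y) - heatField 0 (x - y)) := by
      rw [smearedCommutator_eq_freezing hd hs h.continuous h.norm_le, inner_sub_right]; ring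
    have hE : ∀ a b : Space d, ‖a - b‖ = r →
        |freezingError v s a b| ≤ C₁ * L * r ^ (2 - (d : ℝ)) ∧
        |freezingError v s a b| ≤ C₁ * L * (√s * r ^ (1 - (d : ℝ))) := by
      intro a b hab
      obtain ⟨h1, h2⟩ := H₁ hs h.continuous hL hLip a b
      have h3 : |freezingError v s a b| ≤ C₁ * L * (√s * r ^ (1 - (d : ℝ))) := by
        rw [hab, mul_comm, ← le_div_iff₀ (by positivity)] at h2
        rwa [rpow_one_sub_nat hd hr, ← div_eq_mul_inv, ← mul_div_assoc]
      refine ⟨?_, h3⟩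
      rcases le_total √s r with hsr | hsr
      · refine h3.trans ?_
        gcongr
        rw [show 2 - (d : ℝ) = 1 + (1 - d) by ring, rpow_add hr, rpow_one]
        gcongr
      · refine h1.trans ?_
        rw [hss]
        gcongr
        have : s ^ (1 - (d : ℝ) / 2) = √s ^ (2 - (d : ℝ)) := by
          rw [sqrt_eq_rpow, ← rpow_mul hs.le]; congr 1; ring
        rw [this]
        have hd' : (3 : ℝ) ≤ d := by exact_mod_cast hd
        exact rpow_le_rpow_of_nonpos hr hsr (by linarith)
    have hE1 := hE x y rfl
    have hE2 := hE y x (by rw [norm_sub_rev])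
    have hI : |inner ℝ (v x - v y) (heatField (2 * s) (x - y) - heatField 0 (x - y))| ≤
        L * r * ‖heatField (2 * s) (x - y) - heatField 0 (x - y)‖ :=
      (abs_real_inner_le_norm _ _).trans (by gcongr; exact hLip x y)
    obtain ⟨g1, g2⟩ := H₂ (τ := 2 * s) (by positivity) (x - y) hw
    rw [← hrdef] at g1 g2
    set n := ‖heatField (2 * s) (x - y) - heatField 0 (x - y)‖
    have r1 : r ^ (d - 1) * r ^ (1 - (d : ℝ)) = 1 := by
      rw [rpow_one_sub_nat hd hr]; field_simp
    have r2 : r * r ^ (1 - (d : ℝ)) = r ^ (2 - (d : ℝ)) := by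
      rw [show 2 - (d : ℝ) = 1 + (1 - d) by ring, rpow_add hr, rpow_one]
    have r3 : r ^ d * r ^ (1 - (d : ℝ)) = r := by
      have : r ^ d = r * r ^ (d - 1) := by rw [← pow_succ']; congr 1; omega
      rw [this, mul_assoc, r1, mul_one]
    have hI1 : L * r * n ≤ C₂ * L * r ^ (2 - (d : ℝ)) := by
      have := mul_le_mul_of_nonneg_right g1 (by positivity : 0 ≤ L * (r * r ^ (1 - (d : ℝ))))
      calc L * r * n = n * r ^ (d - 1) * (L * (r * r ^ (1 - (d : ℝ)))) := by
            linear_combination (-L * r * n) * r1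
        _ ≤ _ := this
        _ = _ := by rw [r2]; ring
    have hI2 : L * r * n ≤ 2 * C₂ * L * (√s * r ^ (1 - (d : ℝ))) := by
      have := mul_le_mul_of_nonneg_right g2 (by positivity : 0 ≤ L * r ^ (1 - (d : ℝ)))
      have h2s : √(2 * s) ≤ 2 * √s := by
        rw [sqrt_mul (by norm_num)]
        gcongr
        rw [sqrt_le_left (by norm_num)]; norm_num
      calc L * r * n = n * r ^ d * (L * r ^ (1 - (d : ℝ))) := by
            linear_combination (-L * n) * r3
        _ ≤ _ := this
        _ ≤ C₂ * (2 * √s) * (L * r ^ (1 - (d : ℝ))) := by gcongr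
        _ = _ := by ring
    rw [e0]
    have htri := abs_add_three (freezingError v s x y) (freezingError v s y x)
      (inner ℝ (v x - v y) (heatField (2 * s) (x - y) - heatField 0 (x - y)))
    have p1 : 0 ≤ C₂ * L * r ^ (2 - (d : ℝ)) := by positivity
    constructor
    · refine htri.trans ?_
      calc _ ≤ C₁ * L * r ^ (2 - (d : ℝ)) + C₁ * L * r ^ (2 - (d : ℝ)) +
            C₂ * L * r ^ (2 - (d : ℝ)) :=
            add_le_add (add_le_add hE1.1 hE2.1) (hI.trans hI1)
        _ ≤ _ := by linarith
    · refine htri.trans ((add_le_add (add_le_add hE1.2 hE2.2) (hI.trans hI2)).trans ?_)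
      linarith

/-! ### Quadratic forms in a signed charge distribution -/

/-- Fubini for a bilinear form in the field generated by the signed charge `f ν`. -/
lemma integral_bilinear_field {B : Space d → Space d →L[ℝ] Space d →L[ℝ] ℝ} (cB : Continuous B)
    {L : ℝ} (hB : ∀ z, ‖B z‖ ≤ L) {F : Space d → Space d} (cF : Continuous F) {C : ℝ}
    (hF : ∀ w, ‖F w‖ ≤ C) (iF : Integrable fun w => ‖F w‖ ^ 2) (ν : Measure (Space d))
    [IsFiniteMeasure ν] {f : Space d → ℝ} (mf : Measurable f) (hf : ∀ x, |f x| ≤ 1) :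
    (Integrable fun z => B z (∫ x, f x • F (z - x) ∂ν) (∫ x, f x • F (z - x) ∂ν)) ∧
    ∫ p : Space d × Space d, (∫ z, B z (F (z - p.1)) (F (z - p.2))) * (f p.1 * f p.2) ∂ν.prod ν =
      ∫ z, B z (∫ x, f x • F (z - x) ∂ν) (∫ x, f x • F (z - x) ∂ν) := by
  have hL0 : 0 ≤ L := (norm_nonneg (B 0)).trans (hB 0)
  have hC0 : 0 ≤ C := (norm_nonneg _).trans (hF 0)
  let Φ : Space d × Space d → Space d → ℝ := fun p z =>
    B z (F (z - p.1)) (F (z - p.2)) * (f p.1 * f p.2)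
  have hΦ : ∀ p z, ‖Φ p z‖ ≤ L * (‖F (z - p.1)‖ * ‖F (z - p.2)‖) := by
    intro p z
    have h1 : ‖B z (F (z - p.1)) (F (z - p.2))‖ ≤ L * (‖F (z - p.1)‖ * ‖F (z - p.2)‖) := by
      refine ((B z).le_opNorm₂ _ _).trans ?_
      rw [mul_assoc]; gcongr; exact hB z
    have h2 : ‖f p.1 * f p.2‖ ≤ 1 := by
      rw [norm_mul]
      exact mul_le_one₀ (hf _) (norm_nonneg _) (hf _)
    rw [norm_mul]
    exact (mul_le_of_le_one_right (norm_nonneg _) h2).trans h1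
  have mB : Continuous fun q : (Space d × Space d) × Space d =>
      B q.2 (F (q.2 - q.1.1)) (F (q.2 - q.1.2)) := by fun_prop
  have mΦ : Measurable (Function.uncurry Φ) := by
    refine mB.measurable.mul ?_
    exact (mf.comp (measurable_fst.comp measurable_fst)).mul
      (mf.comp (measurable_snd.comp measurable_fst))
  have ip : ∀ p : Space d × Space d, Integrable fun z => ‖F (z - p.1)‖ * ‖F (z - p.2)‖ :=
    fun p => integrable_norm_mul_norm cF cF iF iF _ _
  have hint : Integrable (Function.uncurry Φ) ((ν.prod ν).prod volume) := by
    rw [integrable_prod_iff mΦ.aestronglyMeasurable]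
    constructor
    · refine Eventually.of_forall fun p => ((ip p).const_mul L).mono' ?_
        (Eventually.of_forall (hΦ p))
      exact (mΦ.comp measurable_prodMk_left).aestronglyMeasurable
    · refine (integrable_const (L * ∫ w, ‖F w‖ ^ 2)).mono'
        mΦ.aestronglyMeasurable.norm.integral_prod_right' (Eventually.of_forall fun p => ?_)
      rw [norm_of_nonneg (integral_nonneg fun _ => norm_nonneg _)]
      have e : ∀ a : Space d, ∫ z, ‖F (z - a)‖ ^ 2 = ∫ w, ‖F w‖ ^ 2 := fun a =>
        integral_sub_right_eq_self (fun w => ‖F w‖ ^ 2) a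
      calc ∫ z, ‖Φ p z‖ ≤ ∫ z, L * ((1 / 2) * ‖F (z - p.1)‖ ^ 2 + (1 / 2) * ‖F (z - p.2)‖ ^ 2) := by
            refine integral_mono_of_nonneg (Eventually.of_forall fun _ => norm_nonneg _)
              ((((iF.comp_sub_right p.1).const_mul _).add
                ((iF.comp_sub_right p.2).const_mul _)).const_mul L)
              (Eventually.of_forall fun z => (hΦ p z).trans ?_)
            simp only
            gcongr
            nlinarith [sq_nonneg (‖F (z - p.1)‖ - ‖F (z - p.2)‖)]
        _ = L * ∫ w, ‖F w‖ ^ 2 := by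
            rw [integral_const_mul, integral_add ((iF.comp_sub_right p.1).const_mul _)
              ((iF.comp_sub_right p.2).const_mul _), integral_const_mul, integral_const_mul, e, e]
            ring
  have hz : ∀ z, ∫ p, Φ p z ∂ν.prod ν =
      B z (∫ x, f x • F (z - x) ∂ν) (∫ x, f x • F (z - x) ∂ν) := by
    intro z
    have ha : Integrable (fun x => f x • F (z - x)) ν := by
      refine (integrable_const C).mono' (mf.aestronglyMeasurable.smul
        (by fun_prop : Continuous fun x => F (z - x)).aestronglyMeasurable)
        (Eventually.of_forall fun x => ?_)
      rw [norm_smul]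
      exact (mul_le_of_le_one_left (norm_nonneg _) (hf x)).trans (hF _)
    have hΦz : Integrable (fun p => Φ p z) (ν.prod ν) := by
      refine (integrable_const (L * (C * C))).mono'
        (mΦ.comp measurable_prodMk_right).aestronglyMeasurable
        (Eventually.of_forall fun p => (hΦ p z).trans ?_)
      gcongr <;> exact hF _
    rw [integral_prod _ hΦz]
    have h1 : ∀ x, ∫ y, Φ (x, y) z ∂ν = (B z).flip (∫ x, f x • F (z - x) ∂ν) (f x • F (z - x)) := by
      intro x
      rw [ContinuousLinearMap.flip_apply, ← (B z (f x • F (z - x))).integral_comp_comm ha]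
      refine integral_congr_ae (Eventually.of_forall fun y => ?_)
      simp only [Φ, map_smul, _root_.smul_apply, smul_eq_mul]
      ring
    simp_rw [h1]
    rw [((B z).flip _).integral_comp_comm ha, ContinuousLinearMap.flip_apply]
  have hsw := integral_integral_swap hint
  have hr := hint.integral_prod_right
  simp only [Function.uncurry_apply_pair, hz] at hr
  refine ⟨hr, ?_⟩
  simp_rw [hz] at hsw
  rw [← hsw]
  refine integral_congr_ae (Eventually.of_forall fun p => ?_)
  simp only [Φ]
  rw [integral_mul_const]

/-- The inner product as a bilinear form over `ℝ`. -/
noncomputable def innerForm (d : ℕ) : Space d →L[ℝ] Space d →L[ℝ] ℝ := innerSL ℝ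

lemma innerForm_apply (a b : Space d) : innerForm d a b = inner ℝ a b := rfl

/-- The stress-energy density as a continuous bilinear form. -/
noncomputable def stressForm (D : Space d →L[ℝ] Space d) : Space d →L[ℝ] Space d →L[ℝ] ℝ :=
  ((innerForm d).comp D).flip + (innerForm d).comp D - divg D • innerForm d

lemma stressForm_apply (D : Space d →L[ℝ] Space d) (a b : Space d) :
    stressForm D a b = stress D a b := by
  simp [stressForm, stress, innerForm_apply, mul_comm]

lemma norm_stressForm_le (D : Space d →L[ℝ] Space d) : ‖stressForm D‖ ≤ (2 + d) * ‖D‖ := by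
  refine ContinuousLinearMap.opNorm_le_bound₂ _ (by positivity) fun a b => ?_
  rw [stressForm_apply, mul_assoc]
  exact abs_stress_le D a b

lemma continuous_stressForm : Continuous (stressForm (d := d)) := by
  have h1 : Continuous fun D : Space d →L[ℝ] Space d => (innerForm d).comp D :=
    ((ContinuousLinearMap.compL ℝ (Space d) (Space d) (Space d →L[ℝ] ℝ)) (innerForm d)).continuous
  have h2 := (ContinuousLinearMap.flipₗᵢ ℝ (Space d) (Space d) ℝ).continuous.comp h1
  have h3 := continuous_divg (d := d)
  exact (h2.add h1).sub (h3.smul continuous_const)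

/-- The commutator estimate for smeared charges: the stress-energy tensor of the field bounds the
commutator by the Lipschitz constant of `v` times the energy of the smeared charges. -/
lemma smearedCommutator_form_le (hd : 3 ≤ d) {s : ℝ} (hs : 0 < s) (ν : Measure (Space d))
    [IsFiniteMeasure ν] {f : Space d → ℝ} (mf : Measurable f) (hf : ∀ x, |f x| ≤ 1) :
    0 ≤ ∫ p : Space d × Space d, heatPot (2 * s) (p.1 - p.2) * (f p.1 * f p.2) ∂ν.prod ν ∧
    ∀ {v : Space d → Space d} {v' : Space d → Space d →L[ℝ] Space d} {B L : ℝ},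
    IsC1Bounded v v' B L →
    |∫ p : Space d × Space d, smearedCommutator v s p.1 p.2 * (f p.1 * f p.2) ∂ν.prod ν| ≤
      (2 + d) * L *
        ∫ p : Space d × Space d, heatPot (2 * s) (p.1 - p.2) * (f p.1 * f p.2) ∂ν.prod ν := by
  have cF := continuous_heatField hd hs
  have iF := integrable_heatField_sq hd hs
  have hF := norm_heatField_le (d := d) hd hs
  obtain ⟨j1, j2⟩ := integral_bilinear_field (B := fun _ => innerForm d) continuous_const
    (L := ‖innerForm d‖) (fun _ => le_rfl) cF hF iF ν mf hf
  simp only [innerForm_apply, real_inner_self_eq_norm_sq,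
    integral_inner_heatField_heatField hd hs] at j1 j2
  refine ⟨j2 ▸ integral_nonneg fun _ => by positivity, ?_⟩
  intro v v' B L h
  obtain ⟨k1, k2⟩ := integral_bilinear_field (B := fun z => stressForm (v' z))
    (continuous_stressForm.comp h.continuous_deriv) (L := (2 + d) * L)
    (fun z => (norm_stressForm_le _).trans (by gcongr; exact h.norm_deriv_le z)) cF hF iF ν mf hf
  simp only [stressForm_apply, ← smearedCommutator_eq_stress hd hs h] at k2
  rw [j2, k2, ← integral_const_mul, ← Real.norm_eq_abs]
  refine norm_integral_le_of_norm_le (j1.const_mul _) (Eventually.of_forall fun z => ?_)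
  refine (abs_stress_le _ _ _).trans ?_
  rw [← sq]
  gcongr
  exact h.norm_deriv_le z

/-! ### The Coulomb potential as a time integral -/

lemma heatConst_mul_four_rpow (d : ℕ) :
    heatConst d * 4 ^ ((d : ℝ) / 2) = (π ^ ((d : ℝ) / 2))⁻¹ := by
  rw [heatConst, mul_rpow (by norm_num) pi_pos.le, rpow_neg (by norm_num), rpow_neg pi_pos.le]
  field_simp

lemma coulombConst_pos (hd : 3 ≤ d) : 0 < coulombConst d := by
  have hd' : (3 : ℝ) ≤ d := by exact_mod_cast hd
  have := Gamma_pos_of_pos (show 0 < (d : ℝ) / 2 - 1 by linarith)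
  unfold coulombConst; positivity

lemma coulombRadial_pos (hd : 3 ≤ d) {r : ℝ} (hr : 0 < r) : 0 < coulombRadial d r :=
  mul_pos (coulombConst_pos hd) (rpow_pos_of_pos hr _)

lemma coulomb_eq_heatPot_zero (hd : 3 ≤ d) {w : Space d} (hw : w ≠ 0) :
    coulomb d w = heatPot 0 w := by
  have hd' : (3 : ℝ) ≤ d := by exact_mod_cast hd
  have hr : 0 < ‖w‖ := norm_pos_iff.2 hw
  rw [heatPot, (integrableOn_timeIntegrand_zero (by linarith) (by positivity)).2,
    four_div_sq_rpow hr, coulomb, coulombRadial, coulombConst,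
    rpow_sub (by norm_num : (0 : ℝ) < 4), rpow_one]
  rw [show -(2 * ((d : ℝ) / 2 - 1)) = 2 - d by ring]
  have := heatConst_mul_four_rpow d
  have hp : 0 < π ^ ((d : ℝ) / 2) := by positivity
  linear_combination (-(1 / 4) * ‖w‖ ^ (2 - (d : ℝ)) * Gamma ((d : ℝ) / 2 - 1)) * this

lemma hasGradientAt_coulomb (hd : 3 ≤ d) {w : Space d} (hw : w ≠ 0) :
    HasGradientAt (coulomb d) (heatField 0 w) w := by
  have hd' : (3 : ℝ) ≤ d := by exact_mod_cast hd
  have hr : 0 < ‖w‖ := norm_pos_iff.2 hw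
  have e : coulomb d = fun w => coulombConst d * (‖w‖ ^ 2) ^ (1 - (d : ℝ) / 2) := by
    ext w
    rw [coulomb, coulombRadial, ← rpow_natCast, ← rpow_mul (norm_nonneg _)]
    congr 2; push_cast; ring
  rw [hasGradientAt_iff_hasFDerivAt, e]
  have h1 := (((hasFDerivAt_id w).norm_sq.rpow_const (p := 1 - (d : ℝ) / 2)
    (Or.inl (by simpa using hw))).const_mul (coulombConst d))
  refine h1.congr_fderiv ?_
  ext1 u
  have hΓ : Gamma ((d : ℝ) / 2) = ((d : ℝ) / 2 - 1) * Gamma ((d : ℝ) / 2 - 1) := by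
    rw [← Gamma_add_one (by linarith), sub_add_cancel]
  have hk := heatConst_mul_four_rpow d
  have hp : 0 < π ^ ((d : ℝ) / 2) := by positivity
  have hn : (‖w‖ ^ 2) ^ (1 - (d : ℝ) / 2 - 1) = ‖w‖ ^ (-(2 * ((d : ℝ) / 2))) := by
    rw [← rpow_natCast, ← rpow_mul (norm_nonneg _)]; congr 1; push_cast; ring
  simp only [id, ContinuousLinearMap.comp_id, _root_.smul_apply, innerSL_apply_apply, smul_eq_mul,
    InnerProductSpace.toDual_apply_apply, heatField, inner_smul_left, conj_trivial, hn]
  rw [(integrableOn_timeIntegrand_zero (by linarith) (by positivity)).2, four_div_sq_rpow hr,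
    add_sub_cancel_right, hΓ, coulombConst, nsmul_eq_mul]
  push_cast
  linear_combination ((1 / 2) * ‖w‖ ^ (-(2 * ((d : ℝ) / 2))) * ((d : ℝ) / 2 - 1) *
    Gamma ((d : ℝ) / 2 - 1) * inner ℝ w u) * hk

lemma gradient_coulomb (hd : 3 ≤ d) {w : Space d} (hw : w ≠ 0) :
    gradient (coulomb d) w = heatField 0 w :=
  (hasGradientAt_coulomb hd hw).gradient

lemma heatPot_nonneg {s : ℝ} (hs : 0 ≤ s) (w : Space d) : 0 ≤ heatPot s w :=
  mul_nonneg (heatConst_pos d).le (timeIntegral_nonneg _ hs)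

lemma heatPot_at_zero (hd : 3 ≤ d) {s : ℝ} (hs : 0 < s) :
    heatPot s (0 : Space d) = heatConst d / ((d : ℝ) / 2 - 1) * s ^ (1 - (d : ℝ) / 2) := by
  have hd' : (3 : ℝ) ≤ d := by exact_mod_cast hd
  rw [heatPot, norm_zero, zero_pow two_ne_zero, timeIntegral_at_zero (by linarith) hs]
  ring

lemma heatPot_le_at_zero (hd : 3 ≤ d) {s : ℝ} (hs : 0 < s) (w : Space d) :
    heatPot s w ≤ heatPot s (0 : Space d) := by
  have hd' : (3 : ℝ) ≤ d := by exact_mod_cast hd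
  have hκ := heatConst_pos d
  rw [heatPot, heatPot, norm_zero, zero_pow two_ne_zero, timeIntegral_at_zero (by linarith) hs]
  gcongr
  exact timeIntegral_le (by linarith) hs (by positivity)

lemma continuous_heatPot (hd : 3 ≤ d) {s : ℝ} (hs : 0 < s) : Continuous (heatPot (d := d) s) := by
  have hd' : (3 : ℝ) ≤ d := by exact_mod_cast hd
  have := continuous_timeIntegral (b := (d : ℝ) / 2) (by linarith) hs
  unfold heatPot; fun_prop

/-- A radial profile that dominates the short-range part of the Coulomb potential at unit scale.
Near the origin it is more singular by half a power, which leaves room for a logarithm. -/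
noncomputable def tailProfile (d : ℕ) (r : ℝ) : ℝ :=
  if r < 1 then r ^ (3 / 2 - (d : ℝ)) else r ^ (-((d : ℝ) + 2))

lemma tailProfile_nonneg {r : ℝ} (hr : 0 ≤ r) : 0 ≤ tailProfile d r := by
  unfold tailProfile; split_ifs <;> positivity

lemma measurable_tailProfile (d : ℕ) : Measurable (tailProfile d) := by
  unfold tailProfile
  exact Measurable.ite measurableSet_Iio (by fun_prop) (by fun_prop)

lemma rpow_le_tailProfile {r ε : ℝ} (hr : 0 < r) (hrε : r < ε) :
    r ^ (2 - (d : ℝ)) ≤ ε ^ (2 - (d : ℝ)) * tailProfile d (r / ε) := by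
  have hε : 0 < ε := hr.trans hrε
  have h1 : r / ε < 1 := (div_lt_one hε).2 hrε
  have h2 : 0 < r / ε := by positivity
  rw [tailProfile, if_pos h1]
  calc r ^ (2 - (d : ℝ)) = ε ^ (2 - (d : ℝ)) * (r / ε) ^ (2 - (d : ℝ)) := by
        rw [← mul_rpow hε.le h2.le, mul_div_cancel₀ _ hε.ne']
    _ ≤ _ := by
        gcongr ?_ * ?_
        exact rpow_le_rpow_of_exponent_ge h2 h1.le (by linarith)

/-- The short-range part of the Coulomb potential is positive, dominated by the rescaled tail
profile, and comparable to the full potential at distances `r ≤ ε`. -/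
lemma coulomb_sub_heatPot (hd : 3 ≤ d) : ∃ C c : ℝ, 0 < C ∧ 0 < c ∧ ∀ {ε : ℝ}, 0 < ε →
    ∀ w : Space d, w ≠ 0 →
      0 ≤ coulomb d w - heatPot (ε ^ 2) w ∧
      coulomb d w - heatPot (ε ^ 2) w ≤ C * (ε ^ (2 - (d : ℝ)) * tailProfile d (‖w‖ / ε)) ∧
      (‖w‖ ≤ ε → c * ‖w‖ ^ (2 - (d : ℝ)) ≤ coulomb d w - heatPot (ε ^ 2) w) := by
  have hd' : (3 : ℝ) ≤ d := by exact_mod_cast hd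
  have hκ := heatConst_pos d
  have hc := coulombConst_pos hd
  set C₀ : ℝ := (4 * ((d : ℝ) / 2 + 1)) ^ ((d : ℝ) / 2 + 1) /
    ((d : ℝ) / 2 + 1 - (d : ℝ) / 2 + 1) with hC₀
  have hC₀' : 0 < C₀ := div_pos (by positivity) (by linarith)
  refine ⟨coulombConst d + heatConst d * C₀, heatConst d * (exp (-1) / 2), by positivity,
    by positivity, ?_⟩
  intro ε hε w hw
  have hr : 0 < ‖w‖ := norm_pos_iff.2 hw
  have e : coulomb d w - heatPot (ε ^ 2) w = heatConst d *
      (timeIntegral ((d : ℝ) / 2) 0 (‖w‖ ^ 2) - timeIntegral ((d : ℝ) / 2) (ε ^ 2) (‖w‖ ^ 2)) := by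
    rw [coulomb_eq_heatPot_zero hd hw, heatPot, heatPot]; ring
  refine ⟨?_, ?_, ?_⟩
  · rw [e]
    exact mul_nonneg hκ.le (timeIntegral_sub_nonneg (by linarith) (by positivity) (by positivity))
  · have ht := tailProfile_nonneg (d := d) (div_nonneg hr.le hε.le)
    rcases lt_or_ge ‖w‖ ε with h | h
    · have h1 := heatPot_nonneg (d := d) (sq_nonneg ε) w
      calc _ ≤ coulomb d w := by linarith
        _ = coulombConst d * ‖w‖ ^ (2 - (d : ℝ)) := rfl
        _ ≤ coulombConst d * (ε ^ (2 - (d : ℝ)) * tailProfile d (‖w‖ / ε)) := by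
            gcongr; exact rpow_le_tailProfile hr h
        _ ≤ _ := by gcongr; exact le_add_of_nonneg_right (by positivity)
    · have h1 := timeIntegral_sub_le (b := (d : ℝ) / 2) (m := (d : ℝ) / 2 + 1) (τ := ε ^ 2)
        (u := ‖w‖ ^ 2) (by linarith) (by linarith) (by positivity) (by positivity)
      rw [← hC₀] at h1
      have e1 : (ε ^ 2) ^ ((d : ℝ) / 2 + 1 - (d : ℝ) / 2 + 1) *
          (‖w‖ ^ 2) ^ (-((d : ℝ) / 2 + 1)) = ε ^ (2 - (d : ℝ)) * tailProfile d (‖w‖ / ε) := by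
        have h2 : ¬ ‖w‖ / ε < 1 := by rw [not_lt, one_le_div hε]; exact h
        rw [tailProfile, if_neg h2, ← rpow_natCast, ← rpow_natCast, ← rpow_mul hε.le,
          ← rpow_mul hr.le, div_rpow hr.le hε.le, ← mul_div_assoc, mul_comm (ε ^ (2 - (d : ℝ))),
          mul_div_assoc, ← rpow_sub hε, mul_comm]
        congr 2 <;> push_cast <;> ring
      rw [e]
      calc _ ≤ heatConst d * (C₀ * (ε ^ 2) ^ ((d : ℝ) / 2 + 1 - (d : ℝ) / 2 + 1) *
            (‖w‖ ^ 2) ^ (-((d : ℝ) / 2 + 1))) := by gcongr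
        _ = heatConst d * C₀ * (ε ^ (2 - (d : ℝ)) * tailProfile d (‖w‖ / ε)) := by
            rw [← e1]; ring
        _ ≤ _ := by gcongr; exact le_add_of_nonneg_left hc.le
  · intro h
    have h1 := le_timeIntegral_sub (b := (d : ℝ) / 2) (u := ‖w‖ ^ 2) (τ := ε ^ 2) (by linarith)
      (by positivity) (by gcongr)
    have e2 : (‖w‖ ^ 2) ^ (1 - (d : ℝ) / 2) = ‖w‖ ^ (2 - (d : ℝ)) := by
      rw [← rpow_natCast, ← rpow_mul hr.le]; congr 1; push_cast; ring
    rw [e2] at h1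
    rw [e, mul_assoc]
    gcongr

/-! ### Densities in `L^p` -/

lemma memLp_tailProfile (hd : 3 ≤ d) {q : ℝ≥0∞} (hq1 : 1 ≤ q) (hqt : q ≠ ∞)
    (hq : ((d : ℝ) - 3 / 2) * q.toReal < d) :
    MemLp (fun w : Space d => tailProfile d ‖w‖) q volume := by
  have hd' : (3 : ℝ) ≤ d := by exact_mod_cast hd
  have hq1' : 1 ≤ q.toReal := by
    rw [← ENNReal.toReal_one]; exact (ENNReal.toReal_le_toReal ENNReal.one_ne_top hqt).2 hq1
  have hm : Measurable fun w : Space d => tailProfile d ‖w‖ :=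
    (measurable_tailProfile d).comp measurable_norm
  rw [← integrable_norm_rpow_iff hm.aestronglyMeasurable (by positivity) hqt]
  have : Nontrivial (Space d) := by
    have : Nonempty (Fin d) := ⟨⟨0, by omega⟩⟩
    infer_instance
  have key := integrable_fun_norm_addHaar (E := Space d) (volume : Measure (Space d))
    (f := fun r => ‖tailProfile d r‖ ^ q.toReal)
  rw [key, finrank_euclideanSpace_fin, ← Ioo_union_Ici_eq_Ioi one_pos]
  have hd1 : (((d - 1 : ℕ) : ℕ) : ℝ) = (d : ℝ) - 1 := by
    rw [Nat.cast_sub (by omega)]; simp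
  refine IntegrableOn.union ?_ ?_
  · have h1 : IntegrableOn (fun y : ℝ => y ^ ((d : ℝ) - 1 + (3 / 2 - d) * q.toReal)) (Ioo 0 1) := by
      have := (intervalIntegrable_iff_integrableOn_Ioo_of_le zero_le_one).1
        (intervalIntegral.intervalIntegrable_rpow' (a := 0) (b := 1)
        (r := (d : ℝ) - 1 + (3 / 2 - d) * q.toReal) (by nlinarith))
      exact this
    refine h1.congr_fun (fun y hy => ?_) measurableSet_Ioo
    simp only [tailProfile, if_pos hy.2, smul_eq_mul]
    rw [norm_of_nonneg (rpow_nonneg hy.1.le _), ← rpow_mul hy.1.le, ← rpow_natCast,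
      ← rpow_add hy.1, hd1]
  · have h1 : IntegrableOn (fun y : ℝ => y ^ ((d : ℝ) - 1 - (d + 2) * q.toReal)) (Ici 1) := by
      rw [integrableOn_Ici_iff_integrableOn_Ioi]
      exact integrableOn_Ioi_rpow_of_lt (by nlinarith) one_pos
    refine h1.congr_fun (fun y hy => ?_) measurableSet_Ici
    have hy0 : 0 < y := lt_of_lt_of_le one_pos hy
    simp only [tailProfile, if_neg (not_lt.2 (show 1 ≤ y from hy)), smul_eq_mul]
    rw [norm_of_nonneg (by positivity), ← rpow_mul hy0.le, ← rpow_natCast,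
      ← rpow_add hy0, hd1]
    congr 1; ring

/-- By Hölder's inequality and scaling, a measure with density in `L^p`, `p > d`, has potentials of
short-range kernels of size `ε^{d - d/p}` at scale `ε`. -/
lemma lintegral_tailProfile_le (hd : 3 ≤ d) {p : ℝ≥0∞} (hp : (d : ℝ≥0∞) < p) :
    ∃ K : ℝ, 0 < K ∧ ∀ (μ : Measure (Space d)) [IsProbabilityMeasure μ], HasLpDensity μ p →
      ∀ {ε : ℝ}, 0 < ε → ∀ x : Space d,
        ∫⁻ y, ENNReal.ofReal (tailProfile d (‖x - y‖ / ε)) ∂μ ≤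
          ENNReal.ofReal (K * densityNorm μ p * ε ^ ((d : ℝ) - d * recip p)) := by
  have hd' : (3 : ℝ) ≤ d := by exact_mod_cast hd
  have hd0 : (d : ℝ≥0∞) ≠ 0 := by exact_mod_cast (by omega : d ≠ 0)
  have hpd : p⁻¹ < (d : ℝ≥0∞)⁻¹ := ENNReal.inv_lt_inv.2 hp
  have hp1 : p⁻¹ < 1 := by
    refine hpd.trans_le ?_
    rw [ENNReal.inv_le_one]; exact_mod_cast (by omega : 1 ≤ d)
  set q : ℝ≥0∞ := (1 - p⁻¹)⁻¹ with hq
  have : p.HolderTriple q 1 := ⟨by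
    rw [hq, inv_inv, inv_one, add_tsub_cancel_of_le hp1.le]⟩
  have hqinv : q⁻¹ = 1 - p⁻¹ := by rw [hq, inv_inv]
  have hq1 : 1 ≤ q := by
    rw [hq, ENNReal.one_le_inv]; exact tsub_le_self
  have hqt : q ≠ ∞ := by
    rw [hq, Ne, ENNReal.inv_eq_top, tsub_eq_zero_iff_le, not_le]; exact hp1
  have hqr : (q.toReal)⁻¹ = 1 - recip p := by
    rw [← ENNReal.toReal_inv, hqinv, ENNReal.toReal_sub_of_le hp1.le ENNReal.one_ne_top, recip,
      ENNReal.toReal_one]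
  have hq0 : 0 < q.toReal := ENNReal.toReal_pos (by positivity) hqt
  have hrec : recip p < (d : ℝ)⁻¹ := by
    have := (ENNReal.toReal_lt_toReal hp1.ne_top (ENNReal.inv_ne_top.2 hd0)).2 hpd
    rwa [ENNReal.toReal_inv d, ENNReal.toReal_natCast] at this
  have hqd : ((d : ℝ) - 3 / 2) * q.toReal < d := by
    have h1 : (d : ℝ) - 1 < d * (q.toReal)⁻¹ := by
      rw [hqr]
      have : (d : ℝ) * recip p < 1 := by
        rw [← mul_inv_cancel₀ (show (d : ℝ) ≠ 0 by positivity)]; gcongr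
      linarith
    rw [← div_eq_mul_inv, lt_div_iff₀ hq0] at h1
    nlinarith
  have hmem := memLp_tailProfile hd hq1 hqt hqd
  refine ⟨(eLpNorm (fun w : Space d => tailProfile d ‖w‖) q volume).toReal + 1, by positivity, ?_⟩
  intro μ _ hμ ε hε x
  set Ψ : Space d → ℝ := fun y => tailProfile d (‖x - y‖ / ε) with hΨ
  have mΨ : Measurable Ψ := (measurable_tailProfile d).comp (by fun_prop)
  have mφ : Measurable fun w : Space d => tailProfile d ‖w‖ :=
    (measurable_tailProfile d).comp measurable_norm
  have hΨ0 : ∀ y, 0 ≤ Ψ y := fun y => tailProfile_nonneg (by positivity)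
  have h1 : ∫⁻ y, ENNReal.ofReal (Ψ y) ∂μ = eLpNorm (density μ • Ψ) 1 volume := by
    rw [← lintegral_rnDeriv_mul hμ.1 (by fun_prop), eLpNorm_one_eq_lintegral_enorm]
    refine lintegral_congr_ae ?_
    filter_upwards [Measure.rnDeriv_lt_top μ volume] with y hy
    rw [Pi.smul_apply', smul_eq_mul, enorm_mul, Real.enorm_eq_ofReal (hΨ0 y), density,
      Real.enorm_eq_ofReal ENNReal.toReal_nonneg, ENNReal.ofReal_toReal hy.ne]
  have h2 := eLpNorm_smul_le_mul_eLpNorm (p := p) (q := q) (r := 1) mΨ.aestronglyMeasurable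
    hμ.2.aestronglyMeasurable
  have hT : Measure.map (fun y : Space d => ε⁻¹ • (x - y)) volume =
      ENNReal.ofReal (ε ^ d) • (volume : Measure (Space d)) := by
    have e1 : (fun y : Space d => ε⁻¹ • (x - y)) = (fun z => ε⁻¹ • z) ∘ fun y => x - y := rfl
    rw [e1, ← Measure.map_map (by fun_prop) (by fun_prop),
      (Measure.measurePreserving_sub_left volume x).map_eq,
      Measure.map_addHaar_smul _ (by positivity), finrank_euclideanSpace_fin, inv_pow, inv_inv,
      abs_of_nonneg (by positivity)]
  have h3 : eLpNorm Ψ q volume = ENNReal.ofReal (ε ^ ((d : ℝ) - d * recip p)) *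
      eLpNorm (fun w : Space d => tailProfile d ‖w‖) q volume := by
    have e2 : Ψ = (fun w : Space d => tailProfile d ‖w‖) ∘ fun y => ε⁻¹ • (x - y) := by
      ext y
      simp only [hΨ, Function.comp, norm_smul, norm_inv, Real.norm_eq_abs, abs_of_pos hε]
      rw [div_eq_inv_mul]
    rw [e2, ← eLpNorm_map_measure mφ.aestronglyMeasurable (by fun_prop), hT,
      eLpNorm_smul_measure_of_ne_top hqt, smul_eq_mul, one_div, ENNReal.toReal_inv, hqr,
      ENNReal.ofReal_rpow_of_pos (by positivity), ← rpow_natCast, ← rpow_mul hε.le]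
    congr 3; ring
  rw [h1]
  refine h2.trans ?_
  rw [h3, densityNorm]
  have t1 : eLpNorm (density μ) p volume ≠ ∞ := hμ.2.eLpNorm_ne_top
  have t2 := hmem.eLpNorm_ne_top
  rw [ENNReal.ofReal_mul (by positivity), ENNReal.ofReal_mul (by positivity),
    ENNReal.ofReal_toReal t1]
  calc _ = eLpNorm (fun w : Space d => tailProfile d ‖w‖) q volume *
        eLpNorm (density μ) p volume * ENNReal.ofReal (ε ^ ((d : ℝ) - d * recip p)) := by ring
    _ ≤ _ := by
        gcongr
        rw [ENNReal.le_ofReal_iff_toReal_le t2 (by positivity)]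
        linarith

/-! ### Integrals off the diagonal -/

lemma measurableSet_offDiag : MeasurableSet (offDiag d) :=
  isClosed_diagonal.measurableSet.compl

instance isFiniteMeasure_pointMasses {N : ℕ} (x : Fin N → Space d) :
    IsFiniteMeasure (pointMasses x) := by
  unfold pointMasses; infer_instance

lemma pointMasses_univ {N : ℕ} (x : Fin N → Space d) : pointMasses x univ = N := by
  simp [pointMasses]

lemma pointMasses_prod {N : ℕ} (x : Fin N → Space d) :
    (pointMasses x).prod (pointMasses x) = ∑ i, ∑ j, Measure.dirac (x i, x j) := by
  rw [pointMasses, ← Measure.sum_fintype, Measure.prod_sum, Measure.sum_fintype,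
    Fintype.sum_prod_type]
  simp [Measure.dirac_prod_dirac]

lemma integral_pointMasses_prod {N : ℕ} (x : Fin N → Space d) (K : Space d × Space d → ℝ) :
    ∫ z, K z ∂(pointMasses x).prod (pointMasses x) = ∑ i, ∑ j, K (x i, x j) := by
  have hK : ∀ i j, Integrable K (Measure.dirac (x i, x j)) := fun i j =>
    integrable_dirac (by simp)
  rw [pointMasses_prod, integral_finsetSum_measure]
  · refine Finset.sum_congr rfl fun i _ => ?_
    rw [integral_finsetSum_measure fun j _ => hK i j]
    simp
  · intro i _
    rw [integrable_finsetSum_measure]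
    exact fun j _ => hK i j

lemma setIntegral_pointMasses_prod {N : ℕ} {x : Fin N → Space d} (hx : Function.Injective x)
    (K : Space d × Space d → ℝ) :
    ∫ z in offDiag d, K z ∂(pointMasses x).prod (pointMasses x) =
      ∑ i, ∑ j ∈ Finset.univ.erase i, K (x i, x j) := by
  rw [← integral_indicator measurableSet_offDiag, integral_pointMasses_prod]
  refine Finset.sum_congr rfl fun i _ => ?_
  rw [← Finset.add_sum_erase _ _ (Finset.mem_univ i)]
  have h0 : (offDiag d).indicator K (x i, x i) = 0 := indicator_of_notMem (by simp [offDiag]) _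
  rw [h0, zero_add]
  refine Finset.sum_congr rfl fun j hj => indicator_of_mem ?_ _
  simp only [offDiag, mem_compl_iff, mem_diagonal_iff]
  exact fun h => (Finset.mem_erase.1 hj).1 (hx h.symm)

lemma add_prod_add (ρ σ : Measure (Space d)) [IsFiniteMeasure ρ] [IsFiniteMeasure σ] :
    (ρ + σ).prod (ρ + σ) = ρ.prod ρ + ρ.prod σ + (σ.prod ρ + σ.prod σ) := by
  rw [Measure.add_prod, Measure.prod_add, Measure.prod_add]

lemma offDiagIntegrable_iff {ρ σ : Measure (Space d)} [IsFiniteMeasure ρ] [IsFiniteMeasure σ]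
    {k : Space d × Space d → ℝ} : OffDiagIntegrable ρ σ k ↔
      (IntegrableOn k (offDiag d) (ρ.prod ρ) ∧ IntegrableOn k (offDiag d) (ρ.prod σ)) ∧
      IntegrableOn k (offDiag d) (σ.prod ρ) ∧ IntegrableOn k (offDiag d) (σ.prod σ) := by
  rw [OffDiagIntegrable, add_prod_add, IntegrableOn, Measure.restrict_add, Measure.restrict_add,
    Measure.restrict_add, integrable_add_measure, integrable_add_measure, integrable_add_measure]
  rfl

lemma offDiagIntegral_add {ρ σ : Measure (Space d)} [IsFiniteMeasure ρ] [IsFiniteMeasure σ]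
    {k l : Space d × Space d → ℝ} (hk : OffDiagIntegrable ρ σ k) (hl : OffDiagIntegrable ρ σ l) :
    offDiagIntegral ρ σ (fun z => k z + l z) = offDiagIntegral ρ σ k + offDiagIntegral ρ σ l := by
  rw [offDiagIntegrable_iff] at hk hl
  simp only [offDiagIntegral]
  rw [integral_add hk.1.1 hl.1.1, integral_add hk.1.2 hl.1.2, integral_add hk.2.1 hl.2.1,
    integral_add hk.2.2 hl.2.2]
  ring

lemma offDiagIntegral_congr {ρ σ : Measure (Space d)} {k l : Space d × Space d → ℝ}
    (h : ∀ z ∈ offDiag d, k z = l z) : offDiagIntegral ρ σ k = offDiagIntegral ρ σ l := by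
  simp only [offDiagIntegral, setIntegral_congr_fun measurableSet_offDiag h]

/-- A radial kernel whose potential with respect to `σ` is bounded by `S` has double integral at
most `ρ(ℝ^d) S`, in either order. -/
lemma lintegral_prod_radial_le {ρ σ : Measure (Space d)} [IsFiniteMeasure ρ] [IsFiniteMeasure σ]
    {Ψ : ℝ → ℝ≥0∞} (mΨ : Measurable Ψ) {S : ℝ≥0∞} (hS : ∀ x, ∫⁻ y, Ψ ‖x - y‖ ∂σ ≤ S) :
    ∫⁻ z : Space d × Space d, Ψ ‖z.1 - z.2‖ ∂ρ.prod σ ≤ S * ρ univ ∧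
    ∫⁻ z : Space d × Space d, Ψ ‖z.1 - z.2‖ ∂σ.prod ρ ≤ S * ρ univ := by
  have hm : Measurable fun z : Space d × Space d => Ψ ‖z.1 - z.2‖ := mΨ.comp (by fun_prop)
  constructor
  · rw [lintegral_prod _ hm.aemeasurable, ← lintegral_const]
    exact lintegral_mono hS
  · rw [lintegral_prod_symm _ hm.aemeasurable, ← lintegral_const]
    refine lintegral_mono fun x => ?_
    simp only [norm_sub_rev _ x]
    exact hS x

section Radial

variable {N : ℕ} {x : Fin N → Space d} {μ : Measure (Space d)} {k : Space d × Space d → ℝ}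
  {Ψ : ℝ → ℝ≥0∞} {S : ℝ}

lemma smul_prob_univ (N : ℕ) (μ : Measure (Space d)) [IsProbabilityMeasure μ] :
    ((N : ℝ≥0∞) • μ) univ = N := by simp

instance isFiniteMeasure_natCast_smul (N : ℕ) (μ : Measure (Space d)) [IsFiniteMeasure μ] :
    IsFiniteMeasure ((N : ℝ≥0∞) • μ) := μ.smul_finite (ENNReal.natCast_ne_top N)

lemma setLIntegral_enorm_le [IsProbabilityMeasure μ] (mΨ : Measurable Ψ)
    (hS : ∀ x, ∫⁻ y, Ψ ‖x - y‖ ∂μ ≤ ENNReal.ofReal S)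
    (hk : ∀ z ∈ offDiag d, ‖k z‖ₑ ≤ Ψ ‖z.1 - z.2‖) {ρ : Measure (Space d)} [IsFiniteMeasure ρ]
    (hρ : ρ univ = N) :
    ∫⁻ z in offDiag d, ‖k z‖ₑ ∂ρ.prod ((N : ℝ≥0∞) • μ) ≤ ENNReal.ofReal ((N : ℝ) ^ 2 * S) ∧
    ∫⁻ z in offDiag d, ‖k z‖ₑ ∂((N : ℝ≥0∞) • μ).prod ρ ≤ ENNReal.ofReal ((N : ℝ) ^ 2 * S) := by
  have hS' : ∀ x, ∫⁻ y, Ψ ‖x - y‖ ∂((N : ℝ≥0∞) • μ) ≤ N * ENNReal.ofReal S := fun x => by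
    rw [lintegral_smul_measure, smul_eq_mul]; gcongr; exact hS x
  have e : N * ENNReal.ofReal S * ρ univ = ENNReal.ofReal ((N : ℝ) ^ 2 * S) := by
    rw [hρ, ENNReal.ofReal_mul (by positivity), ENNReal.ofReal_pow (by positivity),
      ENNReal.ofReal_natCast]
    ring
  obtain ⟨h1, h2⟩ := lintegral_prod_radial_le (ρ := ρ) mΨ hS'
  rw [e] at h1 h2
  exact ⟨((setLIntegral_mono' measurableSet_offDiag hk).trans (setLIntegral_le_lintegral _ _)).trans
      h1, ((setLIntegral_mono' measurableSet_offDiag hk).trans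
      (setLIntegral_le_lintegral _ _)).trans h2⟩

lemma offDiagIntegrable_of_radial [IsProbabilityMeasure μ] (mΨ : Measurable Ψ)
    (hS : ∀ x, ∫⁻ y, Ψ ‖x - y‖ ∂μ ≤ ENNReal.ofReal S)
    (hk : ∀ z ∈ offDiag d, ‖k z‖ₑ ≤ Ψ ‖z.1 - z.2‖)
    (mk : ∃ k' : Space d × Space d → ℝ, Measurable k' ∧ ∀ z ∈ offDiag d, k z = k' z) :
    OffDiagIntegrable (pointMasses x) ((N : ℝ≥0∞) • μ) k := by
  obtain ⟨k', mk', hkk'⟩ := mk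
  have hmeas : ∀ m : Measure (Space d × Space d), AEStronglyMeasurable k (m.restrict (offDiag d)) :=
    fun m => (mk'.aestronglyMeasurable (μ := m.restrict (offDiag d))).congr
      ((ae_restrict_mem measurableSet_offDiag).mono fun z hz => (hkk' z hz).symm)
  have h1 := setLIntegral_enorm_le mΨ hS hk (pointMasses_univ x)
  have h2 := setLIntegral_enorm_le mΨ hS hk (smul_prob_univ N μ)
  rw [offDiagIntegrable_iff]
  refine ⟨⟨?_, hmeas _, ?_⟩, ⟨hmeas _, ?_⟩, hmeas _, ?_⟩
  · rw [IntegrableOn, pointMasses_prod]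
    refine Integrable.mono_measure (ν := ∑ i, ∑ j, Measure.dirac (x i, x j)) ?_
      Measure.restrict_le_self
    simp only [integrable_finsetSum_measure]
    exact fun i _ j _ => integrable_dirac (by simp)
  · exact h1.1.trans_lt ENNReal.ofReal_lt_top
  · exact h1.2.trans_lt ENNReal.ofReal_lt_top
  · exact h2.1.trans_lt ENNReal.ofReal_lt_top

/-- Up to the potential of `μ` for a radial majorant of the kernel, only the sum over the pairs of
points contributes to the off-diagonal integral. -/
lemma abs_offDiagIntegral_sub_sum_le [IsProbabilityMeasure μ] (hx : Function.Injective x)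
    (hS0 : 0 ≤ S) (mΨ : Measurable Ψ) (hS : ∀ x, ∫⁻ y, Ψ ‖x - y‖ ∂μ ≤ ENNReal.ofReal S)
    (hk : ∀ z ∈ offDiag d, ‖k z‖ₑ ≤ Ψ ‖z.1 - z.2‖) :
    |offDiagIntegral (pointMasses x) ((N : ℝ≥0∞) • μ) k -
      ∑ i, ∑ j ∈ Finset.univ.erase i, k (x i, x j)| ≤ 3 * (N : ℝ) ^ 2 * S := by
  have h1 := setLIntegral_enorm_le mΨ hS hk (pointMasses_univ x)
  have h2 := setLIntegral_enorm_le mΨ hS hk (smul_prob_univ N μ)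
  have hb : ∀ m : Measure (Space d × Space d),
      ∫⁻ z in offDiag d, ‖k z‖ₑ ∂m ≤ ENNReal.ofReal ((N : ℝ) ^ 2 * S) →
      |∫ z in offDiag d, k z ∂m| ≤ (N : ℝ) ^ 2 * S := by
    intro m hm
    have := (enorm_integral_le_lintegral_enorm (μ := m.restrict (offDiag d)) k).trans hm
    rwa [Real.enorm_eq_ofReal_abs, ENNReal.ofReal_le_ofReal_iff (by positivity)] at this
  have b1 := abs_le.1 (hb _ h1.1)
  have b2 := abs_le.1 (hb _ h1.2)
  have b3 := abs_le.1 (hb _ h2.1)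
  rw [offDiagIntegral, setIntegral_pointMasses_prod hx, abs_le]
  constructor <;> linarith

/-- The sign `+1` on the point charges and `-1` on the background. -/
noncomputable def chargeSign (x : Fin N → Space d) (y : Space d) : ℝ :=
  open Classical in if y ∈ range x then 1 else -1

lemma measurable_chargeSign (x : Fin N → Space d) : Measurable (chargeSign x) :=
  Measurable.ite (finite_range x).measurableSet measurable_const measurable_const

lemma abs_chargeSign_le (x : Fin N → Space d) (y : Space d) : |chargeSign x y| ≤ 1 := by
  unfold chargeSign; split_ifs <;> simp

/-- For a kernel that is integrable up to the diagonal, the full quadratic form in the signed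
charge is the off-diagonal one plus the self-interactions of the points. -/
lemma integral_chargeSign [IsProbabilityMeasure μ] [NullSingletonClass μ]
    (hx : Function.Injective x) {K : Space d × Space d → ℝ} (hK : Integrable K
      ((pointMasses x + (N : ℝ≥0∞) • μ).prod (pointMasses x + (N : ℝ≥0∞) • μ))) :
    ∫ z, K z * (chargeSign x z.1 * chargeSign x z.2)
        ∂(pointMasses x + (N : ℝ≥0∞) • μ).prod (pointMasses x + (N : ℝ≥0∞) • μ) =
      offDiagIntegral (pointMasses x) ((N : ℝ≥0∞) • μ) K + ∑ i, K (x i, x i) := by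
  have mf := measurable_chargeSign x
  set σ := (N : ℝ≥0∞) • μ with hσ
  have na : NullSingletonClass σ := ⟨fun y => by simp [hσ]⟩
  have hKf : Integrable (fun z : Space d × Space d => K z * (chargeSign x z.1 * chargeSign x z.2))
      ((pointMasses x + σ).prod (pointMasses x + σ)) := by
    refine hK.mul_bdd (c := 1) (((mf.comp measurable_fst).mul
      (mf.comp measurable_snd)).aestronglyMeasurable) (Eventually.of_forall fun z => ?_)
    rw [norm_mul]
    exact mul_le_one₀ (abs_chargeSign_le x _) (norm_nonneg _) (abs_chargeSign_le x _)
  have fp : ∀ᵐ y ∂pointMasses x, chargeSign x y = 1 := by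
    rw [ae_iff, pointMasses, Measure.finsetSum_apply]
    refine Finset.sum_eq_zero fun i _ => ?_
    have hm : MeasurableSet {a | ¬chargeSign x a = 1} := (mf (measurableSet_singleton 1)).compl
    rw [Measure.dirac_apply' _ hm]
    simp [chargeSign]
  have fm : ∀ᵐ y ∂σ, chargeSign x y = -1 := by
    have : ∀ᵐ y ∂σ, y ∉ range x := by
      rw [ae_iff]
      have e : {a | ¬a ∉ range x} = range x := by ext a; simp
      rw [e]; exact (finite_range x).measure_zero σ
    filter_upwards [this] with y hy
    simp [chargeSign, hy]
  have hdiag : ∀ ρ ρ' : Measure (Space d), IsFiniteMeasure ρ → IsFiniteMeasure ρ' →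
      (NullSingletonClass ρ ∨ NullSingletonClass ρ') →
        ∫ z in offDiag d, K z ∂ρ.prod ρ' = ∫ z, K z ∂ρ.prod ρ' := by
    intro ρ ρ' _ _ h
    rw [Measure.restrict_eq_self_of_ae_mem]
    have hmd : MeasurableSet (diagonal (Space d)) := isClosed_diagonal.measurableSet
    rw [ae_iff]
    have e : {a : Space d × Space d | a ∉ offDiag d} = diagonal (Space d) := by
      ext z; simp [offDiag]
    rw [e]
    rcases h with h | h
    · rw [Measure.prod_apply_symm hmd]
      have : ∀ y : Space d, ρ ((fun x => (x, y)) ⁻¹' diagonal (Space d)) = 0 := fun y => by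
        have : (fun x => (x, y)) ⁻¹' diagonal (Space d) = {y} := by ext z; simp
        rw [this, measure_singleton]
      simp [this]
    · rw [Measure.prod_apply hmd]
      have : ∀ y : Space d, ρ' (Prod.mk y ⁻¹' diagonal (Space d)) = 0 := fun y => by
        have : Prod.mk y ⁻¹' diagonal (Space d) = {y} := by ext z; simp [eq_comm]
        rw [this, measure_singleton]
      simp [this]
  have hs : ∀ (ρ ρ' : Measure (Space d)) (a b : ℝ), IsFiniteMeasure ρ → IsFiniteMeasure ρ' →
      (∀ᵐ y ∂ρ, chargeSign x y = a) → (∀ᵐ y ∂ρ', chargeSign x y = b) →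
      ∫ z, K z * (chargeSign x z.1 * chargeSign x z.2) ∂ρ.prod ρ' =
        (a * b) * ∫ z, K z ∂ρ.prod ρ' := by
    intro ρ ρ' a b _ _ ha hb
    rw [← integral_const_mul]
    refine integral_congr_ae ?_
    filter_upwards [Measure.quasiMeasurePreserving_fst.ae ha,
      Measure.quasiMeasurePreserving_snd.ae hb] with z h1 h2
    rw [h1, h2]; ring
  rw [add_prod_add] at hKf ⊢
  rw [integrable_add_measure, integrable_add_measure, integrable_add_measure] at hKf
  rw [integral_add_measure (integrable_add_measure.2 hKf.1) (integrable_add_measure.2 hKf.2),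
    integral_add_measure hKf.1.1 hKf.1.2, integral_add_measure hKf.2.1 hKf.2.2,
    hs _ _ 1 1 inferInstance inferInstance fp fp, hs _ _ 1 (-1) inferInstance inferInstance fp fm,
    hs _ _ (-1) 1 inferInstance inferInstance fm fp,
    hs _ _ (-1) (-1) inferInstance inferInstance fm fm, offDiagIntegral,
    hdiag _ _ inferInstance inferInstance (Or.inr na),
    hdiag _ _ inferInstance inferInstance (Or.inl na),
    hdiag _ _ inferInstance inferInstance (Or.inl na), setIntegral_pointMasses_prod hx,
    integral_pointMasses_prod]
  have e : ∑ i, ∑ j, K (x i, x j) = ∑ i, ∑ j ∈ Finset.univ.erase i, K (x i, x j) +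
      ∑ i, K (x i, x i) := by
    rw [← Finset.sum_add_distrib]
    refine Finset.sum_congr rfl fun i _ => ?_
    rw [Finset.sum_erase_add _ _ (Finset.mem_univ i)]
  rw [e]; ring

end Radial

/-! ### Mollification of log-Lipschitz vector fields -/

lemma logLipNorm_nonneg (v : Space d → Space d) : 0 ≤ logLipNorm v :=
  Real.sSup_nonneg fun q hq => by
    obtain ⟨x, y, _, _, rfl⟩ := hq
    positivity

lemma norm_sub_le_logLip {v : Space d → Space d} (hv : IsLogLipschitz v) {x y : Space d}
    (h : ‖x - y‖ ≤ exp (-1)) : ‖v x - v y‖ ≤ logLipNorm v * (‖x - y‖ * log ‖x - y‖⁻¹) := by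
  rcases eq_or_ne x y with rfl | hxy
  · simp
  have hr : 0 < ‖x - y‖ := norm_pos_iff.2 (sub_ne_zero.2 hxy)
  have hlog : log ‖x - y‖ ≤ -1 := by rw [← log_exp (-1)]; exact log_le_log hr h
  have hq := le_csSup hv ⟨x, y, hr, h, rfl⟩
  rw [abs_of_nonpos (by linarith), ← log_inv] at hq
  have : 0 < log ‖x - y‖⁻¹ := by rw [log_inv]; linarith
  rwa [div_le_iff₀ (by positivity)] at hq

lemma mul_log_inv_mono {r δ : ℝ} (hr : 0 < r) (hrδ : r ≤ δ) (hδ : δ ≤ exp (-1)) :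
    r * log r⁻¹ ≤ δ * log δ⁻¹ := by
  have hδ0 : 0 < δ := hr.trans_le hrδ
  have h1 : exp 1 ≤ δ⁻¹ := by
    rw [← inv_inv (exp 1), ← exp_neg]; exact inv_anti₀ hδ0 hδ
  have h2 : δ⁻¹ ≤ r⁻¹ := inv_anti₀ hr hrδ
  have := log_div_self_antitoneOn (show δ⁻¹ ∈ {x | exp 1 ≤ x} from h1)
    (show r⁻¹ ∈ {x | exp 1 ≤ x} from h1.trans h2) h2
  simp only [div_inv_eq_mul] at this
  linarith

/-- A fixed smooth probability density supported in the unit ball. -/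
noncomputable def mollifier (d : ℕ) : Space d → ℝ :=
  (⟨1 / 2, 1, by norm_num, by norm_num⟩ : ContDiffBump (0 : Space d)).normed volume

/-- The mollifier at scale `δ`. -/
noncomputable def scaledMollifier (d : ℕ) (δ : ℝ) (z : Space d) : ℝ :=
  (δ ^ d)⁻¹ * mollifier d (δ⁻¹ • z)

lemma contDiff_mollifier (d : ℕ) : ContDiff ℝ 1 (mollifier d) := ContDiffBump.contDiff_normed _

lemma mollifier_eq_zero {z : Space d} (hz : 1 ≤ ‖z‖) : mollifier d z = 0 := by
  have h := ContDiffBump.support_normed_eq (μ := volume)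
    (⟨1 / 2, 1, by norm_num, by norm_num⟩ : ContDiffBump (0 : Space d))
  by_contra hne
  have : z ∈ Function.support (mollifier d) := hne
  rw [mollifier, h] at this
  simp only [Metric.mem_ball, dist_zero_right] at this
  linarith

section Scaled

variable {δ : ℝ}

lemma contDiff_scaledMollifier : ContDiff ℝ 1 (scaledMollifier d δ) :=
  contDiff_const.mul ((contDiff_mollifier d).comp (contDiff_const_smul δ⁻¹))

lemma scaledMollifier_nonneg (hδ : 0 < δ) (z : Space d) : 0 ≤ scaledMollifier d δ z :=
  mul_nonneg (by positivity) (ContDiffBump.nonneg_normed _ _)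

lemma scaledMollifier_eq_zero (hδ : 0 < δ) {z : Space d} (hz : δ < ‖z‖) :
    scaledMollifier d δ z = 0 := by
  rw [scaledMollifier, mollifier_eq_zero, mul_zero]
  rw [norm_smul, norm_inv, norm_of_nonneg hδ.le, ← div_eq_inv_mul, one_le_div hδ]
  exact hz.le

lemma hasCompactSupport_scaledMollifier (hδ : 0 < δ) :
    HasCompactSupport (scaledMollifier d δ) :=
  HasCompactSupport.intro (isCompact_closedBall 0 δ) fun z hz => by
    refine scaledMollifier_eq_zero hδ ?_
    simpa using hz

lemma integral_scaledMollifier (hδ : 0 < δ) : ∫ z, scaledMollifier d δ z = 1 := by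
  simp only [scaledMollifier]
  rw [integral_const_mul, Measure.integral_comp_inv_smul, finrank_euclideanSpace_fin,
    abs_of_nonneg (by positivity), smul_eq_mul, mollifier, ContDiffBump.integral_normed]
  field_simp

lemma integrable_scaledMollifier (hδ : 0 < δ) : Integrable (scaledMollifier d δ) :=
  .of_integral_ne_zero (by rw [integral_scaledMollifier hδ]; exact one_ne_zero)

lemma fderiv_scaledMollifier (z : Space d) : fderiv ℝ (scaledMollifier d δ) z =
    ((δ ^ d)⁻¹ * δ⁻¹) • fderiv ℝ (mollifier d) (δ⁻¹ • z) := by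
  have h1 : HasFDerivAt (mollifier d) (fderiv ℝ (mollifier d) (δ⁻¹ • z)) (δ⁻¹ • z) :=
    ((contDiff_mollifier d).differentiable one_ne_zero _).hasFDerivAt
  have h2 := (h1.comp z ((hasFDerivAt_id z).const_smul δ⁻¹)).const_mul (δ ^ d)⁻¹
  refine (HasFDerivAt.fderiv (f := scaledMollifier d δ) h2).trans ?_
  ext u
  simp [mul_assoc]

lemma fderiv_scaledMollifier_eq_zero (hδ : 0 < δ) {z : Space d} (hz : δ < ‖z‖) :
    fderiv ℝ (scaledMollifier d δ) z = 0 := by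
  have : scaledMollifier d δ =ᶠ[𝓝 z] fun _ => 0 := by
    filter_upwards [(isOpen_lt continuous_const continuous_norm).mem_nhds hz] with y hy
    exact scaledMollifier_eq_zero hδ hy
  rw [this.fderiv_eq, fderiv_fun_const]; rfl

lemma integral_norm_fderiv_scaledMollifier (hδ : 0 < δ) :
    ∫ z, ‖fderiv ℝ (scaledMollifier d δ) z‖ = δ⁻¹ * ∫ z, ‖fderiv ℝ (mollifier d) z‖ := by
  simp only [fderiv_scaledMollifier, norm_smul]
  rw [integral_const_mul, Measure.integral_comp_inv_smul volume
      (fun z => ‖fderiv ℝ (mollifier d) z‖), finrank_euclideanSpace_fin,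
    abs_of_nonneg (by positivity), smul_eq_mul, norm_of_nonneg (by positivity)]
  field_simp

lemma integrable_norm_fderiv_scaledMollifier (hδ : 0 < δ) :
    Integrable fun z => ‖fderiv ℝ (scaledMollifier d δ) z‖ :=
  (((contDiff_scaledMollifier).continuous_fderiv one_ne_zero).norm).integrable_of_hasCompactSupport
    ((hasCompactSupport_scaledMollifier hδ).fderiv ℝ).norm

end Scaled

/-- A log-Lipschitz field is approximated at scale `δ`, up to `δ ln δ⁻¹`, by smooth fields whose
Lipschitz constant is of order `ln δ⁻¹` and which obey the same log-Lipschitz bound. -/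
lemma exists_mollification (d : ℕ) : ∃ C : ℝ, 0 < C ∧ ∀ v : Space d →ᵇ Space d,
    IsLogLipschitz v → ∀ {δ : ℝ}, 0 < δ → δ ≤ exp (-1) →
    ∃ (u : Space d → Space d) (u' : Space d → Space d →L[ℝ] Space d),
      IsC1Bounded u u' ‖v‖ (C * logLipNorm v * log δ⁻¹) ∧
      (∀ x, ‖v x - u x‖ ≤ logLipNorm v * (δ * log δ⁻¹)) ∧
      ∀ x y, ‖x - y‖ ≤ exp (-1) → ‖u x - u y‖ ≤ logLipNorm v * (‖x - y‖ * log ‖x - y‖⁻¹) := by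
  have hI : 0 ≤ ∫ z, ‖fderiv ℝ (mollifier d) z‖ := integral_nonneg fun _ => norm_nonneg _
  refine ⟨(∫ z, ‖fderiv ℝ (mollifier d) z‖) + 1, by linarith, ?_⟩
  intro v hv δ hδ hδe
  have hA := logLipNorm_nonneg v
  set A := logLipNorm v
  have hδlog : 1 ≤ log δ⁻¹ := by
    rw [log_inv, le_neg, ← log_exp (-1)]; exact log_le_log hδ hδe
  set χ := scaledMollifier d δ with hχ
  have hχ0 : ∀ z, 0 ≤ χ z := scaledMollifier_nonneg hδ
  have iχ : Integrable χ := integrable_scaledMollifier hδ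
  have cχ : Continuous χ := contDiff_scaledMollifier.continuous
  have hosc : ∀ x t : Space d, ‖t‖ ≤ δ → ‖v (x - t) - v x‖ ≤ A * (δ * log δ⁻¹) := by
    intro x t ht
    rcases eq_or_ne t 0 with rfl | h0
    · simp only [sub_zero, sub_self, norm_zero]; positivity
    have e : ‖x - t - x‖ = ‖t‖ := by rw [sub_sub_cancel_left, norm_neg]
    have := norm_sub_le_logLip hv (x := x - t) (y := x) (by rw [e]; exact ht.trans hδe)
    rw [e] at this
    refine this.trans ?_
    gcongr ?_ * ?_
    exact mul_log_inv_mono (norm_pos_iff.2 h0) ht hδe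
  have iχg : ∀ g : Space d →ᵇ Space d, ∀ x, Integrable fun t => χ t • g (x - t) := by
    intro g x
    refine (iχ.mul_const ‖g‖).mono' (by fun_prop) (Eventually.of_forall fun t => ?_)
    rw [norm_smul, norm_of_nonneg (hχ0 t)]
    exact mul_le_mul_of_nonneg_left (g.norm_coe_le_norm _) (hχ0 t)
  let L : ℝ →L[ℝ] Space d →L[ℝ] Space d := ContinuousLinearMap.lsmul ℝ ℝ
  let u : Space d → Space d := convolution χ v L volume
  have hu : ∀ x, u x = ∫ t, χ t • v (x - t) := fun x => rfl
  have hconst : ∀ c : Space d, ∫ t, χ t • c = c := fun c => by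
    rw [integral_smul_const, hχ, integral_scaledMollifier hδ, one_smul]
  have hsup : HasCompactSupport χ := hasCompactSupport_scaledMollifier hδ
  have hder : ∀ g : Space d →ᵇ Space d, ∀ x, HasFDerivAt (convolution χ g L volume)
      (convolution (fderiv ℝ χ) g (L.precompL (Space d)) volume x) x := fun g x =>
    hsup.hasFDerivAt_convolution_left L contDiff_scaledMollifier
      g.continuous.locallyIntegrable x
  have hdiff : ContDiff ℝ 1 u :=
    hsup.contDiff_convolution_left L contDiff_scaledMollifier v.continuous.locallyIntegrable
  refine ⟨u, fderiv ℝ u, ⟨fun z => (hdiff.differentiable one_ne_zero z).hasFDerivAt,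
    hdiff.continuous_fderiv one_ne_zero, ?_, ?_⟩, ?_, ?_⟩
  · intro z
    rw [hu]
    have : ∫ t, χ t * ‖v‖ = ‖v‖ := by
      rw [integral_mul_const, hχ, integral_scaledMollifier hδ, one_mul]
    rw [← this]
    refine norm_integral_le_of_norm_le (iχ.mul_const ‖v‖) (Eventually.of_forall fun t => ?_)
    rw [norm_smul, norm_of_nonneg (hχ0 t)]
    exact mul_le_mul_of_nonneg_left (v.norm_coe_le_norm _) (hχ0 t)
  · intro z
    -- subtracting a constant from `v` does not change the derivative of its mollification
    let g : Space d →ᵇ Space d := v - BoundedContinuousFunction.const _ (v z)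
    have hg : u = fun x => convolution χ g L volume x + v z := by
      ext1 x
      have e1 : convolution χ g L volume x = ∫ t, (χ t • v (x - t) - χ t • v z) := by
        refine integral_congr_ae (Eventually.of_forall fun t => ?_)
        simp only [L, g, ContinuousLinearMap.lsmul_apply, BoundedContinuousFunction.coe_sub,
          Pi.sub_apply, BoundedContinuousFunction.const_apply, smul_sub]
      rw [e1, integral_sub (iχg v x) (iχ.smul_const _), hconst, hu]
      abel
    have h1 : fderiv ℝ u z = convolution (fderiv ℝ χ) g (L.precompL (Space d)) volume z := by
      rw [hg]; exact ((hder g z).add_const _).fderiv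
    rw [h1, convolution]
    have hbound : ∀ t, ‖(L.precompL (Space d)) (fderiv ℝ χ t) (g (z - t))‖ ≤
        ‖fderiv ℝ χ t‖ * (A * (δ * log δ⁻¹)) := by
      intro t
      rcases lt_or_ge δ ‖t‖ with ht | ht
      · rw [hχ, fderiv_scaledMollifier_eq_zero hδ ht]; simp
      · refine ContinuousLinearMap.opNorm_le_bound _ (by positivity) fun w => ?_
        simp only [L, g, ContinuousLinearMap.precompL_apply, ContinuousLinearMap.lsmul_apply,
          BoundedContinuousFunction.coe_sub, Pi.sub_apply, BoundedContinuousFunction.const_apply]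
        rw [norm_smul]
        calc ‖fderiv ℝ χ t w‖ * ‖v (z - t) - v z‖ ≤
            (‖fderiv ℝ χ t‖ * ‖w‖) * (A * (δ * log δ⁻¹)) := by
              gcongr
              · exact ContinuousLinearMap.le_opNorm _ _
              · exact hosc z t ht
          _ = _ := by ring
    have h2 := norm_integral_le_of_norm_le
      ((integrable_norm_fderiv_scaledMollifier (d := d) hδ).mul_const (A * (δ * log δ⁻¹)))
      (Eventually.of_forall hbound)
    refine h2.trans ?_
    rw [integral_mul_const, integral_norm_fderiv_scaledMollifier hδ]
    calc δ⁻¹ * (∫ z, ‖fderiv ℝ (mollifier d) z‖) * (A * (δ * log δ⁻¹))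
        = (∫ z, ‖fderiv ℝ (mollifier d) z‖) * A * log δ⁻¹ := by field_simp
      _ ≤ ((∫ z, ‖fderiv ℝ (mollifier d) z‖) + 1) * A * log δ⁻¹ := by gcongr; linarith
  · intro x
    have e1 : v x - u x = ∫ t, (χ t • v x - χ t • v (x - t)) := by
      rw [integral_sub (iχ.smul_const _) (iχg v x), hconst, hu]
    have e2 : ∫ t, χ t * (A * (δ * log δ⁻¹)) = A * (δ * log δ⁻¹) := by
      rw [integral_mul_const, hχ, integral_scaledMollifier hδ, one_mul]
    rw [e1, ← e2]
    refine norm_integral_le_of_norm_le (iχ.mul_const _) (Eventually.of_forall fun t => ?_)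
    rw [← smul_sub, norm_smul, norm_of_nonneg (hχ0 t), norm_sub_rev]
    rcases lt_or_ge δ ‖t‖ with ht | ht
    · rw [hχ, scaledMollifier_eq_zero hδ ht]; simp
    · exact mul_le_mul_of_nonneg_left (hosc x t ht) (hχ0 t)
  · intro x y hxy
    have e1 : u x - u y = ∫ t, (χ t • v (x - t) - χ t • v (y - t)) := by
      rw [integral_sub (iχg v x) (iχg v y), hu, hu]
    have e2 : ∫ t, χ t * (A * (‖x - y‖ * log ‖x - y‖⁻¹)) = A * (‖x - y‖ * log ‖x - y‖⁻¹) := by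
      rw [integral_mul_const, hχ, integral_scaledMollifier hδ, one_mul]
    rw [e1, ← e2]
    refine norm_integral_le_of_norm_le (iχ.mul_const _) (Eventually.of_forall fun t => ?_)
    rw [← smul_sub, norm_smul, norm_of_nonneg (hχ0 t)]
    refine mul_le_mul_of_nonneg_left ?_ (hχ0 t)
    have e : x - t - (y - t) = x - y := by abel
    have := norm_sub_le_logLip hv (x := x - t) (y := y - t) (by rwa [e])
    rwa [e] at this

/-! ### Short-range potentials and sums over close pairs -/

/-- The potentials of `μ` with respect to the tail profiles at scale `ε` are at most
`T ε^{d - β}`. For a density in `L^p` this holds with `β = d/p` and `T` a multiple of the `L^p`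
norm, and besides the absence of atoms nothing else about the density is needed. -/
structure HasTailBound (μ : Measure (Space d)) (T β : ℝ) : Prop where
  nonneg : 0 ≤ T
  exponent_nonneg : 0 ≤ β
  exponent_le : β ≤ 1
  lintegral_le : ∀ {ε : ℝ}, 0 < ε → ∀ x : Space d,
    ∫⁻ y, ENNReal.ofReal (tailProfile d (‖x - y‖ / ε)) ∂μ ≤ ENNReal.ofReal (T * ε ^ ((d : ℝ) - β))

/-- The Coulomb energy, up to the factor `c_d`, of the ordered pairs of distinct points
at distance at most `ε`. -/
noncomputable def closePairs {N : ℕ} (x : Fin N → Space d) (ε : ℝ) : ℝ :=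
  ∑ i, ∑ j ∈ Finset.univ.erase i, if ‖x i - x j‖ ≤ ε then ‖x i - x j‖ ^ (2 - (d : ℝ)) else 0

section Pairs

variable {N : ℕ} {x : Fin N → Space d} {μ : Measure (Space d)} {T β : ℝ}
  {k : Space d × Space d → ℝ}

lemma closePairs_nonneg (x : Fin N → Space d) (ε : ℝ) : 0 ≤ closePairs x ε := by
  refine Finset.sum_nonneg fun i _ => Finset.sum_nonneg fun j _ => ?_
  split_ifs <;> positivity

lemma norm_sub_pos (hx : Function.Injective x) {i j : Fin N} (hij : j ∈ Finset.univ.erase i) :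
    0 < ‖x i - x j‖ :=
  norm_pos_iff.2 (sub_ne_zero.2 fun h => (Finset.mem_erase.1 hij).1 (hx h.symm))

lemma mk_mem_offDiag (hx : Function.Injective x) {i j : Fin N} (hij : j ∈ Finset.univ.erase i) :
    (x i, x j) ∈ offDiag d := by
  simp only [offDiag, mem_compl_iff, mem_diagonal_iff]
  exact sub_ne_zero.1 (norm_pos_iff.1 (norm_sub_pos hx hij))

lemma norm_pos_of_mem_offDiag {z : Space d × Space d} (hz : z ∈ offDiag d) :
    0 < ‖z.1 - z.2‖ :=
  norm_pos_iff.2 (sub_ne_zero.2 hz)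

/-- The pair sum of a kernel that is at most `a r^{2-d}` at distances `r ≤ ε` and at most `b`
beyond. -/
lemma abs_sum_pairs_le {a b ε : ℝ} (hb : 0 ≤ b)
    (h₁ : ∀ i, ∀ j ∈ Finset.univ.erase i, ‖x i - x j‖ ≤ ε →
      |k (x i, x j)| ≤ a * ‖x i - x j‖ ^ (2 - (d : ℝ)))
    (h₂ : ∀ i, ∀ j ∈ Finset.univ.erase i, ε < ‖x i - x j‖ → |k (x i, x j)| ≤ b) :
    |∑ i, ∑ j ∈ Finset.univ.erase i, k (x i, x j)| ≤ a * closePairs x ε + (N : ℝ) ^ 2 * b := by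
  have e : a * closePairs x ε + (N : ℝ) ^ 2 * b = ∑ i : Fin N,
      ((∑ j ∈ Finset.univ.erase i,
        a * if ‖x i - x j‖ ≤ ε then ‖x i - x j‖ ^ (2 - (d : ℝ)) else 0) + N * b) := by
    rw [Finset.sum_add_distrib, closePairs, Finset.mul_sum]
    simp only [Finset.mul_sum, Finset.sum_const, Finset.card_univ, Fintype.card_fin, nsmul_eq_mul]
    ring
  rw [e]
  refine (Finset.abs_sum_le_sum_abs _ _).trans (Finset.sum_le_sum fun i _ => ?_)
  have hc : ∑ j ∈ Finset.univ.erase i, b ≤ N * b := by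
    rw [Finset.sum_const, nsmul_eq_mul]
    gcongr
    exact (Finset.card_le_univ _).trans (by simp)
  refine (Finset.abs_sum_le_sum_abs _ _).trans (le_trans ?_ (add_le_add_right hc _))
  rw [← Finset.sum_add_distrib]
  refine Finset.sum_le_sum fun j hj => ?_
  split_ifs with h
  · exact (h₁ i j hj h).trans (le_add_of_nonneg_right hb)
  · simpa using h₂ i j hj (not_le.1 h)

variable [IsProbabilityMeasure μ]

lemma HasTailBound.lintegral_add_const_le (h : HasTailBound μ T β) {a b ε : ℝ} (ha : 0 ≤ a)
    (hb : 0 ≤ b) (hε : 0 < ε) (x : Space d) :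
    ∫⁻ y, ENNReal.ofReal (a * tailProfile d (‖x - y‖ / ε) + b) ∂μ ≤
      ENNReal.ofReal (a * (T * ε ^ ((d : ℝ) - β)) + b) := by
  have hT := h.nonneg
  have hm : Measurable fun y => ENNReal.ofReal (tailProfile d (‖x - y‖ / ε)) :=
    ((measurable_tailProfile d).comp (by fun_prop)).ennreal_ofReal
  have e : ∀ y, ENNReal.ofReal (a * tailProfile d (‖x - y‖ / ε) + b) =
      ENNReal.ofReal a * ENNReal.ofReal (tailProfile d (‖x - y‖ / ε)) + ENNReal.ofReal b := by
    intro y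
    have := tailProfile_nonneg (d := d) (div_nonneg (norm_nonneg (x - y)) hε.le)
    rw [ENNReal.ofReal_add (by positivity) hb, ENNReal.ofReal_mul ha]
  simp only [e]
  rw [lintegral_add_right _ measurable_const, lintegral_const_mul _ hm, lintegral_const,
    measure_univ, mul_one, ENNReal.ofReal_add (by positivity) hb, ENNReal.ofReal_mul ha]
  gcongr
  exact h.lintegral_le hε x

lemma measurable_ofReal_tailProfile (a b ε : ℝ) :
    Measurable fun r => ENNReal.ofReal (a * tailProfile d (r / ε) + b) := by
  have := (measurable_tailProfile d).comp (measurable_id.div_const ε)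
  exact ((this.const_mul a).add_const b).ennreal_ofReal

lemma HasTailBound.offDiagIntegrable (h : HasTailBound μ T β) {a b ε : ℝ} (ha : 0 ≤ a)
    (hb : 0 ≤ b) (hε : 0 < ε) (mk : Measurable k)
    (hk : ∀ z ∈ offDiag d, |k z| ≤ a * tailProfile d (‖z.1 - z.2‖ / ε) + b) :
    OffDiagIntegrable (pointMasses x) ((N : ℝ≥0∞) • μ) k :=
  offDiagIntegrable_of_radial (measurable_ofReal_tailProfile a b ε)
    (h.lintegral_add_const_le ha hb hε)
    (fun z hz => by
      rw [Real.enorm_eq_ofReal_abs]; exact ENNReal.ofReal_le_ofReal (hk z hz))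
    ⟨k, mk, fun _ _ => rfl⟩

lemma HasTailBound.abs_offDiagIntegral_sub_sum_le (h : HasTailBound μ T β)
    (hx : Function.Injective x) {a b ε : ℝ} (ha : 0 ≤ a) (hb : 0 ≤ b) (hε : 0 < ε)
    (hk : ∀ z ∈ offDiag d, |k z| ≤ a * tailProfile d (‖z.1 - z.2‖ / ε) + b) :
    |offDiagIntegral (pointMasses x) ((N : ℝ≥0∞) • μ) k -
      ∑ i, ∑ j ∈ Finset.univ.erase i, k (x i, x j)| ≤
        3 * (N : ℝ) ^ 2 * (a * (T * ε ^ ((d : ℝ) - β)) + b) := by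
  have hT := h.nonneg
  exact CoulombMF.abs_offDiagIntegral_sub_sum_le hx (by positivity)
    (measurable_ofReal_tailProfile a b ε) (h.lintegral_add_const_le ha hb hε)
    (fun z hz => by
      rw [Real.enorm_eq_ofReal_abs]; exact ENNReal.ofReal_le_ofReal (hk z hz))

end Pairs

/-! ### Integrability of the two kernels -/

lemma measurable_energyKernel (d : ℕ) : Measurable (energyKernel d) := by
  unfold energyKernel coulomb coulombRadial
  fun_prop

lemma measurable_commutatorKernel {v : Space d → Space d} (hv : Continuous v) :
    Measurable (commutatorKernel v) := by
  have hg : Measurable (gradient (coulomb d)) :=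
    ((InnerProductSpace.toDual ℝ (Space d)).symm.continuous.measurable).comp
      (measurable_fderiv ℝ (coulomb d))
  have hg' : Measurable fun z : Space d × Space d => gradient (coulomb d) (z.1 - z.2) :=
    hg.comp (by fun_prop)
  exact Measurable.inner (by fun_prop) hg'

lemma abs_commutatorKernel_le (hd : 3 ≤ d) (v : Space d → Space d) {z : Space d × Space d}
    (hz : z ∈ offDiag d) :
    |commutatorKernel v z| ≤
      ‖v z.1 - v z.2‖ * (coulombFieldConst d * ‖z.1 - z.2‖ ^ (1 - (d : ℝ))) := by
  have hr := norm_pos_of_mem_offDiag hz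
  rw [commutatorKernel, gradient_coulomb hd (norm_pos_iff.1 hr)]
  refine (abs_real_inner_le_norm _ _).trans ?_
  gcongr
  rw [rpow_one_sub_nat hd hr, ← div_eq_mul_inv, le_div_iff₀ (by positivity)]
  exact norm_heatField_mul_le hd le_rfl _

/-- Half a power of `r / ε` absorbs the logarithm of a log-Lipschitz modulus. -/
lemma rpow_mul_log_inv_le {r ε : ℝ} (hr : 0 < r) (hrε : r < ε) (hε : ε ≤ exp (-1)) :
    r ^ (2 - (d : ℝ)) * log r⁻¹ ≤
      3 * log ε⁻¹ * (ε ^ (2 - (d : ℝ)) * tailProfile d (r / ε)) := by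
  have hε0 : 0 < ε := hr.trans hrε
  have hl : 1 ≤ log ε⁻¹ := by
    rw [log_inv, le_neg, ← log_exp (-1)]; exact log_le_log hε0 hε
  have h1 : r / ε < 1 := (div_lt_one hε0).2 hrε
  have h2 : 0 < r / ε := by positivity
  set q := r / ε with hq
  have hrq : r = ε * q := by rw [hq, mul_div_cancel₀ _ hε0.ne']
  have hlog : log r⁻¹ = log ε⁻¹ + log q⁻¹ := by
    rw [hrq, mul_inv, log_mul (by positivity) (by positivity)]
  -- `ln t ≤ 2 √t`
  have h3 : log q⁻¹ ≤ 2 * q ^ (-(1 / 2 : ℝ)) := by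
    have := log_le_rpow_div (x := q⁻¹) (by positivity) (ε := 1 / 2) (by norm_num)
    rw [inv_rpow h2.le, ← rpow_neg h2.le] at this
    linarith
  have h4 : 1 ≤ q ^ (-(1 / 2 : ℝ)) := one_le_rpow_of_pos_of_le_one_of_nonpos h2 h1.le (by norm_num)
  have h5 : log r⁻¹ ≤ 3 * log ε⁻¹ * q ^ (-(1 / 2 : ℝ)) := by rw [hlog]; nlinarith
  rw [tailProfile, if_pos h1]
  calc r ^ (2 - (d : ℝ)) * log r⁻¹
      ≤ r ^ (2 - (d : ℝ)) * (3 * log ε⁻¹ * q ^ (-(1 / 2 : ℝ))) := by gcongr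
    _ = 3 * log ε⁻¹ * (ε ^ (2 - (d : ℝ)) * (q ^ (2 - (d : ℝ)) * q ^ (-(1 / 2 : ℝ)))) := by
        rw [hrq, mul_rpow hε0.le h2.le]; ring
    _ = _ := by rw [← rpow_add h2]; congr 3; ring

lemma mul_rpow_one_sub {r : ℝ} (hr : 0 < r) : r * r ^ (1 - (d : ℝ)) = r ^ (2 - (d : ℝ)) := by
  nth_rewrite 1 [← rpow_one r]
  rw [← rpow_add hr]
  congr 1; ring

section Integrability

variable {N : ℕ} {x : Fin N → Space d} {μ : Measure (Space d)} [IsProbabilityMeasure μ] {T β : ℝ}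

lemma HasTailBound.offDiagIntegrable_energyKernel (h : HasTailBound μ T β) (hd : 3 ≤ d) :
    OffDiagIntegrable (pointMasses x) ((N : ℝ≥0∞) • μ) (energyKernel d) := by
  have hc := coulombConst_pos hd
  have hd' : (3 : ℝ) ≤ d := by exact_mod_cast hd
  refine h.offDiagIntegrable hc.le hc.le one_pos (measurable_energyKernel d) fun z hz => ?_
  have hr := norm_pos_of_mem_offDiag hz
  have ht := tailProfile_nonneg (d := d) (div_nonneg hr.le zero_le_one)
  rw [energyKernel, coulomb, abs_of_pos (coulombRadial_pos hd hr), coulombRadial]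
  rcases lt_or_ge ‖z.1 - z.2‖ 1 with h1 | h1
  · have := rpow_le_tailProfile (d := d) hr h1
    rw [one_rpow, one_mul] at this
    nlinarith
  · have : ‖z.1 - z.2‖ ^ (2 - (d : ℝ)) ≤ 1 := rpow_le_one_of_one_le_of_nonpos h1 (by linarith)
    nlinarith [mul_nonneg hc.le ht]

lemma HasTailBound.offDiagIntegrable_commutatorKernel (h : HasTailBound μ T β) (hd : 3 ≤ d)
    {v : Space d → Space d} {A B : ℝ} (hv : Continuous v) (hA : 0 ≤ A) (hB : 0 ≤ B)
    (hvB : ∀ x, ‖v x‖ ≤ B)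
    (hvA : ∀ x y, ‖x - y‖ ≤ exp (-1) → ‖v x - v y‖ ≤ A * (‖x - y‖ * log ‖x - y‖⁻¹)) :
    OffDiagIntegrable (pointMasses x) ((N : ℝ≥0∞) • μ) (commutatorKernel v) := by
  have hd' : (3 : ℝ) ≤ d := by exact_mod_cast hd
  have hF := coulombFieldConst_pos hd
  set ε : ℝ := exp (-1) with hε
  have hε0 : 0 < ε := exp_pos _
  have hlε : log ε⁻¹ = 1 := by rw [hε, ← exp_neg, neg_neg, log_exp]
  refine h.offDiagIntegrable (a := A * coulombFieldConst d * 3 * ε ^ (2 - (d : ℝ)))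
    (b := 2 * B * (coulombFieldConst d * ε ^ (1 - (d : ℝ)))) (by positivity) (by positivity) hε0
    (measurable_commutatorKernel hv) fun z hz => (abs_commutatorKernel_le hd v hz).trans ?_
  have hr := norm_pos_of_mem_offDiag hz
  have ht := tailProfile_nonneg (d := d) (div_nonneg hr.le hε0.le)
  set r := ‖z.1 - z.2‖ with hrdef
  rcases lt_or_ge r ε with h1 | h1
  · refine le_trans ?_ (le_add_of_nonneg_right (by positivity))
    have h2 := rpow_mul_log_inv_le (d := d) hr h1 le_rfl
    rw [hlε] at h2
    calc _ ≤ A * (r * log r⁻¹) * (coulombFieldConst d * r ^ (1 - (d : ℝ))) := by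
          gcongr; exact hvA _ _ h1.le
      _ = A * coulombFieldConst d * (r ^ (2 - (d : ℝ)) * log r⁻¹) := by
          rw [← mul_rpow_one_sub hr]; ring
      _ ≤ A * coulombFieldConst d * (3 * 1 * (ε ^ (2 - (d : ℝ)) * tailProfile d (r / ε))) := by
          gcongr
      _ = _ := by ring
  · refine le_trans ?_ (le_add_of_nonneg_left (by positivity))
    gcongr ?_ * (_ * ?_)
    · exact (norm_sub_le _ _).trans (by linarith [hvB z.1, hvB z.2])
    · exact rpow_le_rpow_of_nonpos hε0 h1 (by linarith)

end Integrability

/-! ### Coercivity of the modulated energy -/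

/-- The Coulomb energy of the signed charge `∑ δ_{x_i} - N μ`, self-interactions included, with
interaction smeared by the heat kernel at time `τ`. -/
noncomputable def smearedEnergy {N : ℕ} (x : Fin N → Space d) (μ : Measure (Space d)) (τ : ℝ) : ℝ :=
  ∫ p : Space d × Space d, heatPot τ (p.1 - p.2) * (chargeSign x p.1 * chargeSign x p.2)
    ∂(pointMasses x + (N : ℝ≥0∞) • μ).prod (pointMasses x + (N : ℝ≥0∞) • μ)

section Energy

variable {N : ℕ} {x : Fin N → Space d} {μ : Measure (Space d)} [IsProbabilityMeasure μ] {T β : ℝ}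

lemma smearedEnergy_nonneg (hd : 3 ≤ d) {τ : ℝ} (hτ : 0 < τ) : 0 ≤ smearedEnergy x μ τ := by
  have := (smearedCommutator_form_le hd (half_pos hτ) (pointMasses x + (N : ℝ≥0∞) • μ)
    (measurable_chargeSign x) (abs_chargeSign_le x)).1
  rwa [mul_div_cancel₀ _ two_ne_zero] at this

lemma smearedEnergy_eq [NullSingletonClass μ] (hd : 3 ≤ d) (hx : Function.Injective x) {τ : ℝ}
    (hτ : 0 < τ) : smearedEnergy x μ τ =
      offDiagIntegral (pointMasses x) ((N : ℝ≥0∞) • μ) (fun z => heatPot τ (z.1 - z.2)) +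
        N * heatPot τ (0 : Space d) := by
  have hc : Continuous fun z : Space d × Space d => heatPot τ (z.1 - z.2) :=
    (continuous_heatPot hd hτ).comp (by fun_prop)
  have hi : Integrable (fun z : Space d × Space d => heatPot τ (z.1 - z.2))
      ((pointMasses x + (N : ℝ≥0∞) • μ).prod (pointMasses x + (N : ℝ≥0∞) • μ)) := by
    refine (integrable_const (heatPot τ (0 : Space d))).mono' hc.aestronglyMeasurable
      (Eventually.of_forall fun z => ?_)
    rw [norm_of_nonneg (heatPot_nonneg hτ.le _)]
    exact heatPot_le_at_zero hd hτ _
  rw [smearedEnergy, integral_chargeSign hx hi]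
  simp

/-- Smearing at a scale `K ε` large compared to `ε` loses at most half of the self-energy
`N c_d ε^{2-d}`, and the short-range part that is removed controls the close pairs. -/
lemma le_modulatedEnergy (hd : 3 ≤ d) : ∃ K c C : ℝ, 1 ≤ K ∧ 0 < c ∧ 0 < C ∧
    ∀ {N : ℕ} {x : Fin N → Space d} {μ : Measure (Space d)} [IsProbabilityMeasure μ]
      [NullSingletonClass μ] {T β : ℝ}, HasTailBound μ T β → Function.Injective x →
    ∀ {ε : ℝ}, 0 < ε →
      smearedEnergy x μ ((K * ε) ^ 2) + c * closePairs x ε ≤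
        modulatedEnergy x μ + 1 / 2 * (N * coulombRadial d ε) +
          C * ((N : ℝ) ^ 2 * (T * ε ^ (2 - β))) := by
  have hd' : (3 : ℝ) ≤ d := by exact_mod_cast hd
  have hcd := coulombConst_pos hd
  have hκ := heatConst_pos d
  obtain ⟨C, c, hC, hc, H⟩ := coulomb_sub_heatPot hd
  set ρ : ℝ := heatConst d / ((d : ℝ) / 2 - 1) / coulombConst d with hρ
  have hρ0 : 0 < ρ := by
    have : 0 < (d : ℝ) / 2 - 1 := by linarith
    positivity
  -- `G_{(Kε)²}(0) = ρ K^{2-d} g(ε) ≤ ρ K⁻¹ g(ε) ≤ g(ε) / 2`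
  set K : ℝ := max 1 (2 * ρ) with hK
  have hK1 : 1 ≤ K := le_max_left _ _
  have hKρ : 2 * ρ ≤ K := le_max_right _ _
  refine ⟨K, c, 3 * C * K ^ 2, hK1, hc, by positivity, ?_⟩
  intro N x μ _ _ T β hT hx ε hε
  have hT0 := hT.nonneg
  have hβ := hT.exponent_nonneg
  set η := K * ε with hη
  have hη0 : 0 < η := by positivity
  have hεη : ε ≤ η := le_mul_of_one_le_left hε.le hK1
  have hη2 : 0 < η ^ 2 := by positivity
  have hbound : ∀ z ∈ offDiag d, |energyKernel d z - heatPot (η ^ 2) (z.1 - z.2)| ≤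
      C * η ^ (2 - (d : ℝ)) * tailProfile d (‖z.1 - z.2‖ / η) + 0 := by
    intro z hz
    obtain ⟨h1, h2, -⟩ := H hη0 (z.1 - z.2) (sub_ne_zero.2 hz)
    rw [energyKernel, abs_of_nonneg h1, add_zero, mul_assoc]
    exact h2
  have cG : Continuous fun z : Space d × Space d => heatPot (η ^ 2) (z.1 - z.2) :=
    (continuous_heatPot hd hη2).comp (by fun_prop)
  have iS : OffDiagIntegrable (pointMasses x) ((N : ℝ≥0∞) • μ)
      (fun z => energyKernel d z - heatPot (η ^ 2) (z.1 - z.2)) :=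
    hT.offDiagIntegrable (by positivity) le_rfl hη0
      ((measurable_energyKernel d).sub cG.measurable) hbound
  have iG : OffDiagIntegrable (pointMasses x) ((N : ℝ≥0∞) • μ)
      (fun z => heatPot (η ^ 2) (z.1 - z.2)) := by
    refine hT.offDiagIntegrable (a := 0) (b := heatPot (η ^ 2) (0 : Space d)) le_rfl
      (heatPot_nonneg hη2.le _) hη0 cG.measurable fun z _ => ?_
    rw [zero_mul, zero_add, abs_of_nonneg (heatPot_nonneg hη2.le _)]
    exact heatPot_le_at_zero hd hη2 _
  have hsplit := offDiagIntegral_add iS iG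
  simp only [sub_add_cancel] at hsplit
  have hE := smearedEnergy_eq (μ := μ) hd hx hη2
  have hshort := hT.abs_offDiagIntegral_sub_sum_le hx (by positivity) le_rfl hη0 hbound
  have hpairs : c * closePairs x ε ≤ ∑ i, ∑ j ∈ Finset.univ.erase i,
      (energyKernel d (x i, x j) - heatPot (η ^ 2) ((x i, x j).1 - (x i, x j).2)) := by
    rw [closePairs, Finset.mul_sum]
    refine Finset.sum_le_sum fun i _ => ?_
    rw [Finset.mul_sum]
    refine Finset.sum_le_sum fun j hj => ?_
    obtain ⟨h1, -, h3⟩ := H hη0 (x i - x j) (norm_pos_iff.1 (norm_sub_pos hx hj))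
    split_ifs with h
    · exact h3 (h.trans hεη)
    · rw [mul_zero]; exact h1
  have hself : heatPot (η ^ 2) (0 : Space d) ≤ 1 / 2 * coulombRadial d ε := by
    have e1 : (η ^ 2) ^ (1 - (d : ℝ) / 2) = K ^ (2 - (d : ℝ)) * ε ^ (2 - (d : ℝ)) := by
      rw [← mul_rpow (by positivity) hε.le, ← hη, ← rpow_natCast, ← rpow_mul hη0.le]
      congr 1; push_cast; ring
    have e2 : K ^ (2 - (d : ℝ)) ≤ K⁻¹ := by
      rw [← rpow_neg_one]; exact rpow_le_rpow_of_exponent_le hK1 (by linarith)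
    have e3 : ρ * K⁻¹ ≤ 1 / 2 := by
      rw [← div_eq_mul_inv, div_le_iff₀ (by positivity)]; linarith
    rw [heatPot_at_zero hd hη2, e1, coulombRadial]
    calc heatConst d / ((d : ℝ) / 2 - 1) * (K ^ (2 - (d : ℝ)) * ε ^ (2 - (d : ℝ)))
        = ρ * K ^ (2 - (d : ℝ)) * (coulombConst d * ε ^ (2 - (d : ℝ))) := by
          rw [hρ]; field_simp
      _ ≤ ρ * K⁻¹ * (coulombConst d * ε ^ (2 - (d : ℝ))) := by gcongr
      _ ≤ _ := by gcongr
  have hmu : C * η ^ (2 - (d : ℝ)) * (T * η ^ ((d : ℝ) - β)) ≤ C * K ^ 2 * (T * ε ^ (2 - β)) := by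
    have e1 : η ^ (2 - (d : ℝ)) * η ^ ((d : ℝ) - β) = K ^ (2 - β) * ε ^ (2 - β) := by
      rw [← rpow_add hη0, ← mul_rpow (by positivity) hε.le]; congr 1; ring
    have e2 : K ^ (2 - β) ≤ K ^ 2 := by
      rw [← rpow_two]; exact rpow_le_rpow_of_exponent_le hK1 (by linarith)
    calc _ = C * T * (η ^ (2 - (d : ℝ)) * η ^ ((d : ℝ) - β)) := by ring
      _ = C * T * (K ^ (2 - β) * ε ^ (2 - β)) := by rw [e1]
      _ ≤ C * T * (K ^ 2 * ε ^ (2 - β)) := by gcongr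
      _ = _ := by ring
  rw [abs_le] at hshort
  have hN : (0 : ℝ) ≤ N := Nat.cast_nonneg N
  have h1 := mul_le_mul_of_nonneg_left hself hN
  have h2 := mul_le_mul_of_nonneg_left hmu (show (0 : ℝ) ≤ 3 * (N : ℝ) ^ 2 by positivity)
  have h3 : modulatedEnergy x μ = offDiagIntegral (pointMasses x) ((N : ℝ≥0∞) • μ)
      (fun z => energyKernel d z) := rfl
  linarith [hshort.1]

end Energy

/-! ### The commutator estimate for Lipschitz fields -/

lemma commutatorKernel_eq (hd : 3 ≤ d) (v : Space d → Space d) {z : Space d × Space d}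
    (hz : z ∈ offDiag d) :
    commutatorKernel v z = inner ℝ (v z.1 - v z.2) (heatField 0 (z.1 - z.2)) := by
  rw [commutatorKernel, gradient_coulomb hd (sub_ne_zero.2 hz)]

lemma measurable_smearedCommutator (hd : 3 ≤ d) {s : ℝ} (hs : 0 < s) {v : Space d → Space d}
    (hv : Continuous v) :
    Measurable fun z : Space d × Space d => smearedCommutator v s z.1 z.2 := by
  have cF := continuous_heatField hd hs
  have cK := continuous_heatKernel (d := d) s
  have : Continuous (Function.uncurry fun (p : Space d × Space d) z =>
      inner ℝ (v z) (heatField s (z - p.1)) * heatKernel s (z - p.2) +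
      inner ℝ (v z) (heatField s (z - p.2)) * heatKernel s (z - p.1)) := by
    simp only [Function.uncurry_def]
    fun_prop
  exact this.stronglyMeasurable.integral_prod_right.measurable

lemma abs_smearedCommutator_le (hd : 3 ≤ d) {s : ℝ} (hs : 0 < s) {v : Space d → Space d} {B : ℝ}
    (hv : ∀ z, ‖v z‖ ≤ B) (x y : Space d) : |smearedCommutator v s x y| ≤
      2 * (B * (heatConst d * s ^ ((1 - (d : ℝ)) / 2))) := by
  have hB : 0 ≤ B := (norm_nonneg _).trans (hv 0)
  have iK : ∀ a : Space d, Integrable fun z => heatKernel s (z - a) := fun a =>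
    (integrable_heatKernel hs).comp_sub_right a
  have eK : ∀ a : Space d, ∫ z, heatKernel s (z - a) = 1 := fun a => by
    rw [integral_sub_right_eq_self (heatKernel (d := d) s) a, integral_heatKernel hs]
  set D := B * (heatConst d * s ^ ((1 - (d : ℝ)) / 2)) with hD
  have hi : ∀ z a : Space d, |(inner ℝ (v z) (heatField s (z - a)) : ℝ)| ≤ D := fun z a =>
    (abs_real_inner_le_norm _ _).trans (mul_le_mul (hv z) (norm_heatField_le hd hs _)
      (norm_nonneg _) hB)
  have e : ∫ z, (D * heatKernel s (z - y) + D * heatKernel s (z - x)) = 2 * D := by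
    rw [integral_add ((iK y).const_mul D) ((iK x).const_mul D), integral_const_mul,
      integral_const_mul, eK, eK]
    ring
  rw [← e, smearedCommutator, ← Real.norm_eq_abs]
  refine norm_integral_le_of_norm_le (((iK y).const_mul D).add ((iK x).const_mul D))
    (Eventually.of_forall fun z => (norm_add_le _ _).trans ?_)
  simp only [norm_mul, Real.norm_eq_abs, abs_of_nonneg (heatKernel_nonneg hs.le _)]
  gcongr
  · exact heatKernel_nonneg hs.le _
  · exact hi z x
  · exact heatKernel_nonneg hs.le _
  · exact hi z y

/-- The commutator of a Lipschitz field, compared at scale `ε` with that of the smeared charges.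
The errors are the self-interactions, the pairs closer than a second scale `η`, and the effect of
smearing at distances beyond `η`. -/
lemma abs_offDiagIntegral_commutatorKernel_le (hd : 3 ≤ d) (K : ℝ) (hK : 1 ≤ K) :
    ∃ C : ℝ, 0 < C ∧
    ∀ {N : ℕ} {x : Fin N → Space d} {μ : Measure (Space d)} [IsProbabilityMeasure μ]
      [NullSingletonClass μ] {T β : ℝ}, HasTailBound μ T β → Function.Injective x →
    ∀ {u : Space d → Space d} {u' : Space d → Space d →L[ℝ] Space d} {B L : ℝ},
      IsC1Bounded u u' B L → ∀ {ε η : ℝ}, 0 < ε → 0 < η →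
      |offDiagIntegral (pointMasses x) ((N : ℝ≥0∞) • μ) (commutatorKernel u)| ≤
        C * L * (smearedEnergy x μ ((K * ε) ^ 2) + N * coulombRadial d ε + closePairs x η +
          (N : ℝ) ^ 2 * (ε / η ^ (d - 1)) + (N : ℝ) ^ 2 * (T * η ^ (2 - β))) := by
  have hd' : (3 : ℝ) ≤ d := by exact_mod_cast hd
  have hcd := coulombConst_pos hd
  have hK0 : 0 < K := by linarith
  obtain ⟨C, hC, H⟩ := abs_smearedCommutator_sub_le hd
  set S : ℝ := (1 / 2 : ℝ) ^ (1 - (d : ℝ) / 2) / coulombConst d with hS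
  have hS0 : 0 < S := by positivity
  refine ⟨(2 + d) + C * S + 4 * C * K + 4 * C, by positivity, ?_⟩
  intro N x μ _ _ T β hT hx u u' B L hu ε η hε hη
  have hL := hu.nonneg
  have hT0 := hT.nonneg
  have hQ0 := smearedEnergy_nonneg (x := x) (μ := μ) hd (τ := (K * ε) ^ 2) (by positivity)
  have hP0 := closePairs_nonneg x η
  -- smearing every charge at time `s` produces the interaction `G_{2s} = G_{(Kε)²}`
  set s := (K * ε) ^ 2 / 2 with hs
  have hs0 : 0 < s := by positivity
  obtain ⟨Hdiag, Hoff⟩ := H hs0 hu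
  have mk := measurable_smearedCommutator hd hs0 hu.continuous
  have hkb := abs_smearedCommutator_le hd hs0 hu.norm_le
  have hDb : 0 ≤ 2 * (B * (heatConst d * s ^ ((1 - (d : ℝ)) / 2))) := (abs_nonneg _).trans (hkb 0 0)
  have iκ : OffDiagIntegrable (pointMasses x) ((N : ℝ≥0∞) • μ)
      (fun z => smearedCommutator u s z.1 z.2) :=
    hT.offDiagIntegrable (a := 0) le_rfl hDb hη mk fun z _ => by simpa using hkb z.1 z.2
  have hsqrt : √s ≤ K * ε := by
    rw [sqrt_le_left (by positivity), hs]; nlinarith [sq_nonneg (K * ε)]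
  have hηpow : η ^ (1 - (d : ℝ)) = (η ^ (d - 1))⁻¹ := rpow_one_sub_nat hd hη
  have herr₁ : ∀ z ∈ offDiag d, |commutatorKernel u z - smearedCommutator u s z.1 z.2| ≤
      C * L * ‖z.1 - z.2‖ ^ (2 - (d : ℝ)) := fun z hz => by
    rw [commutatorKernel_eq hd u hz, abs_sub_comm]; exact (Hoff _ _ hz).1
  have herr₂ : ∀ z ∈ offDiag d, η ≤ ‖z.1 - z.2‖ →
      |commutatorKernel u z - smearedCommutator u s z.1 z.2| ≤
        C * L * (K * (ε / η ^ (d - 1))) := fun z hz h => by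
    rw [commutatorKernel_eq hd u hz, abs_sub_comm]
    refine (Hoff _ _ hz).2.trans ?_
    calc C * L * (√s * ‖z.1 - z.2‖ ^ (1 - (d : ℝ)))
        ≤ C * L * ((K * ε) * η ^ (1 - (d : ℝ))) := by
          gcongr ?_ * (?_ * ?_)
          exact rpow_le_rpow_of_nonpos hη h (by linarith)
      _ = _ := by rw [hηpow]; ring
  have hbound : ∀ z ∈ offDiag d, |commutatorKernel u z - smearedCommutator u s z.1 z.2| ≤
      C * L * η ^ (2 - (d : ℝ)) * tailProfile d (‖z.1 - z.2‖ / η) +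
        C * L * (K * (ε / η ^ (d - 1))) := by
    intro z hz
    have hr := norm_pos_of_mem_offDiag hz
    have ht := tailProfile_nonneg (d := d) (div_nonneg hr.le hη.le)
    rcases lt_or_ge ‖z.1 - z.2‖ η with h | h
    · refine ((herr₁ z hz).trans ?_).trans (le_add_of_nonneg_right (by positivity))
      rw [mul_assoc _ (η ^ _)]
      gcongr
      exact rpow_le_tailProfile hr h
    · exact (herr₂ z hz h).trans (le_add_of_nonneg_left (by positivity))
  have iE : OffDiagIntegrable (pointMasses x) ((N : ℝ≥0∞) • μ)
      (fun z => commutatorKernel u z - smearedCommutator u s z.1 z.2) :=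
    hT.offDiagIntegrable (by positivity) (by positivity) hη
      ((measurable_commutatorKernel hu.continuous).sub mk) hbound
  have hsplit := offDiagIntegral_add iE iκ
  simp only [sub_add_cancel] at hsplit
  have herr := hT.abs_offDiagIntegral_sub_sum_le hx (by positivity) (by positivity) hη hbound
  have hsum := abs_sum_pairs_le (x := x)
    (k := fun z => commutatorKernel u z - smearedCommutator u s z.1 z.2) (a := C * L)
    (b := C * L * (K * (ε / η ^ (d - 1)))) (ε := η) (by positivity)
    (fun i j hj _ => herr₁ _ (mk_mem_offDiag hx hj))
    (fun i j hj h => herr₂ _ (mk_mem_offDiag hx hj) h.le)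
  have hfull := integral_chargeSign (μ := μ) hx (K := fun z => smearedCommutator u s z.1 z.2)
    ((integrable_const _).mono' mk.aestronglyMeasurable
      (Eventually.of_forall fun z => hkb z.1 z.2))
  have hform := (smearedCommutator_form_le hd hs0 (pointMasses x + (N : ℝ≥0∞) • μ)
    (measurable_chargeSign x) (abs_chargeSign_le x)).2 hu
  rw [hfull, show 2 * s = (K * ε) ^ 2 by rw [hs]; ring, ← smearedEnergy] at hform
  have hself : |∑ i, smearedCommutator u s (x i) (x i)| ≤
      C * S * L * (N * coulombRadial d ε) := by
    have e1 : s ^ (1 - (d : ℝ) / 2) ≤ (1 / 2 : ℝ) ^ (1 - (d : ℝ) / 2) * ε ^ (2 - (d : ℝ)) := by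
      have e2 : s = 1 / 2 * (K * ε) ^ 2 := by rw [hs]; ring
      rw [e2, mul_rpow (by norm_num) (by positivity), ← rpow_natCast,
        ← rpow_mul (by positivity)]
      gcongr ?_ * ?_
      rw [show ((2 : ℕ) : ℝ) * (1 - (d : ℝ) / 2) = 2 - d by push_cast; ring]
      exact rpow_le_rpow_of_nonpos hε (le_mul_of_one_le_left hε.le hK) (by linarith)
    refine (Finset.abs_sum_le_sum_abs _ _).trans
      ((Finset.sum_le_sum fun i _ => Hdiag (x i)).trans ?_)
    rw [Finset.sum_const, Finset.card_univ, Fintype.card_fin, nsmul_eq_mul]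
    calc (N : ℝ) * (C * L * s ^ (1 - (d : ℝ) / 2))
        ≤ N * (C * L * ((1 / 2 : ℝ) ^ (1 - (d : ℝ) / 2) * ε ^ (2 - (d : ℝ)))) := by gcongr
      _ = _ := by rw [hS, coulombRadial]; field_simp
  have hmu : η ^ (2 - (d : ℝ)) * (T * η ^ ((d : ℝ) - β)) = T * η ^ (2 - β) := by
    rw [mul_left_comm, ← rpow_add hη]; congr 2; ring
  rw [mul_assoc (C * L), hmu] at herr
  have hN : (0 : ℝ) ≤ N := Nat.cast_nonneg N
  have hg := (coulombRadial_pos hd hε).le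
  set Q := smearedEnergy x μ ((K * ε) ^ 2)
  set P := closePairs x η
  set G := (N : ℝ) * coulombRadial d ε
  set e := ε / η ^ (d - 1)
  set U := T * η ^ (2 - β)
  have hG : 0 ≤ G := by positivity
  have he : 0 ≤ e := by positivity
  have hU : 0 ≤ U := by positivity
  have main : |offDiagIntegral (pointMasses x) ((N : ℝ≥0∞) • μ) (commutatorKernel u)| ≤
      (2 + d) * L * Q + C * S * L * G + (C * L * P + (N : ℝ) ^ 2 * (C * L * (K * e))) +
        3 * (N : ℝ) ^ 2 * (C * L * U + C * L * (K * e)) := by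
    have h3 : offDiagIntegral (pointMasses x) ((N : ℝ≥0∞) • μ) (commutatorKernel u) =
      offDiagIntegral (pointMasses x) ((N : ℝ≥0∞) • μ) (fun z => commutatorKernel u z) := rfl
    have a1 := abs_le.1 hform
    have a2 := abs_le.1 hself
    have a3 := abs_le.1 hsum
    have a4 := abs_le.1 herr
    rw [h3, abs_le]
    constructor <;> linarith only [a1.1, a1.2, a2.1, a2.2, a3.1, a3.2, a4.1, a4.2, hsplit]
  have p1 : 0 ≤ L * Q := by positivity
  have p2 : 0 ≤ L * G := by positivity
  have p3 : 0 ≤ L * P := by positivity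
  have p4 : 0 ≤ L * ((N : ℝ) ^ 2 * e) := by positivity
  have p5 : 0 ≤ L * ((N : ℝ) ^ 2 * U) := by positivity
  have q1 : 0 < C * S := by positivity
  have q2 : 0 < C * K := by positivity
  clear_value Q P G e U S
  set D : ℝ := (2 + d) + C * S + 4 * C * K + 4 * C with hD
  have r1 : 2 + (d : ℝ) ≤ D := by linarith
  have r2 : C * S ≤ D := by linarith
  have r3 : C ≤ D := by linarith
  have r4 : 4 * (C * K) ≤ D := by linarith
  have r5 : 3 * C ≤ D := by linarith
  calc _ ≤ _ := main
    _ = (2 + d) * (L * Q) + C * S * (L * G) + C * (L * P) + 4 * (C * K) * (L * ((N : ℝ) ^ 2 * e)) +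
        3 * C * (L * ((N : ℝ) ^ 2 * U)) := by ring
    _ ≤ D * (L * Q) + D * (L * G) + D * (L * P) + D * (L * ((N : ℝ) ^ 2 * e)) +
        D * (L * ((N : ℝ) ^ 2 * U)) := by gcongr
    _ = _ := by ring

/-! ### The commutator estimate for small log-Lipschitz fields -/

/-- The Hamiltonian bounds the logarithm of the distance of every sufficiently close pair: one pair
alone contributes `c_d r^{2-d} / 2 ≥ r^{-1/2}` to `N² H`. -/
lemma log_inv_norm_sub_le_lnPlus (hd : 3 ≤ d) {N : ℕ} {x : Fin N → Space d}
    (hx : Function.Injective x) {i j : Fin N} (hij : j ∈ Finset.univ.erase i)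
    (h1 : ‖x i - x j‖ ≤ 1) (h2 : ‖x i - x j‖ ≤ (coulombConst d / 2) ^ 2) :
    log ‖x i - x j‖⁻¹ ≤ 2 * lnPlus ((N : ℝ) ^ 2 * meanFieldHamiltonian x) := by
  have hd' : (3 : ℝ) ≤ d := by exact_mod_cast hd
  have hcd := coulombConst_pos hd
  have hr := norm_sub_pos hx hij
  have hN : (N : ℝ) ≠ 0 := by
    have : N ≠ 0 := by rintro rfl; exact i.elim0
    exact_mod_cast this
  have e : (N : ℝ) ^ 2 * meanFieldHamiltonian x =
      1 / 2 * ∑ i, ∑ j ∈ Finset.univ.erase i, coulomb d (x i - x j) := by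
    rw [meanFieldHamiltonian, hamiltonian]
    simp only [mul_assoc, ← Finset.mul_sum]
    field_simp
  have hg : ∀ i : Fin N, ∀ j ∈ Finset.univ.erase i, 0 ≤ coulomb d (x i - x j) := fun i j hj =>
    (coulombRadial_pos hd (norm_sub_pos hx hj)).le
  have hle : coulomb d (x i - x j) ≤ ∑ i, ∑ j ∈ Finset.univ.erase i, coulomb d (x i - x j) :=
    (Finset.single_le_sum (f := fun j => coulomb d (x i - x j)) (hg i) hij).trans
      (Finset.single_le_sum (f := fun i => ∑ j ∈ Finset.univ.erase i, coulomb d (x i - x j))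
        (fun i _ => Finset.sum_nonneg (hg i)) (Finset.mem_univ i))
  set r := ‖x i - x j‖ with hrdef
  have hpow : r ^ (-(1 / 2) : ℝ) ≤ 1 / 2 * coulomb d (x i - x j) := by
    have h3 : √r ≤ coulombConst d / 2 := (sqrt_le_left (by positivity)).2 h2
    calc r ^ (-(1 / 2) : ℝ) = √r * r ^ (-1 : ℝ) := by
          rw [sqrt_eq_rpow, ← rpow_add hr]; norm_num
      _ ≤ coulombConst d / 2 * r ^ (2 - (d : ℝ)) := by
          gcongr ?_ * ?_
          exact rpow_le_rpow_of_exponent_ge hr h1 (by linarith)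
      _ = _ := by rw [coulomb, coulombRadial, ← hrdef]; ring
  have hlog := log_le_log (by positivity) (hpow.trans (show _ ≤ (N : ℝ) ^ 2 *
    meanFieldHamiltonian x by rw [e]; linarith))
  rw [log_rpow hr] at hlog
  have := le_max_left (log ((N : ℝ) ^ 2 * meanFieldHamiltonian x)) 0
  rw [log_inv, lnPlus]
  linarith

/-- The commutator of a log-Lipschitz field whose oscillation is of order `ε^d ln ε⁻¹`. At distances
up to `η` (for pairs of points) or `ε` (for the background) the log-Lipschitz bound is used, beyond
that the smallness of the field; the power `ε^d` compensates the singularity `ε^{1-d}`. -/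
lemma abs_offDiagIntegral_commutatorKernel_le_of_small (hd : 3 ≤ d) : ∃ C : ℝ, 0 < C ∧
    ∀ {N : ℕ} {x : Fin N → Space d} {μ : Measure (Space d)} [IsProbabilityMeasure μ]
      {T β : ℝ}, HasTailBound μ T β → Function.Injective x →
    ∀ {w : Space d → Space d} {A ε η : ℝ}, 0 ≤ A → 0 < ε → ε ≤ η → η ≤ exp (-1) →
      η ≤ (coulombConst d / 2) ^ 2 →
      (∀ x y, ‖w x - w y‖ ≤ A * (ε ^ d * log ε⁻¹)) →
      (∀ x y, ‖x - y‖ ≤ exp (-1) → ‖w x - w y‖ ≤ A * (‖x - y‖ * log ‖x - y‖⁻¹)) →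
      |offDiagIntegral (pointMasses x) ((N : ℝ≥0∞) • μ) (commutatorKernel w)| ≤
        C * A * (lnPlus ((N : ℝ) ^ 2 * meanFieldHamiltonian x) * closePairs x η +
          (N : ℝ) ^ 2 * (ε * log ε⁻¹ / η ^ (d - 1)) +
          log ε⁻¹ * ((N : ℝ) ^ 2 * (T * ε ^ (2 - β)))) := by
  have hd' : (3 : ℝ) ≤ d := by exact_mod_cast hd
  have hF := coulombFieldConst_pos hd
  set c := coulombFieldConst d
  refine ⟨9 * c, by positivity, ?_⟩
  intro N x μ _ T β hT hx w A ε η hA hε hεη hη hη' hsmall hLL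
  have hT0 := hT.nonneg
  have hη0 : 0 < η := hε.trans_le hεη
  have hη1 : η ≤ 1 := hη.trans (exp_le_one_iff.2 (by norm_num))
  have hl : 1 ≤ log ε⁻¹ := by
    rw [log_inv, le_neg, ← log_exp (-1)]; exact log_le_log hε (hεη.trans hη)
  have hP0 := closePairs_nonneg x η
  have hΛ0 : 0 ≤ lnPlus ((N : ℝ) ^ 2 * meanFieldHamiltonian x) := le_max_right _ _
  -- beyond a distance `s ≥ ε` the kernel is small
  have hfar : ∀ {s : ℝ}, 0 < s → ∀ z ∈ offDiag d, s ≤ ‖z.1 - z.2‖ →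
      |commutatorKernel w z| ≤ A * (ε ^ d * log ε⁻¹) * (c * s ^ (1 - (d : ℝ))) := by
    intro s hs z hz h
    refine (abs_commutatorKernel_le hd w hz).trans ?_
    gcongr ?_ * (_ * ?_)
    · exact hsmall _ _
    · exact rpow_le_rpow_of_nonpos hs h (by linarith)
  have hnear : ∀ z ∈ offDiag d, ‖z.1 - z.2‖ ≤ exp (-1) →
      |commutatorKernel w z| ≤
        A * c * (‖z.1 - z.2‖ ^ (2 - (d : ℝ)) * log ‖z.1 - z.2‖⁻¹) := by
    intro z hz h
    have hr := norm_pos_of_mem_offDiag hz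
    calc _ ≤ A * (‖z.1 - z.2‖ * log ‖z.1 - z.2‖⁻¹) *
          (c * ‖z.1 - z.2‖ ^ (1 - (d : ℝ))) := by
          refine (abs_commutatorKernel_le hd w hz).trans ?_
          gcongr
          exact hLL _ _ h
      _ = _ := by rw [← mul_rpow_one_sub hr]; ring
  have hpow : ε ^ d * ε ^ (1 - (d : ℝ)) = ε := by
    rw [← rpow_natCast, ← rpow_add hε]; simp
  have hηp : 0 < η ^ (d - 1) := by positivity
  set b := ε * log ε⁻¹ / η ^ (d - 1) with hb
  have hb0 : 0 ≤ b := by positivity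
  have hεb : ε * log ε⁻¹ ≤ b := by
    rw [hb, le_div_iff₀ hηp]
    exact mul_le_of_le_one_right (by positivity) (pow_le_one₀ hη0.le hη1)
  have hbound : ∀ z ∈ offDiag d, |commutatorKernel w z| ≤
      A * c * (3 * log ε⁻¹) * ε ^ (2 - (d : ℝ)) * tailProfile d (‖z.1 - z.2‖ / ε) +
        A * c * b := by
    intro z hz
    have hr := norm_pos_of_mem_offDiag hz
    have ht := tailProfile_nonneg (d := d) (div_nonneg hr.le hε.le)
    rcases lt_or_ge ‖z.1 - z.2‖ ε with h | h
    · refine ((hnear z hz (h.le.trans (hεη.trans hη))).trans ?_).trans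
        (le_add_of_nonneg_right (by positivity))
      calc _ ≤ A * c * (3 * log ε⁻¹ *
            (ε ^ (2 - (d : ℝ)) * tailProfile d (‖z.1 - z.2‖ / ε))) := by
            exact mul_le_mul_of_nonneg_left (rpow_mul_log_inv_le hr h (hεη.trans hη))
              (by positivity)
        _ = _ := by ring
    · refine ((hfar hε z hz h).trans ?_).trans (le_add_of_nonneg_left (by positivity))
      calc A * (ε ^ d * log ε⁻¹) * (c * ε ^ (1 - (d : ℝ)))
          = A * c * (ε ^ d * ε ^ (1 - (d : ℝ)) * log ε⁻¹) := by ring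
        _ ≤ _ := by rw [hpow]; gcongr
  have hsub := hT.abs_offDiagIntegral_sub_sum_le hx (by positivity) (by positivity) hε hbound
  have hsum := abs_sum_pairs_le (x := x) (k := commutatorKernel w)
    (a := A * c * (2 * lnPlus ((N : ℝ) ^ 2 * meanFieldHamiltonian x))) (b := A * c * b) (ε := η)
    (by positivity)
    (fun i j hj h => by
      refine (hnear _ (mk_mem_offDiag hx hj) (h.trans hη)).trans ?_
      calc _ ≤ A * c * (‖x i - x j‖ ^ (2 - (d : ℝ)) *
            (2 * lnPlus ((N : ℝ) ^ 2 * meanFieldHamiltonian x))) := by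
            gcongr
            exact log_inv_norm_sub_le_lnPlus hd hx hj (h.trans hη1) (h.trans hη')
        _ = _ := by ring)
    (fun i j hj h => by
      refine (hfar hη0 _ (mk_mem_offDiag hx hj) h.le).trans ?_
      have h1 : ε ^ d ≤ ε := pow_le_of_le_one hε.le (hεη.trans hη1) (by omega)
      rw [rpow_one_sub_nat hd hη0]
      calc A * (ε ^ d * log ε⁻¹) * (c * (η ^ (d - 1))⁻¹)
          ≤ A * (ε * log ε⁻¹) * (c * (η ^ (d - 1))⁻¹) := by gcongr
        _ = _ := by rw [hb]; ring)
  have hmu : ε ^ (2 - (d : ℝ)) * (T * ε ^ ((d : ℝ) - β)) = T * ε ^ (2 - β) := by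
    rw [mul_left_comm, ← rpow_add hε]; congr 2; ring
  rw [mul_assoc (A * c * _), hmu] at hsub
  have hU : 0 ≤ T * ε ^ (2 - β) := by positivity
  set Λ := lnPlus ((N : ℝ) ^ 2 * meanFieldHamiltonian x)
  set P := closePairs x η
  set U := T * ε ^ (2 - β)
  have a1 := abs_le.1 hsub
  have a2 := abs_le.1 hsum
  have main : |offDiagIntegral (pointMasses x) ((N : ℝ≥0∞) • μ) (commutatorKernel w)| ≤
      A * c * (2 * Λ) * P + (N : ℝ) ^ 2 * (A * c * b) +
        3 * (N : ℝ) ^ 2 * (A * c * (3 * log ε⁻¹) * U + A * c * b) := by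
    rw [abs_le]
    constructor <;> linarith only [a1.1, a1.2, a2.1, a2.2]
  have p1 : 0 ≤ A * c * (Λ * P) := by positivity
  have p2 : 0 ≤ A * c * ((N : ℝ) ^ 2 * b) := by positivity
  refine main.trans ?_
  linarith only [p1, p2]

/-! ### The commutator estimate for log-Lipschitz fields -/

lemma commutatorKernel_add_sub (v u : Space d → Space d) (z : Space d × Space d) :
    commutatorKernel u z + commutatorKernel (fun x => v x - u x) z = commutatorKernel v z := by
  simp only [commutatorKernel]
  rw [← inner_add_left]
  congr 1; abel

/-- The coercivity bounds at the scales `ε₁` and `ε₄` (constants `Qᵢ`, `Pᵢ`, `Gᵢ`, `Uᵢ` for the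
smeared energy, the close pairs, the self-energy and the background at scale `εᵢ`) make
`F + G₁ + 2 C₁ U₄` a nonnegative quantity that dominates `Q₁`, `G₁`, `P₄` and `U₄`. In the same way
`F + G₃ + 2 C₁ U₃` dominates `P₃`. -/
lemma combine_energy_bounds
    {c C₁ D₁ D₂ A Λ l F Q₁ Q₃ Q₄ P₁ P₃ P₄ G₁ G₃ G₄ U₁ U₂ U₃ U₄ e f : ℝ}
    (hc : 0 < c) (hC₁ : 0 < C₁) (hD₁0 : 0 ≤ D₁) (hD₂0 : 0 ≤ D₂) (hA : 0 ≤ A) (hΛ0 : 0 ≤ Λ)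
    (hl : 1 ≤ l)
    (E1 : Q₁ + c * P₁ ≤ F + 1 / 2 * G₁ + C₁ * U₁) (E3 : Q₃ + c * P₃ ≤ F + 1 / 2 * G₃ + C₁ * U₃)
    (E4 : Q₄ + c * P₄ ≤ F + 1 / 2 * G₄ + C₁ * U₄)
    (q1 : 0 ≤ Q₁) (q3 : 0 ≤ Q₃) (q4 : 0 ≤ Q₄) (r1 : 0 ≤ P₁) (r3 : 0 ≤ P₃) (r4 : 0 ≤ P₄)
    (Ng1 : 0 ≤ G₁) (Ng3 : 0 ≤ G₃) (Ng41 : G₄ ≤ G₁) (Nu14 : U₁ ≤ U₄) (Nu24 : U₂ ≤ U₄)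
    (NU3 : 0 ≤ U₃) (NU4 : 0 ≤ U₄) (Ne : 0 ≤ e) (Nf : 0 ≤ f) :
    D₁ * (A * l * (Q₁ + G₁ + P₄ + e + U₄)) + D₂ * (A * (Λ * P₃ + f + l * U₂)) ≤
      (D₁ * (4 + 1 / c + 1 / C₁) + D₂ * (1 + 1 / c + 1 / C₁)) *
        (A * l * (F + G₁ + 2 * C₁ * U₄) + A * Λ * (F + G₃ + 2 * C₁ * U₃) + A * l * e +
          A * f) := by
  have hCU : C₁ * U₁ ≤ C₁ * U₄ := by gcongr
  have hCU4 : 0 ≤ C₁ * U₄ := by positivity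
  have hCU3 : 0 ≤ C₁ * U₃ := by positivity
  have hcP1 : 0 ≤ c * P₁ := by positivity
  have hcP4 : 0 ≤ c * P₄ := by positivity
  have hcP3 : 0 ≤ c * P₃ := by positivity
  set Y := F + G₁ + 2 * C₁ * U₄ with hY
  set X := F + G₃ + 2 * C₁ * U₃ with hX
  have y1 : Q₁ + G₁ ≤ 3 * Y := by linarith
  have y2 : P₄ ≤ 1 / c * Y := by
    rw [one_div, inv_mul_eq_div, le_div_iff₀ hc]; linarith
  have y3 : U₄ ≤ 1 / C₁ * Y := by
    rw [one_div, inv_mul_eq_div, le_div_iff₀ hC₁]; linarith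
  have x1 : P₃ ≤ 1 / c * X := by
    rw [one_div, inv_mul_eq_div, le_div_iff₀ hc]; linarith
  have hY0 : 0 ≤ Y := by linarith
  have hX0 : 0 ≤ X := by linarith
  have hl0 : 0 ≤ l := by linarith
  have ic : 0 ≤ 1 / c := by positivity
  have iC : 0 ≤ 1 / C₁ := by positivity
  set a := 1 / c
  set b := 1 / C₁
  have t1 : 0 ≤ A * l * Y := by positivity
  have t2 : 0 ≤ A * Λ * X := by positivity
  have t3 : 0 ≤ A * l * e := by positivity
  have t4 : 0 ≤ A * f := by positivity
  have hS₁ : A * l * (Q₁ + G₁ + P₄ + e + U₄) ≤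
      (4 + a + b) * (A * l * Y + A * Λ * X + A * l * e + A * f) := by
    calc A * l * (Q₁ + G₁ + P₄ + e + U₄) ≤ A * l * (3 * Y + a * Y + e + b * Y) := by gcongr
      _ = (3 + a + b) * (A * l * Y) + A * l * e := by ring
      _ ≤ (4 + a + b) * (A * l * Y) + (4 + a + b) * (A * l * e) +
          (4 + a + b) * (A * Λ * X + A * f) := by
          have k1 : 3 + a + b ≤ 4 + a + b := by linarith
          have k2 : 1 ≤ 4 + a + b := by linarith
          have k3 := mul_le_mul_of_nonneg_right k1 t1
          have k4 := mul_le_mul_of_nonneg_right k2 t3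
          have k5 : 0 ≤ (4 + a + b) * (A * Λ * X + A * f) := by positivity
          linarith only [k3, k4, k5]
      _ = _ := by ring
  have hS₂ : A * (Λ * P₃ + f + l * U₂) ≤
      (1 + a + b) * (A * l * Y + A * Λ * X + A * l * e + A * f) := by
    calc A * (Λ * P₃ + f + l * U₂) ≤ A * (Λ * (a * X) + f + l * (b * Y)) := by
          gcongr
          exact Nu24.trans y3
      _ = a * (A * Λ * X) + A * f + b * (A * l * Y) := by ring
      _ ≤ (1 + a + b) * (A * Λ * X) + (1 + a + b) * (A * f) + (1 + a + b) * (A * l * Y) +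
          (1 + a + b) * (A * l * e) := by
          have k1 : a ≤ 1 + a + b := by linarith
          have k2 : 1 ≤ 1 + a + b := by linarith
          have k6 : b ≤ 1 + a + b := by linarith
          have k3 := mul_le_mul_of_nonneg_right k1 t2
          have k4 := mul_le_mul_of_nonneg_right k2 t4
          have k7 := mul_le_mul_of_nonneg_right k6 t1
          have k5 : 0 ≤ (1 + a + b) * (A * l * e) := by positivity
          linarith only [k3, k4, k5, k7]
      _ = _ := by ring
  have m₁ := mul_le_mul_of_nonneg_left hS₁ hD₁0
  have m₂ := mul_le_mul_of_nonneg_left hS₂ hD₂0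
  linarith only [m₁, m₂]

/-- The commutator estimate before normalization by `N²`, with the two energies that bound it
spelled out: one at the scales `ε₁, ε₄` controls the mollified field, the other at the scale `ε₃`
the remainder. -/
lemma abs_offDiagIntegral_commutatorKernel_le_of_logLipschitz (hd : 3 ≤ d) :
    ∃ C C' : ℝ, 0 < C ∧ 0 < C' ∧ ∀ {N : ℕ} {x : Fin N → Space d} {μ : Measure (Space d)}
      [IsProbabilityMeasure μ] [NullSingletonClass μ] {T β : ℝ}, HasTailBound μ T β →
      Function.Injective x → ∀ v : Space d →ᵇ Space d, IsLogLipschitz v →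
    ∀ {ε₁ ε₂ ε₃ ε₄ : ℝ}, 0 < ε₁ → ε₁ < ε₂ → ε₂ < ε₃ → ε₂ < ε₄ → ε₃ ≤ exp (-1) →
      ε₃ ≤ (coulombConst d / 2) ^ 2 →
      |offDiagIntegral (pointMasses x) ((N : ℝ≥0∞) • μ) (commutatorKernel v)| ≤
        C * (logLipNorm v * log ε₂⁻¹ * (modulatedEnergy x μ + N * coulombRadial d ε₁ +
            C' * ((N : ℝ) ^ 2 * (T * ε₄ ^ (2 - β)))) +
          logLipNorm v * lnPlus ((N : ℝ) ^ 2 * meanFieldHamiltonian x) *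
            (modulatedEnergy x μ + N * coulombRadial d ε₃ +
              C' * ((N : ℝ) ^ 2 * (T * ε₃ ^ (2 - β)))) +
          logLipNorm v * log ε₂⁻¹ * ((N : ℝ) ^ 2 * (ε₁ / ε₄ ^ (d - 1))) +
          logLipNorm v * ((N : ℝ) ^ 2 * (ε₂ * log ε₂⁻¹ / ε₃ ^ (d - 1)))) := by
  have hd' : (3 : ℝ) ≤ d := by exact_mod_cast hd
  have hcd := coulombConst_pos hd
  obtain ⟨K, c, C₁, hK, hc, hC₁, HE⟩ := le_modulatedEnergy hd
  obtain ⟨C₂, hC₂, HU⟩ := abs_offDiagIntegral_commutatorKernel_le hd K hK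
  obtain ⟨C₃, hC₃, HW⟩ := abs_offDiagIntegral_commutatorKernel_le_of_small hd
  obtain ⟨C₀, hC₀, HM⟩ := exists_mollification d
  set D₁ : ℝ := C₂ * (C₀ * d) with hD₁
  have hD₁0 : 0 < D₁ := by positivity
  set D₂ : ℝ := C₃ * (2 * d) with hD₂
  have hD₂0 : 0 < D₂ := by positivity
  refine ⟨D₁ * (4 + 1 / c + 1 / C₁) + D₂ * (1 + 1 / c + 1 / C₁), 2 * C₁, by positivity,
    by positivity, ?_⟩
  intro N x μ _ _ T β hT hx v hv ε₁ ε₂ ε₃ ε₄ h1 h12 h23 h24 h3 h3'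
  have hA := logLipNorm_nonneg v
  have hT0 := hT.nonneg
  have hβ := hT.exponent_le
  have h2 : 0 < ε₂ := h1.trans h12
  have hl : 1 ≤ log ε₂⁻¹ := by
    rw [log_inv, le_neg, ← log_exp (-1)]; exact log_le_log h2 (h23.le.trans h3)
  have hε₂1 : ε₂ ≤ 1 := (h23.le.trans h3).trans (exp_le_one_iff.2 (by norm_num))
  have hδ : ε₂ ^ d ≤ exp (-1) :=
    (pow_le_of_le_one h2.le hε₂1 (by omega)).trans (h23.le.trans h3)
  -- with `δ = ε₂^d` the logarithm of `δ` is still comparable to that of `ε₂`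
  obtain ⟨u, u', hu, huv, huLL⟩ := HM v hv (pow_pos h2 d) hδ
  have hlogδ : log (ε₂ ^ d)⁻¹ = d * log ε₂⁻¹ := by rw [← inv_pow, log_pow]
  rw [hlogδ] at hu huv
  have hvLL : ∀ x y, ‖x - y‖ ≤ exp (-1) →
      ‖v x - v y‖ ≤ logLipNorm v * (‖x - y‖ * log ‖x - y‖⁻¹) := fun x y h =>
    norm_sub_le_logLip hv h
  set A := logLipNorm v
  set l := log ε₂⁻¹
  set w : Space d → Space d := fun x => v x - u x with hw
  have hwsub : ∀ x y, w x - w y = (v x - v y) - (u x - u y) := fun x y => by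
    simp only [hw]; abel
  have hlogr : ∀ x y : Space d, ‖x - y‖ ≤ exp (-1) → 0 ≤ ‖x - y‖ * log ‖x - y‖⁻¹ := by
    intro x y h
    rcases (norm_nonneg (x - y)).eq_or_lt with h0 | h0
    · rw [← h0]; simp
    · exact mul_nonneg h0.le (log_nonneg ((one_le_inv₀ h0).2
        (h.trans (exp_le_one_iff.2 (by norm_num)))))
  have hwLL : ∀ x y, ‖x - y‖ ≤ exp (-1) →
      ‖w x - w y‖ ≤ 2 * d * A * (‖x - y‖ * log ‖x - y‖⁻¹) := by
    intro x y h
    rw [hwsub]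
    refine (norm_sub_le _ _).trans ((add_le_add (hvLL x y h) (huLL x y h)).trans ?_)
    have := mul_nonneg hA (hlogr x y h)
    nlinarith
  have hwsmall : ∀ x y, ‖w x - w y‖ ≤ 2 * d * A * (ε₂ ^ d * l) := by
    intro x y
    refine (norm_sub_le _ _).trans ((add_le_add (huv x) (huv y)).trans (le_of_eq ?_))
    ring
  have iu : OffDiagIntegrable (pointMasses x) ((N : ℝ≥0∞) • μ) (commutatorKernel u) :=
    hT.offDiagIntegrable_commutatorKernel hd hu.continuous hA (norm_nonneg v) hu.norm_le huLL
  have iw : OffDiagIntegrable (pointMasses x) ((N : ℝ≥0∞) • μ) (commutatorKernel w) :=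
    hT.offDiagIntegrable_commutatorKernel hd (v.continuous.sub hu.continuous)
      (by positivity) (by positivity : 0 ≤ ‖v‖ + ‖v‖)
      (fun z => (norm_sub_le _ _).trans (add_le_add (v.norm_coe_le_norm z) (hu.norm_le z))) hwLL
  have hsplit := offDiagIntegral_add iu iw
  have e0 : offDiagIntegral (pointMasses x) ((N : ℝ≥0∞) • μ) (commutatorKernel v) =
      offDiagIntegral (pointMasses x) ((N : ℝ≥0∞) • μ)
        (fun z => commutatorKernel u z + commutatorKernel w z) :=
    offDiagIntegral_congr fun z _ => (commutatorKernel_add_sub v u z).symm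
  have Bu := HU hT hx hu h1 (h2.trans h24)
  have Bw := HW hT hx (w := w) (A := 2 * d * A) (by positivity) h2 h23.le h3 h3' hwsmall hwLL
  have E1 := HE hT hx h1
  have E3 := HE hT hx (h2.trans h23)
  have E4 := HE hT hx (h2.trans h24)
  have q3 := smearedEnergy_nonneg (x := x) (μ := μ) hd (τ := (K * ε₃) ^ 2)
    (by have := h2.trans h23; positivity)
  have q4 := smearedEnergy_nonneg (x := x) (μ := μ) hd (τ := (K * ε₄) ^ 2)
    (by have := h2.trans h24; positivity)
  have q1 := smearedEnergy_nonneg (x := x) (μ := μ) hd (τ := (K * ε₁) ^ 2) (by positivity)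
  have r1 := closePairs_nonneg x ε₁
  have r3 := closePairs_nonneg x ε₃
  have r4 := closePairs_nonneg x ε₄
  have hΛ0 : 0 ≤ lnPlus ((N : ℝ) ^ 2 * meanFieldHamiltonian x) := le_max_right _ _
  have g1 := (coulombRadial_pos hd h1).le
  have g3 := (coulombRadial_pos hd (h2.trans h23)).le
  have g41 : coulombRadial d ε₄ ≤ coulombRadial d ε₁ := by
    rw [coulombRadial, coulombRadial]
    gcongr ?_ * ?_
    exact rpow_le_rpow_of_nonpos h1 (h12.trans h24).le (by linarith)
  have u14 : T * ε₁ ^ (2 - β) ≤ T * ε₄ ^ (2 - β) := by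
    gcongr ?_ * ?_
    exact rpow_le_rpow h1.le (h12.trans h24).le (by linarith)
  have u24 : T * ε₂ ^ (2 - β) ≤ T * ε₄ ^ (2 - β) := by
    gcongr ?_ * ?_
    exact rpow_le_rpow h2.le h24.le (by linarith)
  have hU3 : 0 ≤ T * ε₃ ^ (2 - β) := by have := h2.trans h23; positivity
  have hU4 : 0 ≤ T * ε₄ ^ (2 - β) := by have := h2.trans h24; positivity
  have he : 0 ≤ ε₁ / ε₄ ^ (d - 1) := by have := h2.trans h24; positivity
  have hf : 0 ≤ ε₂ * l / ε₃ ^ (d - 1) := by have := h2.trans h23; positivity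
  have hN : (0 : ℝ) ≤ N := Nat.cast_nonneg N
  have Ng1 := mul_nonneg hN g1
  have Ng3 := mul_nonneg hN g3
  have Ng41 := mul_le_mul_of_nonneg_left g41 hN
  have hN2 : (0 : ℝ) ≤ (N : ℝ) ^ 2 := sq_nonneg _
  have Nu14 := mul_le_mul_of_nonneg_left u14 hN2
  have Nu24 := mul_le_mul_of_nonneg_left u24 hN2
  have NU3 := mul_nonneg hN2 hU3
  have NU4 := mul_nonneg hN2 hU4
  have Ne := mul_nonneg hN2 he
  have Nf := mul_nonneg hN2 hf
  rw [e0, hsplit]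
  refine (abs_add_le _ _).trans ((add_le_add Bu Bw).trans ?_)
  have fin := combine_energy_bounds hc hC₁ hD₁0.le hD₂0.le hA hΛ0 hl E1 E3 E4 q1 q3 q4 r1 r3 r4
    Ng1 Ng3 Ng41 Nu14 Nu24 NU3 NU4 Ne Nf
  refine le_trans (le_of_eq ?_) fin
  rw [hD₁, hD₂]; ring

/-! ### The estimate for densities in `L^p` -/

lemma exists_hasTailBound (hd : 3 ≤ d) {p : ℝ≥0∞} (hp : (d : ℝ≥0∞) < p) :
    ∃ K : ℝ, 0 < K ∧ ∀ (μ : Measure (Space d)) [IsProbabilityMeasure μ], HasLpDensity μ p →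
      HasTailBound μ (K * densityNorm μ p) (d * recip p) := by
  obtain ⟨K, hK, H⟩ := lintegral_tailProfile_le hd hp
  refine ⟨K, hK, fun μ _ hμ => ⟨mul_nonneg hK.le ENNReal.toReal_nonneg,
    mul_nonneg (Nat.cast_nonneg d) ENNReal.toReal_nonneg, ?_, fun hε x => H μ hμ hε x⟩⟩
  have hd0 : (d : ℝ≥0∞) ≠ 0 := by exact_mod_cast (by omega : d ≠ 0)
  have h1 : recip p ≤ (d : ℝ)⁻¹ := by
    rw [recip, ← ENNReal.toReal_natCast d, ← ENNReal.toReal_inv]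
    exact ENNReal.toReal_mono (ENNReal.inv_ne_top.2 hd0) (ENNReal.inv_le_inv.2 hp.le)
  have hdpos : (0 : ℝ) < d := by exact_mod_cast (by omega : 0 < d)
  calc (d : ℝ) * recip p ≤ d * (d : ℝ)⁻¹ := by gcongr
    _ = 1 := mul_inv_cancel₀ hdpos.ne'

lemma HasLpDensity.nullSingletonClass (hd : 3 ≤ d) {μ : Measure (Space d)} {p : ℝ≥0∞}
    (hμ : HasLpDensity μ p) : NullSingletonClass μ := by
  have : Nonempty (Fin d) := ⟨⟨0, by omega⟩⟩
  exact ⟨fun y => hμ.1 (measure_singleton y)⟩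

end CoulombMF

open CoulombMF in
theorem proposition4p1 (d : ℕ) (hd : 3 ≤ d) :
    ∃ C : ℝ, 0 < C ∧ ∃ ε₀ : ℝ, 0 < ε₀ ∧
    ∀ p : ℝ≥0∞, (d : ℝ≥0∞) < p → ∃ Cp : ℝ, 0 < Cp ∧
    ∀ (μ : Measure (Space d)) [IsProbabilityMeasure μ], HasLpDensity μ p →
    ∀ v : Space d →ᵇ Space d, IsLogLipschitz v →
    ∀ (N : ℕ), 1 ≤ N → ∀ x : Fin N → Space d, Function.Injective x →
      OffDiagIntegrable (pointMasses x) ((N : ℝ≥0∞) • μ) (energyKernel d) ∧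
      OffDiagIntegrable (pointMasses x) ((N : ℝ≥0∞) • μ) (commutatorKernel v) ∧
      ∀ ε₁ ε₂ ε₃ ε₄ : ℝ, 0 < 2 * ε₁ → 2 * ε₁ < ε₂ → ε₂ < ε₃ → ε₂ < ε₄ → ε₃ < ε₀ → ε₄ < ε₀ →
        (1 / (N : ℝ) ^ 2) *
            |offDiagIntegral (pointMasses x) ((N : ℝ≥0∞) • μ) (commutatorKernel v)| ≤
          C * (
            logLipNorm v * (lnPlus ((N : ℝ) ^ 2 * meanFieldHamiltonian x) + Real.log ε₂⁻¹) *
              modulatedEnergyAvg x μ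
            + logLipNorm v *
                (Real.log ε₂⁻¹ * coulombRadial d ε₁ +
                  lnPlus ((N : ℝ) ^ 2 * meanFieldHamiltonian x) * coulombRadial d ε₃) / (N : ℝ)
            + Cp * logLipNorm v * densityNorm μ p *
                (Real.log ε₂⁻¹ * ε₄ ^ (2 - (d : ℝ) * recip p) +
                  lnPlus ((N : ℝ) ^ 2 * meanFieldHamiltonian x) *
                    ε₃ ^ (2 - (d : ℝ) * recip p))
            + ε₁ / ε₄ ^ (d - 1) * (‖v‖ / ε₄ + logLipNorm v * Real.log ε₁⁻¹)
            + logLipNorm v *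
                densityNorm μ p ^ (((d : ℝ) - 1) / ((d : ℝ) * (1 - recip p))) *
                (ε₁ * Real.log ε₁⁻¹)
            + logLipNorm v * (ε₂ * Real.log ε₂⁻¹) *
                (1 / ε₃ ^ (d - 1) +
                  densityNorm μ p ^ (((d : ℝ) - 1) / ((d : ℝ) * (1 - recip p))))
            + ‖v‖ *
                (densityNorm μ p * ε₁ ^ (1 - (d : ℝ) * recip p) +
                  if p = ∞ then densityNorm μ ∞ * (ε₁ * Real.log ε₁⁻¹) else 0)) := by
  obtain ⟨C, C', hC, hC', H⟩ := abs_offDiagIntegral_commutatorKernel_le_of_logLipschitz hd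
  have hcd := coulombConst_pos hd
  refine ⟨C, hC, min (Real.exp (-1)) ((coulombConst d / 2) ^ 2), by positivity, ?_⟩
  intro p hp
  obtain ⟨Kp, hKp, hTail⟩ := exists_hasTailBound hd hp
  refine ⟨C' * Kp, by positivity, ?_⟩
  intro μ _ hμ v hv N hN x hx
  have hT := hTail μ hμ
  have : NullSingletonClass μ := hμ.nullSingletonClass hd
  have hA := logLipNorm_nonneg v
  refine ⟨hT.offDiagIntegrable_energyKernel hd,
    hT.offDiagIntegrable_commutatorKernel hd v.continuous hA (norm_nonneg v)
      v.norm_coe_le_norm (fun x y h => norm_sub_le_logLip hv h), ?_⟩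
  intro ε₁ ε₂ ε₃ ε₄ h1 h12 h23 h24 h3 h4
  obtain ⟨h3e, h3c⟩ := lt_min_iff.1 h3
  obtain ⟨h4e, -⟩ := lt_min_iff.1 h4
  have h1' : 0 < ε₁ := by linarith
  have h12' : ε₁ < ε₂ := by linarith
  have h2' : 0 < ε₂ := h1'.trans h12'
  have h3' : 0 < ε₃ := h2'.trans h23
  have h4' : 0 < ε₄ := h2'.trans h24
  have key := H hT hx v hv h1' h12' h23 h24 h3e.le h3c.le
  have hl21 : Real.log ε₂⁻¹ ≤ Real.log ε₁⁻¹ := by gcongr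
  have hε₂1 : ε₂ ≤ 1 := (h23.trans h3e).le.trans (Real.exp_le_one_iff.2 (by norm_num))
  have hl2 : 0 ≤ Real.log ε₂⁻¹ := Real.log_nonneg ((one_le_inv₀ h2').2 hε₂1)
  have hM : 0 ≤ densityNorm μ p := ENNReal.toReal_nonneg
  have hM' : 0 ≤ densityNorm μ ∞ := ENNReal.toReal_nonneg
  have hNpos : (0 : ℝ) < N := by exact_mod_cast hN
  have hl1 := hl2.trans hl21
  -- the terms of the right-hand side that `key` does not produce are nonnegative
  have n1 : 0 ≤ ε₁ / ε₄ ^ (d - 1) * (‖v‖ / ε₄) := by positivity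
  have n2 : ε₁ / ε₄ ^ (d - 1) * (logLipNorm v * Real.log ε₂⁻¹) ≤
      ε₁ / ε₄ ^ (d - 1) * (logLipNorm v * Real.log ε₁⁻¹) := by gcongr
  have n3 : 0 ≤ logLipNorm v * densityNorm μ p ^ (((d : ℝ) - 1) / ((d : ℝ) * (1 - recip p))) *
      (ε₁ * Real.log ε₁⁻¹) := by positivity
  have n4 : 0 ≤ logLipNorm v * (ε₂ * Real.log ε₂⁻¹) *
      densityNorm μ p ^ (((d : ℝ) - 1) / ((d : ℝ) * (1 - recip p))) := by positivity
  have n5 : 0 ≤ ‖v‖ * (densityNorm μ p * ε₁ ^ (1 - (d : ℝ) * recip p) +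
      if p = ∞ then densityNorm μ ∞ * (ε₁ * Real.log ε₁⁻¹) else 0) := by
    split_ifs <;> positivity
  rw [one_div, inv_mul_eq_div]
  refine (div_le_div_of_nonneg_right key (by positivity)).trans ?_
  rw [mul_div_assoc]
  refine mul_le_mul_of_nonneg_left ?_ hC.le
  have e : ∀ a b F g₁ g₃ U₄ U₃ E f : ℝ,
      (a * (F + N * g₁ + C' * ((N : ℝ) ^ 2 * U₄)) + b * (F + N * g₃ + C' * ((N : ℝ) ^ 2 * U₃)) +
        a * ((N : ℝ) ^ 2 * E) + logLipNorm v * ((N : ℝ) ^ 2 * f)) / (N : ℝ) ^ 2 =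
      (b + a) * (F / (N : ℝ) ^ 2) + (a * g₁ + b * g₃) / N + C' * (a * U₄ + b * U₃) + a * E +
        logLipNorm v * f := by
    intro a b F g₁ g₃ U₄ U₃ E f
    field_simp
    ring
  rw [e, ← modulatedEnergyAvg]
  have e2 : ε₂ * Real.log ε₂⁻¹ / ε₃ ^ (d - 1) = ε₂ * Real.log ε₂⁻¹ * (1 / ε₃ ^ (d - 1)) := by ring
  have e3 : logLipNorm v * (Real.log ε₂⁻¹ * coulombRadial d ε₁ +
      lnPlus ((N : ℝ) ^ 2 * meanFieldHamiltonian x) * coulombRadial d ε₃) / (N : ℝ) =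
      (logLipNorm v * Real.log ε₂⁻¹ * coulombRadial d ε₁ + logLipNorm v *
        lnPlus ((N : ℝ) ^ 2 * meanFieldHamiltonian x) * coulombRadial d ε₃) / N := by ring
  rw [e2, e3]
  linarith only [n1, n2, n3, n4, n5]
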